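/- Let $n,m,d\ge 1$ be integers, $1<p<\infty$ and $p'=p/(p-1)$. A cube in $\mathbb{R}^n$ is a product of $n$ bounded left-closed, right-open intervals of the same positive length; a rectangle in $\mathbb{R}^n\times\mathbb{R}^m$ is a product $R=R_1\times R_2$ of a cube $R_1\subset\mathbb{R}^n$ and a cube $R_2\subset\mathbb{R}^m$. Write $\langle f\rangle_E=|E|^{-1}\int_E f$, and let $|A|$ denote the operator norm of $A\in M_d(\mathbb{C})$ on Euclidean $\mathbb{C}^d$. A $d\times d$ matrix weight is a locally integrable $M_d(\mathbb{C})$-valued function that is positive definite a.e.; a matrix weight $W$ on $\mathbb{R}^n\times\mathbb{R}^m$ is a biparameter $A_p$ weight if $$[W]_{A_p}:=\sup_R \frac1{|R|}\int_R\Big(\frac1{|R|}\int_R|W(x)^{1/p}W(y)^{-1/p}|^{p'}dy\Big)^{p/p'}dx<\infty,$$ the supremum being over all rectangles. Put $W':=W^{-1/(p-1)}$. A reducing operator of $W$ over $E$ with respect to the exponent $p$ is a positive definite matrix $\mathcal{W}_E$ with $$\Big(\frac1{|E|}\int_E|W(x)^{1/p}e|^pdx\Big)^{1/p}\le|\mathcal{W}_Ee|\le\sqrt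 d\,\Big(\frac1{|E|}\int_E|W(x)^{1/p}e|^pdx\Big)^{1/p}\qquad\text{for all }e\in\mathbb{C}^d.$$ Reducing operators $\mathcal{U}_E,\mathcal{V}_E$ of $U,V$ are taken with respect to $p$, reducing operators $\mathcal{U}'_E,\mathcal{V}'_E$ of $U',V'$ with respect to $p'$, and all of them may be chosen arbitrarily. Let $U,V$ be biparameter $d\times d$ matrix $A_p$ weights on $\mathbb{R}^n\times\mathbb{R}^m$ and let $B:\mathbb{R}^n\times\mathbb{R}^m\to M_d(\mathbb{C})$ be locally integrable. Define, with values in $[0,\infty]$ and suprema over all rectangles $R$, $$\|B\|_{\mathrm{bmo}(U,V,p)}=\sup_R\Big(\frac1{|R|}\int_R|V(x)^{1/p}(B(x)-\langle B\rangle_R)\,\mathcal{U}_R^{-1}|^pdx\Big)^{1/p},\qquad \|B\|_{\widetilde{\mathrm{bmo}}(U,V,p)}=\sup_R\frac1{|R|}\int_R|\mathcal{V}_R(B(x)-\langle B\rangle_R)\,\mathcal{U}_R^{-1}|dx,$$ $$\|B\|_{\mathrm{bmo}^1(U,V,p)}=\sup_R\Big(\frac1{|R|}\int_R\Big(\frac1{|R|}\int_R|V(x)^{1/p}(B(x)-B(y))U(y)^{-1/p}|^{p'}dy\Big)^{p/p'}dx\Big)^{1/p},$$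 $$\|B\|_{\mathrm{bmo}^2(U,V,p)}=\sup_R\Big(\frac1{|R|}\int_R\Big(\frac1{|R|}\int_R|V(x)^{1/p}(B(x)-B(y))U(y)^{-1/p}|^{p}dx\Big)^{p'/p}dy\Big)^{1/p'}.$$ The norms $\|B^*\|_{\mathrm{bmo}(V',U',p')}$ and $\|B^*\|_{\widetilde{\mathrm{bmo}}(V',U',p')}$ are obtained by replacing $(B,U,V,p)$ by $(B^*,V',U',p')$, where $B^*(x)$ is the adjoint of $B(x)$. The one-parameter norm $\|\cdot\|_{\mathrm{BMO}(U,V,p)}$ on $\mathbb{R}^n$ (or $\mathbb{R}^m$) is defined as $\|\cdot\|_{\mathrm{bmo}(U,V,p)}$ with rectangles replaced by cubes. For $x=(x_1,x_2)$ write $F_{x_2}=F(\cdot,x_2)$ and $F_{x_1}=F(x_1,\cdot)$. Then $$\|B\|_{\mathrm{bmo}(U,V,p)}\sim\max\Big(\operatorname*{ess\,sup}_{x_2\in\mathbb{R}^m}\|B_{x_2}\|_{\mathrm{BMO}(U_{x_2},V_{x_2},p)},\ \operatorname*{ess\,sup}_{x_1\in\mathbb{R}^n}\|B_{x_1}\|_{\mathrm{BMO}(U_{x_1},V_{x_1},p)}\Big),$$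 $$\|B\|_{\mathrm{bmo}(U,V,p)}\sim\|B^*\|_{\mathrm{bmo}(V',U',p')}\sim\|B\|_{\widetilde{\mathrm{bmo}}(U,V,p)}\sim\|B^*\|_{\widetilde{\mathrm{bmo}}(V',U',p')},$$ $$\|B\|_{\mathrm{bmo}(U,V,p)}\sim\|B\|_{\mathrm{bmo}^1(U,V,p)}\sim\|B\|_{\mathrm{bmo}^2(U,V,p)}.$$ Here $a\sim b$ means $a\le Cb$ and $b\le Ca$ (in particular one side is infinite if and only if the other is), where $0<C<\infty$ depends only on $n,m,p,d$ and on upper bounds for $[U]_{A_p}$ and $[V]_{A_p}$. -/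

import Mathlib

open MeasureTheory Set
open scoped ENNReal NNReal Matrix Matrix.Norms.L2Operator ComplexOrder

namespace LittleBMO

noncomputable section

/-- `M_d(ℂ)`.  Its norm is the operator norm on the Euclidean space `ℂ^d`
(the largest singular value). -/
abbrev Mat (d : ℕ) : Type := Matrix (Fin d) (Fin d) ℂ

/-- The real power `A ^ r` of a (positive definite) matrix, by functional calculus. -/
def mpow {d : ℕ} (A : Mat d) (r : ℝ) : Mat d := cfc (fun t : ℝ => t ^ r) A

/-- The cubes in `ℝⁿ`: products of left-closed, right-open intervals of equal positive length. -/
def cubes (n : ℕ) : Set (Set (Fin n → ℝ)) :=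
  {Q | ∃ (a : Fin n → ℝ) (l : ℝ), 0 < l ∧ Q = Set.pi univ (fun i => Ico (a i) (a i + l))}

/-- The rectangles in `ℝⁿ × ℝᵐ`: products of a cube in `ℝⁿ` and a cube in `ℝᵐ`. -/
def rectangles (n m : ℕ) : Set (Set ((Fin n → ℝ) × (Fin m → ℝ))) :=
  {R | ∃ P ∈ cubes n, ∃ Q ∈ cubes m, R = P ×ˢ Q}

section Norms

variable {X : Type*} [MeasureSpace X] {d : ℕ}

/-- The dual weight `W' = W ^ (-1 / (p - 1))`. -/
def dualWeight (p : ℝ) (W : X → Mat d) : X → Mat d := fun x => mpow (W x) (-1 / (p - 1))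

/-- The matrix `A_p` characteristic
`sup_R ⨍_R (⨍_R |W(x)^{1/p} W(y)^{-1/p}|^{p'} dy)^{p/p'} dx` over a basis `𝓕` of sets
(cubes in the one-parameter case, rectangles in the biparameter case). -/
def apChar (𝓕 : Set (Set X)) (p : ℝ) (W : X → Mat d) : ℝ≥0∞ :=
  ⨆ R ∈ 𝓕, ⨍⁻ x in R, (⨍⁻ y in R,
    ‖mpow (W x) (1 / p) * mpow (W y) (-1 / p)‖ₑ ^ p.conjExponent ∂volume) ^ (p / p.conjExponent)
    ∂volume

/-- A matrix weight: locally integrable and almost everywhere positive definite. -/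
def IsMatrixWeight [TopologicalSpace X] (W : X → Mat d) : Prop :=
  LocallyIntegrable W volume ∧ ∀ᵐ x, (W x).PosDef

/-- A matrix `A_p` weight with respect to the basis `𝓕`. -/
def IsMatrixAp [TopologicalSpace X] (𝓕 : Set (Set X)) (p : ℝ) (W : X → Mat d) : Prop :=
  IsMatrixWeight W ∧ apChar 𝓕 p W < ∞

/-- The average `(⨍_E |W(x)^{1/p} e|^p dx)^{1/p}` for a vector `e`. -/
def weightedAvg (p : ℝ) (W : X → Mat d) (E : Set X) (e : EuclideanSpace ℂ (Fin d)) : ℝ≥0∞ :=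
  (⨍⁻ x in E, ‖Matrix.toEuclideanLin (mpow (W x) (1 / p)) e‖ₑ ^ p ∂volume) ^ (1 / p)

/-- `A` is a reducing operator of `W` over `E` with respect to the exponent `p`:
`A` is positive definite and
`(⨍_E |W^{1/p} e|^p)^{1/p} ≤ |A e| ≤ √d (⨍_E |W^{1/p} e|^p)^{1/p}` for all `e`. -/
def IsReducing (p : ℝ) (W : X → Mat d) (E : Set X) (A : Mat d) : Prop :=
  A.PosDef ∧ ∀ e : EuclideanSpace ℂ (Fin d),
    weightedAvg p W E e ≤ ‖Matrix.toEuclideanLin A e‖ₑ ∧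
    ‖Matrix.toEuclideanLin A e‖ₑ ≤ ENNReal.ofReal (Real.sqrt d) * weightedAvg p W E e

/-- `𝓦` chooses, for every set `E` of the basis `𝓕`, a reducing operator `𝓦 E` of `W` over `E`
with respect to the exponent `p`. -/
def IsReducingFamily (𝓕 : Set (Set X)) (p : ℝ) (W : X → Mat d) (𝓦 : Set X → Mat d) : Prop :=
  ∀ E ∈ 𝓕, IsReducing p W E (𝓦 E)

/-- `sup_R (⨍_R |V(x)^{1/p} (B(x) - ⟨B⟩_R) 𝒰_R⁻¹|^p dx)^{1/p}`, the supremum over the sets `R` of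
the basis `𝓕`.  With `𝓤 R` a reducing operator of `U` over `R` this is the norm `BMO(U,V,p)`
(over cubes) or `bmo(U,V,p)` (over rectangles). -/
def bmoNorm (𝓕 : Set (Set X)) (p : ℝ) (𝓤 : Set X → Mat d) (V B : X → Mat d) : ℝ≥0∞ :=
  ⨆ R ∈ 𝓕, (⨍⁻ x in R,
    ‖mpow (V x) (1 / p) * (B x - ⨍ y in R, B y) * (𝓤 R)⁻¹‖ₑ ^ p ∂volume) ^ (1 / p)

/-- `sup_R ⨍_R |𝒱_R (B(x) - ⟨B⟩_R) 𝒰_R⁻¹| dx`, with `𝓤 R`, `𝓥 R` reducing operators of `U`, `V`. -/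
def bmoTildeNorm (𝓕 : Set (Set X)) (𝓤 𝓥 : Set X → Mat d) (B : X → Mat d) : ℝ≥0∞ :=
  ⨆ R ∈ 𝓕, ⨍⁻ x in R, ‖𝓥 R * (B x - ⨍ y in R, B y) * (𝓤 R)⁻¹‖ₑ ∂volume

/-- The first pointwise variant
`sup_R (⨍_R (⨍_R |V(x)^{1/p} (B(x) - B(y)) U(y)^{-1/p}|^{p'} dy)^{p/p'} dx)^{1/p}`. -/
def bmoOneNorm (𝓕 : Set (Set X)) (p : ℝ) (U V B : X → Mat d) : ℝ≥0∞ :=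
  ⨆ R ∈ 𝓕, (⨍⁻ x in R, (⨍⁻ y in R,
    ‖mpow (V x) (1 / p) * (B x - B y) * mpow (U y) (-1 / p)‖ₑ ^ p.conjExponent ∂volume)
      ^ (p / p.conjExponent) ∂volume) ^ (1 / p)

/-- The second pointwise variant
`sup_R (⨍_R (⨍_R |V(x)^{1/p} (B(x) - B(y)) U(y)^{-1/p}|^p dx)^{p'/p} dy)^{1/p'}`. -/
def bmoTwoNorm (𝓕 : Set (Set X)) (p : ℝ) (U V B : X → Mat d) : ℝ≥0∞ :=
  ⨆ R ∈ 𝓕, (⨍⁻ y in R, (⨍⁻ x in R,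
    ‖mpow (V x) (1 / p) * (B x - B y) * mpow (U y) (-1 / p)‖ₑ ^ p ∂volume)
      ^ (p.conjExponent / p) ∂volume) ^ (1 / p.conjExponent)

end Norms

/-- The two extended nonnegative quantities `a`, `b` are comparable with constant `C`. -/
def Comparable (C : ℝ≥0) (a b : ℝ≥0∞) : Prop := a ≤ C * b ∧ b ≤ C * a

end

end LittleBMO

namespace LittleBMO

/-! ### Real powers of positive definite matrices -/

section Mpow

variable {d : ℕ} {A : Mat d}

/-! On a fixed rectangle everything is expressed through a probability measure `ν`, the mutually
inverse functions `w = W^{1/p}` and `wi = W^{-1/p}`, and reducing matrices `A`, `A'` of `w` in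
`L^p(ν)` and of `wi` in `L^{p'}(ν)`. The `A_p` condition enters only as a bound on `|A A'|`; a bound
on `|A⁻¹ A'⁻¹|` follows from Hölder's inequality. Since `(W')^{1/p'} = W^{-1/p}`, duality exchanges
`w` with `wi` and `A` with `A'` (`IsRedPair.swap`), so each estimate serves twice, for `B` and for
its adjoint.

Four comparisons hold on each rectangle separately, by inserting `w wi = 1` or `A A⁻¹ = 1` and
applying Hölder: the reduced oscillation is bounded by the weighted one (`oscTilde_le_osc`), by its
dual (`oscTilde_le_oscTilde_dual`) and by the pointwise variant (`oscTilde_le_oscOne`), while the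
pointwise variant is bounded by the weighted oscillation plus its dual (`oscOne_le`).

Bounding the weighted oscillation by the reduced one needs all subrectangles: it is a John–Nirenberg
inequality (`DyadicSystem.lpNorm_cellAvg_le`). Halving all sides at once keeps the eccentricity of a
rectangle, so below a given rectangle the theory is of one-parameter dyadic type. With `T` the
supremum of the reduced oscillations, one proves `‖v (B_k - ⟨B⟩) M‖_p ≤ C T ‖u M‖_p` for all
matrices `M` and all dyadic averages `B_k`, by induction on `k`. Cells on which the reduced
oscillation first exceeds `2T` cover at most half of the rectangle. Outside them the reduced
oscillation is pointwise bounded, and inside them the induction hypothesis applies, where `|u M|^p`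
has at most a fixed proportion `θ < 1` of its mass (`IsRedPair.setLIntegral_le`). The recursion `C =
c + C θ^{1/p}` closes. Differentiation of integrals and Fatou's lemma then let `k` tend to infinity.

For the slices, the reduced oscillation on `P × Q` is at most the sum of the deviations from the
averages in each variable (`oscTilde_prod_le_add`), and Hölder in the two variables in turn reduces
each of them to slices. Conversely, the weighted inequality with arbitrary `M` makes sense on a
slice, and it is reached by shrinking `Q` to a point. Countable dense sets of cubes, of matrices `M`
and of constants replacing `⟨B⟩ M` make the exceptional null set independent of all choices
(`ae_slice_lpNorm_le`). -/

theorem spectrum_pos_of_posDef (hA : A.PosDef) {t : ℝ} (ht : t ∈ spectrum ℝ A) : 0 < t := by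
  open scoped MatrixOrder in
  exact (Matrix.PosDef.isStrictlyPositive hA).spectrum_pos ht

theorem continuousOn_rpow_spectrum (hA : A.PosDef) (r : ℝ) :
    ContinuousOn (fun t : ℝ => t ^ r) (spectrum ℝ A) := fun t ht =>
  (Real.continuousAt_rpow_const t r (Or.inl (spectrum_pos_of_posDef hA ht).ne')).continuousWithinAt

theorem mpow_isHermitian (A : Mat d) (r : ℝ) : (mpow A r).IsHermitian :=
  cfc_predicate (R := ℝ) (p := IsSelfAdjoint) (fun t : ℝ => t ^ r) A

theorem mpow_mpow (hA : A.PosDef) (r s : ℝ) : mpow (mpow A r) s = mpow A (r * s) := by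
  have h := cfc_comp' (fun t : ℝ => t ^ s) (fun t : ℝ => t ^ r) A
    (by
      rintro _ ⟨t, ht, rfl⟩
      exact (Real.continuousAt_rpow_const _ s (Or.inl
        (Real.rpow_pos_of_pos (spectrum_pos_of_posDef hA ht) r).ne')).continuousWithinAt)
    (continuousOn_rpow_spectrum hA r) hA.1
  rw [mpow, mpow, ← h, mpow]
  exact cfc_congr fun t ht => (Real.rpow_mul (spectrum_pos_of_posDef hA ht).le r s).symm

theorem mpow_mul_mpow_neg (hA : A.PosDef) (r : ℝ) : mpow A r * mpow A (-r) = 1 := by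
  rw [mpow, mpow, ← cfc_mul _ _ A (continuousOn_rpow_spectrum hA r)
    (continuousOn_rpow_spectrum hA (-r)), ← cfc_const_one ℝ A hA.1]
  refine cfc_congr fun t ht => ?_
  have := spectrum_pos_of_posDef hA ht
  rw [← Real.rpow_add this, add_neg_cancel, Real.rpow_zero]

/-- The restriction to positive definite matrices matters: a negative power is discontinuous at `0`,
whereas the spectra here stay in the open half-line, on which every power is continuous. -/
theorem continuous_mpow_posDef (r : ℝ) :
    Continuous fun A : {A : Mat d // A.PosDef} => mpow A.1 r := by
  rw [← continuousOn_univ]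
  refine ContinuousOn.cfc_of_mem_nhdsSet (s := Ioi (0 : ℝ)) (fun t : ℝ => t ^ r) ?_
    continuous_subtype_val.continuousOn (fun x _ => x.2.1) ?_
  · refine isOpen_Ioi.mem_nhdsSet.2 (iUnion₂_subset fun A _ t ht => ?_)
    exact spectrum_pos_of_posDef A.2 ht
  · exact fun t ht => (Real.continuousAt_rpow_const t r (Or.inl (ne_of_gt ht))).continuousWithinAt

theorem aestronglyMeasurable_mpow {X : Type*} [MeasurableSpace X] {μ : Measure X} {W : X → Mat d}
    (hW : AEStronglyMeasurable W μ) (hpos : ∀ᵐ x ∂μ, (W x).PosDef) (r : ℝ) :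
    AEStronglyMeasurable (fun x => mpow (W x) r) μ := by
  classical
  -- Redefining the weight as `1` on the exceptional null set makes it take values in the domain of
  -- the continuous power map.
  let W' : X → {A : Mat d // A.PosDef} := fun x =>
    if h : (W x).PosDef then ⟨W x, h⟩ else ⟨1, Matrix.PosDef.one⟩
  have hW' : ∀ᵐ x ∂μ, W x = (W' x).1 := by
    filter_upwards [hpos] with x hx
    simp [W', hx]
  have h1 : AEStronglyMeasurable (fun x => (W' x).1) μ := hW.congr hW'
  have h2 : AEStronglyMeasurable W' μ :=
    (Topology.IsEmbedding.subtypeVal.aestronglyMeasurable_comp_iff).1 h1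
  refine ((continuous_mpow_posDef r).comp_aestronglyMeasurable h2).congr ?_
  filter_upwards [hW'] with x hx
  simp [hx]

end Mpow

/-! ### Operator norms -/

section Norms

variable {d : ℕ}

theorem enorm_mat_mul_le (A B : Mat d) : ‖A * B‖ₑ ≤ ‖A‖ₑ * ‖B‖ₑ := by
  simp only [enorm_eq_nnnorm, ← ENNReal.coe_mul]
  exact_mod_cast nnnorm_mul_le A B

theorem enorm_mat_mul₃_le (A B C : Mat d) : ‖A * B * C‖ₑ ≤ ‖A‖ₑ * ‖B‖ₑ * ‖C‖ₑ :=
  (enorm_mat_mul_le _ _).trans (mul_le_mul_left (enorm_mat_mul_le A B) _)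

theorem enorm_conjTranspose (A : Mat d) : ‖Aᴴ‖ₑ = ‖A‖ₑ := by
  simp only [enorm_eq_nnnorm]
  exact congrArg _ (NNReal.eq (Matrix.l2_opNorm_conjTranspose A))

theorem enorm_mul_comm_of_isHermitian {A B : Mat d} (hA : A.IsHermitian) (hB : B.IsHermitian) :
    ‖A * B‖ₑ = ‖B * A‖ₑ := by
  rw [← enorm_conjTranspose, Matrix.conjTranspose_mul, hA.eq, hB.eq]

theorem enorm_mat_one_le : ‖(1 : Mat d)‖ₑ ≤ 1 := by
  rcases isEmpty_or_nonempty (Fin d) with h | h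
  · simp [Subsingleton.elim (1 : Mat d) 0]
  · simp [enorm_eq_nnnorm]

theorem enorm_toEuclideanLin_le (A : Mat d) (e : EuclideanSpace ℂ (Fin d)) :
    ‖Matrix.toEuclideanLin A e‖ₑ ≤ ‖A‖ₑ * ‖e‖ₑ := by
  simp only [enorm_eq_nnnorm, ← ENNReal.coe_mul]
  exact_mod_cast Matrix.l2_opNorm_mulVec A e

theorem enorm_toEuclideanLin_single_le (A : Mat d) (j : Fin d) :
    ‖Matrix.toEuclideanLin A (EuclideanSpace.single j 1)‖ₑ ≤ ‖A‖ₑ := by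
  refine (enorm_toEuclideanLin_le A _).trans ?_
  simp [enorm_eq_nnnorm]

/-- An operator is controlled by its columns, at the cost of a factor depending on the dimension.
This turns the defining inequalities of reducing operators, which concern vectors, into inequalities
for matrices. -/
theorem enorm_le_sum_single (A : Mat d) :
    ‖A‖ₑ ≤ ∑ j, ‖Matrix.toEuclideanLin A (EuclideanSpace.single j 1)‖ₑ := by
  have key : ‖A‖ ≤ ∑ j, ‖Matrix.toEuclideanLin A (EuclideanSpace.single j 1)‖ := by
    rw [Matrix.l2_opNorm_def]
    refine ContinuousLinearMap.opNorm_le_bound _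
      (Finset.sum_nonneg fun j _ => norm_nonneg _) fun e => ?_
    have he : e = ∑ j, e j • EuclideanSpace.single j (1 : ℂ) := by
      ext i
      simp [Pi.single_apply]
    calc ‖Matrix.toEuclideanLin A e‖
        = ‖∑ j, e j • Matrix.toEuclideanLin A (EuclideanSpace.single j (1 : ℂ))‖ := by
          conv_lhs => rw [he]
          rw [map_sum]
          simp only [map_smul]
      _ ≤ ∑ j, ‖Matrix.toEuclideanLin A (EuclideanSpace.single j (1 : ℂ))‖ * ‖e‖ := by
          refine (norm_sum_le _ _).trans (Finset.sum_le_sum fun j _ => ?_)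
          rw [norm_smul, mul_comm]
          exact mul_le_mul_of_nonneg_left (PiLp.norm_apply_le e j) (norm_nonneg _)
      _ = _ := by rw [Finset.sum_mul]
  have := ENNReal.ofReal_le_ofReal key
  rw [ENNReal.ofReal_sum_of_nonneg fun j _ => norm_nonneg _] at this
  simpa only [ofReal_norm] using this

end Norms

/-! ### Lebesgue norms of nonnegative functions -/

section LpNorm

variable {X : Type*} [MeasurableSpace X] {p q : ℝ} {ν : Measure X} {f g : X → ℝ≥0∞}

/-- The `L^p` norm of a nonnegative function. -/
noncomputable def lpNorm (p : ℝ) (ν : Measure X) (f : X → ℝ≥0∞) : ℝ≥0∞ :=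
  (∫⁻ x, f x ^ p ∂ν) ^ (1 / p)

theorem lpNorm_mono_ae (hp : 0 ≤ p) (h : ∀ᵐ x ∂ν, f x ≤ g x) : lpNorm p ν f ≤ lpNorm p ν g :=
  ENNReal.rpow_le_rpow (lintegral_mono_ae (h.mono fun _ hx => ENNReal.rpow_le_rpow hx hp))
    (by positivity)

theorem lpNorm_mono (hp : 0 ≤ p) (h : ∀ x, f x ≤ g x) : lpNorm p ν f ≤ lpNorm p ν g :=
  lpNorm_mono_ae hp (ae_of_all _ h)

theorem lpNorm_congr_ae (h : ∀ᵐ x ∂ν, f x = g x) : lpNorm p ν f = lpNorm p ν g := by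
  unfold lpNorm
  rw [lintegral_congr_ae (g := fun x => g x ^ p) (h.mono fun x hx => by simp only [hx])]

theorem lpNorm_rpow (hp : 0 < p) : lpNorm p ν f ^ p = ∫⁻ x, f x ^ p ∂ν := by
  rw [lpNorm, ← ENNReal.rpow_mul, one_div, inv_mul_cancel₀ hp.ne', ENNReal.rpow_one]

theorem lpNorm_const_mul (hp : 0 < p) {c : ℝ≥0∞} (hc : c ≠ ∞) :
    lpNorm p ν (fun x => c * f x) = c * lpNorm p ν f := by
  simp only [lpNorm, ENNReal.mul_rpow_of_nonneg _ _ hp.le]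
  rw [lintegral_const_mul' _ _ (ENNReal.rpow_ne_top_of_nonneg hp.le hc),
    ENNReal.mul_rpow_of_nonneg _ _ (by positivity), ← ENNReal.rpow_mul, mul_one_div_cancel hp.ne',
    ENNReal.rpow_one]

theorem lpNorm_mul_const (hp : 0 < p) {c : ℝ≥0∞} (hc : c ≠ ∞) :
    lpNorm p ν (fun x => f x * c) = lpNorm p ν f * c := by
  simp only [mul_comm _ c, lpNorm_const_mul hp hc]

theorem lpNorm_add_le (hp : 1 ≤ p) (hf : AEMeasurable f ν) (hg : AEMeasurable g ν) :
    lpNorm p ν (fun x => f x + g x) ≤ lpNorm p ν f + lpNorm p ν g :=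
  ENNReal.lintegral_Lp_add_le hf hg hp

theorem lintegral_mul_le_lpNorm (hpq : p.HolderConjugate q) (hf : AEMeasurable f ν)
    (hg : AEMeasurable g ν) : ∫⁻ x, f x * g x ∂ν ≤ lpNorm p ν f * lpNorm q ν g :=
  ENNReal.lintegral_mul_le_Lp_mul_Lq ν hpq hf hg

theorem lpNorm_sum_le {ι : Type*} (s : Finset ι) (hp : 1 ≤ p) {f : ι → X → ℝ≥0∞}
    (hf : ∀ i ∈ s, AEMeasurable (f i) ν) :
    lpNorm p ν (fun x => ∑ i ∈ s, f i x) ≤ ∑ i ∈ s, lpNorm p ν (f i) := by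
  classical
  induction s using Finset.induction_on with
  | empty => simp [lpNorm, ENNReal.zero_rpow_of_pos (by linarith : 0 < p), show (0:ℝ) < p by linarith]
  | insert i s hi ih =>
    simp only [Finset.sum_insert hi]
    refine (lpNorm_add_le hp (hf i (Finset.mem_insert_self i s)) ?_).trans ?_
    · exact Finset.aemeasurable_fun_sum s fun j hj => hf j (Finset.mem_insert_of_mem hj)
    · exact add_le_add le_rfl (ih fun j hj => hf j (Finset.mem_insert_of_mem hj))

end LpNorm

/-- Measurability of `f` replaces finiteness of the constant. This version is used where the
constant contains an oscillation that may be infinite. -/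
theorem lpNorm_mul_const_of_aemeasurable {X : Type*} [MeasurableSpace X] {p : ℝ} {ν : Measure X}
    {f : X → ℝ≥0∞} (hp : 0 < p) (hf : AEMeasurable f ν) (c : ℝ≥0∞) :
    lpNorm p ν (fun x => f x * c) = lpNorm p ν f * c := by
  simp only [lpNorm, ENNReal.mul_rpow_of_nonneg _ _ hp.le]
  rw [lintegral_mul_const'' _ (hf.pow_const p),
    ENNReal.mul_rpow_of_nonneg _ _ (by positivity), ← ENNReal.rpow_mul c, mul_one_div_cancel hp.ne',
    ENNReal.rpow_one]

/-! ### Reducing pairs over a probability space -/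

variable {X : Type*} [MeasurableSpace X] {d : ℕ}

/-- `A` is a reducing matrix of `w` in the norm of `L^p(ν)`, with constant `K`. -/
structure IsMatRed (ν : Measure X) (p : ℝ) (w : X → Mat d) (A : Mat d) (K : ℝ≥0) : Prop where
  le : ∀ M : Mat d, lpNorm p ν (fun x => ‖w x * M‖ₑ) ≤ K * ‖A * M‖ₑ
  ge : ∀ M : Mat d, ‖A * M‖ₑ ≤ K * lpNorm p ν (fun x => ‖w x * M‖ₑ)

/-- The functions `w`, `wi` are mutually inverse, with reducing matrices `A` in `L^p(ν)` and `A'`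
in `L^q(ν)` satisfying the `A_p` condition `|A A'| ≤ K`. -/
structure IsRedPair (ν : Measure X) (p q : ℝ) (w wi : X → Mat d) (A A' : Mat d) (K : ℝ≥0) :
    Prop where
  holder : p.HolderConjugate q
  meas : AEStronglyMeasurable w ν
  measi : AEStronglyMeasurable wi ν
  herm : ∀ᵐ x ∂ν, (w x).IsHermitian
  hermi : ∀ᵐ x ∂ν, (wi x).IsHermitian
  inv : ∀ᵐ x ∂ν, w x * wi x = 1
  posDef : A.PosDef
  posDef' : A'.PosDef
  red : IsMatRed ν p w A K
  redi : IsMatRed ν q wi A' K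
  norm_mul_le : ‖A * A'‖ₑ ≤ K

theorem integral_conjTranspose (ν : Measure X) (B : X → Mat d) :
    ∫ x, (B x)ᴴ ∂ν = (∫ x, B x ∂ν)ᴴ :=
  (starL' ℝ : Mat d ≃L[ℝ] Mat d).integral_comp_comm B

theorem integrable_conjTranspose {ν : Measure X} {B : X → Mat d} (hB : Integrable B ν) :
    Integrable (fun x => (B x)ᴴ) ν :=
  (starL' ℝ : Mat d ≃L[ℝ] Mat d).toContinuousLinearMap.integrable_comp hB

/-- Jensen's inequality for the norm, with the average moved inside the two constant factors. -/
theorem enorm_mul_sub_integral_mul_le {ν : Measure X} [IsProbabilityMeasure ν] {B : X → Mat d}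
    (hB : Integrable B ν) (L c M : Mat d) :
    ‖L * (c - ∫ y, B y ∂ν) * M‖ₑ ≤ ∫⁻ y, ‖L * (c - B y) * M‖ₑ ∂ν := by
  have h : ∫ y, L * (c - B y) * M ∂ν = L * (c - ∫ y, B y ∂ν) * M := by
    have h1 : Integrable (fun y => c - B y) ν := (integrable_const c).sub hB
    rw [integral_mul_const_of_integrable (h1.const_mul L), integral_const_mul_of_integrable h1,
      integral_sub (integrable_const c) hB, integral_const, probReal_univ, one_smul]
  rw [← h]
  exact enorm_integral_le_lintegral_enorm _

namespace IsRedPair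

variable {ν : Measure X} {p q : ℝ} {w wi : X → Mat d} {A A' : Mat d} {K : ℝ≥0}

theorem swap (h : IsRedPair ν p q w wi A A' K) : IsRedPair ν q p wi w A' A K where
  holder := h.holder.symm
  meas := h.measi
  measi := h.meas
  herm := h.hermi
  hermi := h.herm
  inv := h.inv.mono fun _ hx => mul_eq_one_comm.1 hx
  posDef := h.posDef'
  posDef' := h.posDef
  red := h.redi
  redi := h.red
  norm_mul_le := by
    rw [enorm_mul_comm_of_isHermitian h.posDef'.1 h.posDef.1]
    exact h.norm_mul_le

theorem mul_inv (h : IsRedPair ν p q w wi A A' K) : A * A⁻¹ = 1 :=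
  Matrix.mul_nonsing_inv A (A.isUnit_iff_isUnit_det.1 h.posDef.isUnit)

theorem inv_mul (h : IsRedPair ν p q w wi A A' K) : A⁻¹ * A = 1 :=
  Matrix.nonsing_inv_mul A (A.isUnit_iff_isUnit_det.1 h.posDef.isUnit)

theorem lpNorm_mul_inv_le (h : IsRedPair ν p q w wi A A' K) :
    lpNorm p ν (fun x => ‖w x * A⁻¹‖ₑ) ≤ K := by
  refine (h.red.le _).trans ?_
  rw [h.mul_inv]
  exact mul_le_of_le_one_right' enorm_mat_one_le

/-- Here the `A_p` condition is spent: `A'` reduces `wi`, which leaves the constant matrix `A' A`.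
-/
theorem lpNorm_inv_mul_le (h : IsRedPair ν p q w wi A A' K) :
    lpNorm q ν (fun x => ‖A * wi x‖ₑ) ≤ K * K := by
  rw [lpNorm_congr_ae (g := fun x => ‖wi x * A‖ₑ)
    (h.hermi.mono fun x hx => enorm_mul_comm_of_isHermitian h.posDef.1 hx)]
  exact (h.redi.le _).trans (mul_le_mul_right h.swap.norm_mul_le _)

/-- The counterpart of the `A_p` bound, obtained without using it: write `A⁻¹ A'⁻¹ = (A⁻¹ w)(wi
A'⁻¹)` at each point, average, and apply Hölder; both factors are normalized by their reducing
matrices. -/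
theorem enorm_inv_mul_inv_le [IsProbabilityMeasure ν] (h : IsRedPair ν p q w wi A A' K) :
    ‖A⁻¹ * A'⁻¹‖ₑ ≤ K * K := by
  have hA : (A⁻¹).IsHermitian := h.posDef.1.inv
  calc ‖A⁻¹ * A'⁻¹‖ₑ = ∫⁻ _, ‖A⁻¹ * A'⁻¹‖ₑ ∂ν := by simp
    _ ≤ ∫⁻ x, ‖w x * A⁻¹‖ₑ * ‖wi x * A'⁻¹‖ₑ ∂ν := by
        refine lintegral_mono_ae ?_
        filter_upwards [h.inv, h.herm] with x hx hx'
        rw [enorm_mul_comm_of_isHermitian hx' hA]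
        refine le_trans (le_of_eq ?_) (enorm_mat_mul_le _ _)
        rw [Matrix.mul_assoc, ← Matrix.mul_assoc (w x), hx, Matrix.one_mul]
    _ ≤ _ := lintegral_mul_le_lpNorm h.holder (h.meas.mul_const _).enorm (h.measi.mul_const _).enorm
    _ ≤ K * K := mul_le_mul' h.lpNorm_mul_inv_le h.swap.lpNorm_mul_inv_le

end IsRedPair

/-- The oscillation `‖v (B - ⟨B⟩) U⁻¹‖` in `L^p(ν)`. -/
noncomputable def osc (ν : Measure X) (p : ℝ) (v : X → Mat d) (U : Mat d) (B : X → Mat d) :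
    ℝ≥0∞ :=
  lpNorm p ν (fun x => ‖v x * (B x - ∫ y, B y ∂ν) * U⁻¹‖ₑ)

/-- The reduced oscillation `‖V (B - ⟨B⟩) U⁻¹‖` in `L^1(ν)`. -/
noncomputable def oscTilde (ν : Measure X) (V U : Mat d) (B : X → Mat d) : ℝ≥0∞ :=
  ∫⁻ x, ‖V * (B x - ∫ y, B y ∂ν) * U⁻¹‖ₑ ∂ν

/-- The oscillation `‖v(x) (B(x) - B(y)) ui(y)‖` in the mixed norm of `L^p_x(L^q_y)`. -/
noncomputable def oscOne (ν : Measure X) (p q : ℝ) (v ui B : X → Mat d) : ℝ≥0∞ :=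
  lpNorm p ν (fun x => lpNorm q ν (fun y => ‖v x * (B x - B y) * ui y‖ₑ))

/-! ### Comparisons of oscillations on a single set -/

section Local

variable {ν : Measure X} {p q : ℝ} {v vi u ui B : X → Mat d}
  {V V' U U' : Mat d} {K : ℝ≥0}

/-- Insert `vi v = 1` after `V` and apply Hölder; the factor `V vi` is bounded in `L^q` by the `A_p`
condition. -/
theorem oscTilde_le_osc (hV : IsRedPair ν p q v vi V V' K) (hB : Integrable B ν) :
    oscTilde ν V U B ≤ (K * K : ℝ≥0) * osc ν p v U B := by
  calc oscTilde ν V U B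
      ≤ ∫⁻ x, ‖V * vi x‖ₑ * ‖v x * (B x - ∫ y, B y ∂ν) * U⁻¹‖ₑ ∂ν := by
        refine lintegral_mono_ae ?_
        filter_upwards [hV.swap.inv] with x hx
        refine le_trans (le_of_eq ?_) (enorm_mat_mul_le _ _)
        simp only [Matrix.mul_assoc]
        rw [← Matrix.mul_assoc (vi x), hx, Matrix.one_mul]
    _ ≤ lpNorm q ν (fun x => ‖V * vi x‖ₑ) * osc ν p v U B :=
        lintegral_mul_le_lpNorm hV.holder.symm (hV.measi.const_mul _).enorm
          ((hV.meas.mul (hB.1.sub aestronglyMeasurable_const)).mul_const _).enorm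
    _ ≤ _ := by
        push_cast
        exact mul_le_mul' hV.lpNorm_inv_mul_le le_rfl

/-- Split `B(x) - B(y)` at the average `b`. In the term with `B(x) - b` the inner norm replaces `ui`
by `U'`, which is exchanged for `U⁻¹` through `U U'`. In the term with `B(y) - b` the factor `v(x)`
is normalized by `V⁻¹`, and taking adjoints turns the rest into the dual oscillation. -/
theorem oscOne_le (hV : IsRedPair ν p q v vi V V' K) (hU : IsRedPair ν p q u ui U U' K)
    (hB : Integrable B ν) :
    oscOne ν p q v ui B ≤
      (K * K : ℝ≥0) * (osc ν p v U B + osc ν q ui V' (fun x => (B x)ᴴ)) := by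
  set b := ∫ y, B y ∂ν with hb
  have hp : 0 < p := hV.holder.pos
  have hq : 0 < q := hV.holder.symm.pos
  have hBm : AEStronglyMeasurable (fun x => B x - b) ν := hB.1.sub aestronglyMeasurable_const
  have inner : ∀ x, lpNorm q ν (fun y => ‖v x * (B x - B y) * ui y‖ₑ) ≤
      ‖v x * (B x - b) * U⁻¹‖ₑ * (K * K) +
        ‖v x * V⁻¹‖ₑ * (K * osc ν q ui V' (fun x => (B x)ᴴ)) := by
    intro x
    have h1 : lpNorm q ν (fun y => ‖v x * (B x - b) * ui y‖ₑ) ≤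
        ‖v x * (B x - b) * U⁻¹‖ₑ * (K * K) := by
      have e1 : lpNorm q ν (fun y => ‖v x * (B x - b) * ui y‖ₑ) =
          lpNorm q ν (fun y => ‖ui y * (v x * (B x - b))ᴴ‖ₑ) := by
        refine lpNorm_congr_ae (hU.hermi.mono fun y hy => ?_)
        rw [← enorm_conjTranspose, Matrix.conjTranspose_mul _ (ui y), hy.eq]
      rw [e1]
      refine (hU.redi.le _).trans ?_
      rw [← enorm_conjTranspose, Matrix.conjTranspose_mul, Matrix.conjTranspose_conjTranspose,
        hU.posDef'.1.eq]
      have e2 : v x * (B x - b) * U' = (v x * (B x - b) * U⁻¹) * (U * U') := by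
        rw [Matrix.mul_assoc _ U⁻¹, ← Matrix.mul_assoc U⁻¹, hU.inv_mul, Matrix.one_mul]
      rw [e2]
      calc _ ≤ (K : ℝ≥0∞) * (‖v x * (B x - b) * U⁻¹‖ₑ * K) :=
            mul_le_mul_right ((enorm_mat_mul_le _ _).trans
              (mul_le_mul_right hU.norm_mul_le _)) _
        _ = _ := by ring
    have h2 : lpNorm q ν (fun y => ‖v x * (B y - b) * ui y‖ₑ) ≤
        ‖v x * V⁻¹‖ₑ * (K * osc ν q ui V' (fun x => (B x)ᴴ)) := by
      rw [← mul_assoc, osc, ← lpNorm_const_mul hq (by finiteness)]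
      refine lpNorm_mono_ae hq.le (hU.hermi.mono fun y hy => ?_)
      rw [integral_conjTranspose, ← Matrix.conjTranspose_sub, ← hb, ← enorm_conjTranspose (_ * V'⁻¹)]
      simp only [Matrix.conjTranspose_mul, Matrix.conjTranspose_conjTranspose, hy.eq,
        hV.posDef'.1.inv.eq]
      -- Inserting both `V⁻¹ V` and `V' V'⁻¹` isolates `V V'`, which the `A_p` condition bounds.
      have e2 : v x * (B y - b) * ui y =
          (v x * V⁻¹) * (V * V') * (V'⁻¹ * ((B y - b) * ui y)) := by
        calc _ = v x * (V⁻¹ * V) * (V' * V'⁻¹) * (B y - b) * ui y := by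
              rw [hV.swap.mul_inv, hV.inv_mul, Matrix.mul_one, Matrix.mul_one]
          _ = _ := by simp only [Matrix.mul_assoc]
      rw [e2]
      exact (enorm_mat_mul₃_le _ _ _).trans
        (mul_le_mul_left (mul_le_mul_right hV.norm_mul_le _) _)
    calc _ ≤ lpNorm q ν (fun y => ‖v x * (B x - b) * ui y‖ₑ + ‖v x * (B y - b) * ui y‖ₑ) := by
          refine lpNorm_mono hq.le fun y => ?_
          have : v x * (B x - B y) * ui y =
              v x * (B x - b) * ui y - v x * (B y - b) * ui y := by
            rw [← Matrix.sub_mul, ← Matrix.mul_sub, sub_sub_sub_cancel_right]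
          rw [this]
          exact enorm_sub_le
      _ ≤ _ := lpNorm_add_le hV.holder.symm.lt.le (hU.measi.const_mul _).enorm
          ((hBm.const_mul _).mul hU.measi).enorm
      _ ≤ _ := add_le_add h1 h2
  have m1 : AEMeasurable (fun x => ‖v x * (B x - b) * U⁻¹‖ₑ) ν :=
    ((hV.meas.mul hBm).mul_const _).enorm
  have m2 : AEMeasurable (fun x => ‖v x * V⁻¹‖ₑ) ν := (hV.meas.mul_const _).enorm
  calc oscOne ν p q v ui B ≤ _ := lpNorm_mono hp.le inner
    _ ≤ _ := lpNorm_add_le hV.holder.lt.le (m1.mul_const _) (m2.mul_const _)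
    _ = osc ν p v U B * (K * K) + lpNorm p ν (fun x => ‖v x * V⁻¹‖ₑ) *
          (K * osc ν q ui V' (fun x => (B x)ᴴ)) := by
        rw [lpNorm_mul_const_of_aemeasurable hp m1, lpNorm_mul_const_of_aemeasurable hp m2]
        rfl
    _ ≤ osc ν p v U B * (K * K) + K * (K * osc ν q ui V' (fun x => (B x)ᴴ)) := by
        gcongr
        exact hV.lpNorm_mul_inv_le
    _ = _ := by push_cast; ring

variable [IsProbabilityMeasure ν]

/-- The integrands are comparable at each point: `V = (V V') V'⁻¹` and `U⁻¹ = U' (U'⁻¹ U⁻¹)`, with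
both constant products bounded. No integrability of `B` enters. -/
theorem oscTilde_le_oscTilde_dual (hV : IsRedPair ν p q v vi V V' K)
    (hU : IsRedPair ν p q u ui U U' K) :
    oscTilde ν V U B ≤ (K * (K * K) : ℝ≥0) * oscTilde ν U' V' (fun x => (B x)ᴴ) := by
  unfold oscTilde
  rw [← lintegral_const_mul' _ _ ENNReal.coe_ne_top]
  refine lintegral_mono fun x => ?_
  rw [integral_conjTranspose, ← Matrix.conjTranspose_sub]
  set D := B x - ∫ y, B y ∂ν
  have h1 : ‖U' * Dᴴ * V'⁻¹‖ₑ = ‖V'⁻¹ * D * U'‖ₑ := by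
    rw [← enorm_conjTranspose]
    simp only [Matrix.conjTranspose_mul, Matrix.conjTranspose_conjTranspose, hU.posDef'.1.eq,
      hV.posDef'.1.inv.eq, Matrix.mul_assoc]
  have h2 : V * D * U⁻¹ = (V * V') * (V'⁻¹ * D * U') * (U'⁻¹ * U⁻¹) := by
    calc V * D * U⁻¹ = V * (V' * V'⁻¹) * D * (U' * U'⁻¹) * U⁻¹ := by
          rw [hV.swap.mul_inv, hU.swap.mul_inv, Matrix.mul_one, Matrix.mul_one]
      _ = _ := by simp only [Matrix.mul_assoc]
  rw [h1, h2]
  refine (enorm_mat_mul₃_le _ _ _).trans ?_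
  calc _ ≤ (K : ℝ≥0∞) * ‖V'⁻¹ * D * U'‖ₑ * (K * K) :=
        mul_le_mul' (mul_le_mul' hV.norm_mul_le le_rfl) hU.swap.enorm_inv_mul_inv_le
    _ = _ := by push_cast; ring

/-- Write `B(x) - ⟨B⟩` as an average over `y` of `B(x) - B(y)`, insert `vi v = 1` and `ui u = 1`,
and apply Hölder first in `y`, against `u U⁻¹`, then in `x`, against `V vi`. -/
theorem oscTilde_le_oscOne (hV : IsRedPair ν p q v vi V V' K) (hU : IsRedPair ν p q u ui U U' K)
    (hB : Integrable B ν) :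
    oscTilde ν V U B ≤ (K * (K * K) : ℝ≥0) * oscOne ν p q v ui B := by
  have hp : 0 < p := hV.holder.pos
  have hq : 0 < q := hV.holder.symm.pos
  have inner : ∀ᵐ x ∂ν, ‖V * (B x - ∫ y, B y ∂ν) * U⁻¹‖ₑ ≤
      ‖V * vi x‖ₑ * lpNorm q ν (fun y => ‖v x * (B x - B y) * ui y‖ₑ) * K := by
    filter_upwards [hV.swap.inv] with x hx
    calc _ ≤ ∫⁻ y, ‖V * (B x - B y) * U⁻¹‖ₑ ∂ν := enorm_mul_sub_integral_mul_le hB _ _ _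
      _ ≤ ∫⁻ y, ‖V * vi x‖ₑ * (‖v x * (B x - B y) * ui y‖ₑ * ‖u y * U⁻¹‖ₑ) ∂ν := by
          refine lintegral_mono_ae (hU.swap.inv.mono fun y hy => ?_)
          rw [← mul_assoc]
          refine le_trans (le_of_eq ?_) (enorm_mat_mul₃_le _ _ _)
          calc _ = ‖V * (vi x * v x) * (B x - B y) * (ui y * u y) * U⁻¹‖ₑ := by
                rw [hx, hy, Matrix.mul_one, Matrix.mul_one]
            _ = _ := by simp only [Matrix.mul_assoc]
      _ = ‖V * vi x‖ₑ * ∫⁻ y, ‖v x * (B x - B y) * ui y‖ₑ * ‖u y * U⁻¹‖ₑ ∂ν :=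
          lintegral_const_mul' _ _ enorm_ne_top
      _ ≤ ‖V * vi x‖ₑ * (lpNorm q ν (fun y => ‖v x * (B x - B y) * ui y‖ₑ) *
            lpNorm p ν (fun y => ‖u y * U⁻¹‖ₑ)) := by
          gcongr
          exact lintegral_mul_le_lpNorm hV.holder.symm
            (((aestronglyMeasurable_const.sub hB.1).const_mul _).mul hU.measi).enorm
            (hU.meas.mul_const _).enorm
      _ ≤ _ := by
          rw [mul_assoc]
          gcongr
          exact hU.lpNorm_mul_inv_le
  have mjoint : AEMeasurable (fun z : X × X => ‖v z.1 * (B z.1 - B z.2) * ui z.2‖ₑ ^ q)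
      (ν.prod ν) :=
    (((hV.meas.comp_fst.mul (hB.1.comp_fst.sub hB.1.comp_snd)).mul
      hU.measi.comp_snd).enorm).pow_const _
  have mo : AEMeasurable (fun x => lpNorm q ν (fun y => ‖v x * (B x - B y) * ui y‖ₑ)) ν :=
    mjoint.lintegral_prod_right'.pow_const _
  calc oscTilde ν V U B ≤ ∫⁻ x, ‖V * vi x‖ₑ *
        lpNorm q ν (fun y => ‖v x * (B x - B y) * ui y‖ₑ) * K ∂ν := lintegral_mono_ae inner
    _ = (∫⁻ x, ‖V * vi x‖ₑ * lpNorm q ν (fun y => ‖v x * (B x - B y) * ui y‖ₑ) ∂ν) * K :=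
        lintegral_mul_const' _ _ ENNReal.coe_ne_top
    _ ≤ lpNorm q ν (fun x => ‖V * vi x‖ₑ) * oscOne ν p q v ui B * K := by
        gcongr
        exact lintegral_mul_le_lpNorm hV.holder.symm (hV.measi.const_mul _).enorm mo
    _ ≤ K * K * oscOne ν p q v ui B * K := by
        gcongr
        exact hV.lpNorm_inv_mul_le
    _ = _ := by push_cast; ring

end Local

/-! ### Dyadic systems and the John–Nirenberg inequality -/

/-- A family of sets of positive finite measure, each of which is split into children of equal
measure. -/
structure DyadicSystem (X : Type*) [MeasurableSpace X] (μ : Measure X) (ι β : Type*)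
    [Fintype β] where
  /-- The underlying set of an index. -/
  set : ι → Set X
  /-- The children of an index. -/
  child : ι → β → ι
  /-- The child to which a point belongs. -/
  loc : ι → X → β
  measurableSet_set : ∀ r, MeasurableSet (set r)
  measurableSet_loc : ∀ r b, MeasurableSet (loc r ⁻¹' {b})
  set_child : ∀ r b, set (child r b) = set r ∩ loc r ⁻¹' {b}
  measure_child : ∀ r b, μ (set r) = Fintype.card β * μ (set (child r b))
  measure_ne_zero : ∀ r, μ (set r) ≠ 0
  measure_ne_top : ∀ r, μ (set r) ≠ ∞

namespace DyadicSystem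

variable {X : Type*} [MeasurableSpace X] {μ : Measure X} {ι β : Type*} [Fintype β] {d : ℕ}
  (S : DyadicSystem X μ ι β) {p q : ℝ}

/-- The normalized restriction of the measure to a set of the system. -/
noncomputable abbrev prob (r : ι) : Measure X := ProbabilityTheory.cond μ (S.set r)

instance isProbabilityMeasure_prob (r : ι) : IsProbabilityMeasure (S.prob r) :=
  ProbabilityTheory.cond_isProbabilityMeasure_of_finite (S.measure_ne_zero r) (S.measure_ne_top r)

/-- The conditional expectation of `B` on the sets of generation `k` below `r`. -/
noncomputable def cellAvg (B : X → Mat d) : ℕ → ι → X → Mat d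
  | 0, r, _ => ∫ y, B y ∂(S.prob r)
  | k + 1, r, x => cellAvg B k (S.child r (S.loc r x)) x

theorem lintegral_prob (r : ι) (f : X → ℝ≥0∞) :
    ∫⁻ x, f x ∂(S.prob r) = (μ (S.set r))⁻¹ * ∫⁻ x in S.set r, f x ∂μ := by
  rw [prob, ProbabilityTheory.cond, lintegral_smul_measure, smul_eq_mul]

theorem setLIntegral_eq (r : ι) (f : X → ℝ≥0∞) :
    ∫⁻ x in S.set r, f x ∂μ = μ (S.set r) * ∫⁻ x, f x ∂(S.prob r) := by
  rw [lintegral_prob, ← mul_assoc,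
    ENNReal.mul_inv_cancel (S.measure_ne_zero r) (S.measure_ne_top r), one_mul]

theorem child_subset (r : ι) (b : β) : S.set (S.child r b) ⊆ S.set r := by
  rw [S.set_child]
  exact inter_subset_left

theorem iUnion_child (r : ι) : ⋃ b, S.set (S.child r b) = S.set r := by
  ext x
  simp [S.set_child]

theorem pairwise_disjoint_child (r : ι) :
    Pairwise (Function.onFun Disjoint fun b => S.set (S.child r b)) := by
  intro b b' hbb'
  simp only [Function.onFun, S.set_child]
  refine Set.disjoint_left.2 fun x hx hx' => hbb' ?_
  rw [← mem_singleton_iff.1 hx.2, ← mem_singleton_iff.1 hx'.2]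

theorem setLIntegral_eq_sum (r : ι) (f : X → ℝ≥0∞) :
    ∫⁻ x in S.set r, f x ∂μ = ∑ b, ∫⁻ x in S.set (S.child r b), f x ∂μ := by
  conv_lhs => rw [← S.iUnion_child r]
  rw [lintegral_iUnion (fun b => S.measurableSet_set _) (S.pairwise_disjoint_child r),
    tsum_fintype]

theorem loc_eq {r : ι} {b : β} {x : X} (hx : x ∈ S.set (S.child r b)) : S.loc r x = b := by
  rw [S.set_child] at hx
  exact hx.2

theorem stronglyMeasurable_glue {r : ι} {h : β → X → Mat d} (hh : ∀ b, StronglyMeasurable (h b)) :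
    StronglyMeasurable fun x => h (S.loc r x) x := by
  classical
  have : (fun x => h (S.loc r x) x) =
      fun x => ∑ b, (S.loc r ⁻¹' {b}).indicator (h b) x := by
    ext1 x
    rw [Finset.sum_eq_single (S.loc r x)]
    · simp
    · intro b _ hb
      exact indicator_of_notMem (by simpa using Ne.symm hb) _
    · simp
  rw [this]
  exact Finset.stronglyMeasurable_fun_sum _ fun b _ => (hh b).indicator (S.measurableSet_loc r b)

theorem stronglyMeasurable_cellAvg (B : X → Mat d) (k : ℕ) (r : ι) :
    StronglyMeasurable (S.cellAvg B k r) := by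
  induction k generalizing r with
  | zero => exact stronglyMeasurable_const
  | succ k ih => exact S.stronglyMeasurable_glue fun b => ih (S.child r b)

theorem enorm_mul_integral_sub_mul_le {B : X → Mat d} {r : ι} (hB : Integrable B (S.prob r))
    (L c M : Mat d) :
    ‖L * (∫ y, B y ∂(S.prob r) - c) * M‖ₑ * μ (S.set r) ≤
      ∫⁻ y in S.set r, ‖L * (B y - c) * M‖ₑ ∂μ := by
  have hflip : ∀ D : Mat d, ‖L * (D - c) * M‖ₑ = ‖L * (c - D) * M‖ₑ := fun D => by
    rw [← enorm_neg, ← Matrix.neg_mul, ← Matrix.mul_neg, neg_sub]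
  simp only [hflip]
  rw [S.setLIntegral_eq, mul_comm]
  exact mul_le_mul_right (enorm_mul_sub_integral_mul_le hB L c M) _

/-- A Calderón–Zygmund stopping argument cut off at depth `i`. `E` is the union of the maximal cells
on which the average of `‖L (B - c) N‖` exceeds `t`, and `h` is the dyadic average minus the average
over the stopping cell, extended by `0`. Thus `h` is governed on each stopping cell by `hm`, which
concerns fewer generations, and the remainder is a cell average that is bounded pointwise. -/
theorem exists_stopping [Nonempty β] {B v u : X → Mat d} (hB : ∀ r, Integrable B (S.prob r))
    {k : ℕ} {m t : ℝ≥0∞}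
    (hm : ∀ j < k, ∀ r, ∀ M : Mat d,
      ∫⁻ x in S.set r, ‖v x * (S.cellAvg B j r x - ∫ y, B y ∂(S.prob r)) * M‖ₑ ^ p ∂μ ≤
        m * ∫⁻ x in S.set r, ‖u x * M‖ₑ ^ p ∂μ) (hp : 0 < p)
    (L c N : Mat d) (i : ℕ) (hi : i ≤ k) (r : ι)
    (hr : ∫⁻ x in S.set r, ‖L * (B x - c) * N‖ₑ ∂μ ≤ t * μ (S.set r)) :
    ∃ (E : Set X) (h : X → Mat d), MeasurableSet E ∧ E ⊆ S.set r ∧ StronglyMeasurable h ∧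
      t * μ E ≤ ∫⁻ x in E, ‖L * (B x - c) * N‖ₑ ∂μ ∧
      (∀ x ∈ S.set r, ‖L * (S.cellAvg B i r x - c - h x) * N‖ₑ ≤ Fintype.card β * t) ∧
      ∀ M : Mat d, ∫⁻ x in S.set r, ‖v x * h x * M‖ₑ ^ p ∂μ ≤
        m * ∫⁻ x in E, ‖u x * M‖ₑ ^ p ∂μ := by
  induction i generalizing r with
  | zero =>
    refine ⟨∅, fun _ => 0, MeasurableSet.empty, empty_subset _, stronglyMeasurable_const, by simp,
      fun x _ => ?_, fun M => by simp [hp]⟩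
    have h1 := (S.enorm_mul_integral_sub_mul_le (hB r) L c N).trans hr
    rw [ENNReal.mul_le_mul_iff_left (S.measure_ne_zero r) (S.measure_ne_top r)] at h1
    simp only [cellAvg, sub_zero]
    refine h1.trans (le_mul_of_one_le_left' ?_)
    exact_mod_cast Fintype.card_pos
  | succ i ih =>
    have key : ∀ b, ∃ (E : Set X) (h : X → Mat d), MeasurableSet E ∧ E ⊆ S.set (S.child r b) ∧
        StronglyMeasurable h ∧ t * μ E ≤ ∫⁻ x in E, ‖L * (B x - c) * N‖ₑ ∂μ ∧
        (∀ x ∈ S.set (S.child r b),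
          ‖L * (S.cellAvg B i (S.child r b) x - c - h x) * N‖ₑ ≤ Fintype.card β * t) ∧
        ∀ M : Mat d, ∫⁻ x in S.set (S.child r b), ‖v x * h x * M‖ₑ ^ p ∂μ ≤
          m * ∫⁻ x in E, ‖u x * M‖ₑ ^ p ∂μ := by
      intro b
      by_cases hb : ∫⁻ x in S.set (S.child r b), ‖L * (B x - c) * N‖ₑ ∂μ ≤
          t * μ (S.set (S.child r b))
      -- The child is not selected, so the search continues below it.
      · exact ih (by omega) _ hb
      -- The child is selected: it enters `E` as a whole, and the remaining `i` generations are left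
      -- to `hm`.
      · refine ⟨S.set (S.child r b),
          fun x => S.cellAvg B i (S.child r b) x - ∫ y, B y ∂(S.prob (S.child r b)),
          S.measurableSet_set _, Subset.rfl,
          (S.stronglyMeasurable_cellAvg B i _).sub stronglyMeasurable_const, (not_le.1 hb).le,
          fun x _ => ?_, fun M => hm i (by omega) _ M⟩
        have e : S.cellAvg B i (S.child r b) x - c -
            (S.cellAvg B i (S.child r b) x - ∫ y, B y ∂(S.prob (S.child r b))) =
            ∫ y, B y ∂(S.prob (S.child r b)) - c := by abel
        rw [e, ← ENNReal.mul_le_mul_iff_left (S.measure_ne_zero (S.child r b))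
          (S.measure_ne_top (S.child r b))]
        -- The parent was not selected, and passing to a child multiplies an average by at most the
        -- number of children; this is the origin of the factor `Fintype.card β`.
        calc _ ≤ ∫⁻ x in S.set (S.child r b), ‖L * (B x - c) * N‖ₑ ∂μ :=
              S.enorm_mul_integral_sub_mul_le (hB _) L c N
          _ ≤ ∫⁻ x in S.set r, ‖L * (B x - c) * N‖ₑ ∂μ := lintegral_mono_set (S.child_subset r b)
          _ ≤ t * μ (S.set r) := hr
          _ = _ := by rw [S.measure_child r b]; ring
    choose E h hE hEs hh hEt hbd hM using key
    have hdisj : Pairwise (Function.onFun Disjoint E) := fun b b' hbb' =>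
      (S.pairwise_disjoint_child r hbb').mono (hEs b) (hEs b')
    have hsum : ∀ f : X → ℝ≥0∞, ∫⁻ x in ⋃ b, E b, f x ∂μ = ∑ b, ∫⁻ x in E b, f x ∂μ := fun f => by
      rw [lintegral_iUnion hE hdisj, tsum_fintype]
    refine ⟨⋃ b, E b, fun x => h (S.loc r x) x, MeasurableSet.iUnion hE,
      iUnion_subset fun b => (hEs b).trans (S.child_subset r b), S.stronglyMeasurable_glue hh,
      ?_, fun x hx => ?_, fun M => ?_⟩
    · rw [hsum, measure_iUnion hdisj hE, tsum_fintype, Finset.mul_sum]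
      exact Finset.sum_le_sum fun b _ => hEt b
    · rw [← S.iUnion_child r] at hx
      obtain ⟨b, hb⟩ := mem_iUnion.1 hx
      simpa only [cellAvg, S.loc_eq hb] using hbd b x hb
    · rw [hsum, S.setLIntegral_eq_sum, Finset.mul_sum]
      refine Finset.sum_le_sum fun b _ => le_trans (le_of_eq ?_) (hM b M)
      refine setLIntegral_congr_fun (S.measurableSet_set _) fun x hx => ?_
      simp only [S.loc_eq hx]

end DyadicSystem

/-! ### Fatou's lemma and the mass carried by small sets -/

open Filter Topology in
theorem lpNorm_le_of_tendsto {X : Type*} [MeasurableSpace X] {p : ℝ} {ν : Measure X} (hp : 0 < p)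
    {F : ℕ → X → ℝ≥0∞} {f : X → ℝ≥0∞} {c : ℕ → ℝ≥0∞} {c' : ℝ≥0∞}
    (hF : ∀ k, AEMeasurable (F k) ν)
    (hlim : ∀ᵐ x ∂ν, Tendsto (fun k => F k x) atTop (𝓝 (f x)))
    (hle : ∀ k, lpNorm p ν (F k) ≤ c k) (hc : Tendsto c atTop (𝓝 c')) : lpNorm p ν f ≤ c' := by
  rw [← ENNReal.rpow_le_rpow_iff hp, lpNorm_rpow hp]
  calc ∫⁻ x, f x ^ p ∂ν = ∫⁻ x, liminf (fun k => F k x ^ p) atTop ∂ν :=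
        lintegral_congr_ae (hlim.mono fun x hx => (hx.ennrpow_const p).liminf_eq.symm)
    _ ≤ liminf (fun k => ∫⁻ x, F k x ^ p ∂ν) atTop :=
        lintegral_liminf_le' fun k => (hF k).pow_const p
    _ ≤ liminf (fun k => c k ^ p) atTop := by
        refine liminf_le_liminf (Eventually.of_forall fun k => ?_)
        rw [← lpNorm_rpow hp]
        exact ENNReal.rpow_le_rpow (hle k) hp.le
    _ = c' ^ p := (hc.ennrpow_const p).liminf_eq

/-- The proportion of mass which a set of relative measure at most one half can carry. -/
noncomputable def massRatio (p : ℝ) (K : ℝ≥0) : ℝ≥0 := 1 - ((2 * K ^ 3 + 1) ^ p)⁻¹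

theorem massRatio_lt_one (p : ℝ) (K : ℝ≥0) : massRatio p K < 1 :=
  tsub_lt_self one_pos (by positivity)

/-- If `b` is at least the fraction `1 / D` of the total `W`, then `a = W - b` is at most `(1 - 1 /
D) W`. The summand `1` in `D = (2 K ^ 3 + 1) ^ p` guarantees `D ≥ 1`, so that the truncated
subtraction in `massRatio` is a genuine one. -/
theorem le_massRatio_mul {p : ℝ} (hp : 0 < p) {K : ℝ≥0} {a b W : ℝ≥0∞} (hW : W ≠ ∞)
    (hab : a + b = W) (hWb : W ≤ (2 * K ^ 3 * b ^ (1 / p)) ^ p) : a ≤ massRatio p K * W := by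
  have hb : b ≠ ∞ := fun h => hW (by rw [← hab, h, add_top])
  have ha : a ≠ ∞ := fun h => hW (by rw [← hab, h, top_add])
  have h1 : W ≤ ((2 * K ^ 3 + 1) ^ p : ℝ≥0) * b := by
    refine hWb.trans ?_
    rw [ENNReal.mul_rpow_of_nonneg _ _ hp.le, ← ENNReal.rpow_mul, one_div,
      inv_mul_cancel₀ hp.ne', ENNReal.rpow_one, ENNReal.coe_rpow_of_nonneg _ hp.le]
    gcongr
    push_cast
    exact le_self_add
  lift a to ℝ≥0 using ha
  lift b to ℝ≥0 using hb
  subst hab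
  have h2 : a + b ≤ (2 * K ^ 3 + 1) ^ p * b := by exact_mod_cast h1
  have hD : (1 : ℝ≥0) ≤ (2 * K ^ 3 + 1) ^ p := NNReal.one_le_rpow le_add_self hp.le
  have h3 : a ≤ massRatio p K * (a + b) := by
    rw [massRatio, ← NNReal.coe_le_coe]
    set D : ℝ≥0 := (2 * K ^ 3 + 1) ^ p
    have hD0 : (0 : ℝ) < D := by exact_mod_cast zero_lt_one.trans_le hD
    rw [NNReal.coe_mul, NNReal.coe_sub (inv_le_one_of_one_le₀ hD)]
    have h4 : (a : ℝ) + b ≤ D * b := by exact_mod_cast h2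
    push_cast
    have h5 : (D : ℝ)⁻¹ * (a + b) ≤ b := by
      rw [inv_mul_le_iff₀ hD0]
      exact h4
    linarith
  exact_mod_cast h3

/-- The `A_∞` property of the scalar weights `|u M|^p`, uniformly in `M`. The complement of `E` has
measure at least one half, and on it `U M = (U ui)(u M)` with Hölder bounds `|U M|`, hence the full
norm of `u M`, by the norm over the complement. So the complement carries a fixed share of the mass.
-/
theorem IsRedPair.setLIntegral_le {X : Type*} [MeasurableSpace X] {d : ℕ} {ν : Measure X}
    [IsProbabilityMeasure ν] {p q : ℝ} {u ui : X → Mat d} {U U' : Mat d} {K : ℝ≥0}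
    (h : IsRedPair ν p q u ui U U' K) {E : Set X} (hE : MeasurableSet E) (hE2 : ν E ≤ 1 / 2)
    (M : Mat d) :
    ∫⁻ x in E, ‖u x * M‖ₑ ^ p ∂ν ≤ massRatio p K * ∫⁻ x, ‖u x * M‖ₑ ^ p ∂ν := by
  have hp := h.holder.pos
  have hq := h.holder.symm.pos
  have hfin : ∫⁻ x, ‖u x * M‖ₑ ^ p ∂ν ≠ ∞ := by
    rw [← lpNorm_rpow hp]
    refine ENNReal.rpow_ne_top_of_nonneg hp.le (ne_top_of_le_ne_top ?_ (h.red.le M))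
    finiteness
  refine le_massRatio_mul hp hfin (lintegral_add_compl _ hE) ?_
  have hEc : 1 ≤ 2 * ν Eᶜ := by
    have h1 : ν E + ν Eᶜ = 1 := by rw [measure_add_measure_compl hE, measure_univ]
    by_contra! hlt
    have h2 : ν Eᶜ < 1 / 2 := by
      rw [ENNReal.lt_div_iff_mul_lt (by simp) (by simp), mul_comm]
      exact hlt
    have h3 := ENNReal.add_lt_add_of_le_of_lt (by finiteness) hE2 h2
    rw [h1, ENNReal.add_halves] at h3
    exact lt_irrefl _ h3
  have key : ‖U * M‖ₑ * ν Eᶜ ≤ K * K * (∫⁻ x in Eᶜ, ‖u x * M‖ₑ ^ p ∂ν) ^ (1 / p) := by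
    calc ‖U * M‖ₑ * ν Eᶜ = ∫⁻ _ in Eᶜ, ‖U * M‖ₑ ∂ν := by rw [setLIntegral_const]
      _ ≤ ∫⁻ x in Eᶜ, ‖U * ui x‖ₑ * ‖u x * M‖ₑ ∂ν := by
          refine lintegral_mono_ae (ae_restrict_of_ae (h.swap.inv.mono fun x hx => ?_))
          refine le_trans (le_of_eq ?_) (enorm_mat_mul_le _ _)
          rw [Matrix.mul_assoc, ← Matrix.mul_assoc (ui x), hx, Matrix.one_mul]
      _ ≤ lpNorm q (ν.restrict Eᶜ) (fun x => ‖U * ui x‖ₑ) *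
            lpNorm p (ν.restrict Eᶜ) (fun x => ‖u x * M‖ₑ) :=
          lintegral_mul_le_lpNorm h.holder.symm (h.measi.const_mul _).enorm.restrict
            (h.meas.mul_const _).enorm.restrict
      _ ≤ _ := by
          refine mul_le_mul' (le_trans ?_ h.lpNorm_inv_mul_le) le_rfl
          exact ENNReal.rpow_le_rpow (setLIntegral_le_lintegral _ _) (by positivity)
  rw [← lpNorm_rpow hp]
  refine ENNReal.rpow_le_rpow ?_ hp.le
  calc lpNorm p ν (fun x => ‖u x * M‖ₑ) ≤ K * ‖U * M‖ₑ := h.red.le M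
    _ ≤ K * (‖U * M‖ₑ * (2 * ν Eᶜ)) := by
        gcongr
        exact le_mul_of_one_le_right' hEc
    _ = 2 * K * (‖U * M‖ₑ * ν Eᶜ) := by ring
    _ ≤ 2 * K * (K * K * (∫⁻ x in Eᶜ, ‖u x * M‖ₑ ^ p ∂ν) ^ (1 / p)) := by gcongr
    _ = _ := by ring

/-- The constant in the John–Nirenberg inequality for a dyadic system with `N` children. -/
noncomputable def jnConst (p : ℝ) (K N : ℝ≥0) : ℝ≥0 :=
  2 * N * K ^ 2 / (1 - massRatio p K ^ (1 / p))

/-- The constant is the fixed point of the recursion in the John–Nirenberg induction: `2 N K ^ 2` is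
the contribution outside the stopping cells, and the other term is what the induction hypothesis
gives inside them. -/
theorem jnConst_eq {p : ℝ} (hp : 0 < p) (K N : ℝ≥0) :
    2 * N * K ^ 2 + jnConst p K N * massRatio p K ^ (1 / p) = jnConst p K N := by
  have h : massRatio p K ^ (1 / p) < 1 :=
    NNReal.rpow_lt_one (massRatio_lt_one p K) (by positivity)
  have h1 : jnConst p K N * (1 - massRatio p K ^ (1 / p)) = 2 * N * K ^ 2 :=
    div_mul_cancel₀ _ (tsub_pos_of_lt h).ne'
  rw [← h1, ← mul_add, tsub_add_cancel_of_le h.le, mul_one]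

/-! ### The John–Nirenberg inequality -/

namespace DyadicSystem

variable {X : Type*} [MeasurableSpace X] {μ : Measure X} {ι β : Type*} [Fintype β] {d : ℕ}
  (S : DyadicSystem X μ ι β) {p q : ℝ} {v vi u ui B : X → Mat d} {V V' U U' : ι → Mat d} {K : ℝ≥0}

theorem setLIntegral_prob {r : ι} {E : Set X} (hE : MeasurableSet E) (hEr : E ⊆ S.set r)
    (f : X → ℝ≥0∞) :
    ∫⁻ x in E, f x ∂(S.prob r) = (μ (S.set r))⁻¹ * ∫⁻ x in E, f x ∂μ := by
  rw [prob, ProbabilityTheory.cond, Measure.restrict_smul, Measure.restrict_restrict hE,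
    inter_eq_self_of_subset_left hEr, lintegral_smul_measure, smul_eq_mul]

/-- Strong induction on the number of generations, with a constant independent of `k`. Having an
arbitrary `M` and the pointwise weight `u` on the right lets the induction hypothesis on the
stopping cells be summed, whereas a bound in terms of `U r` would change from cell to cell. -/
theorem lpNorm_cellAvg_le [Nonempty β]
    (hV : ∀ r, IsRedPair (S.prob r) p q v vi (V r) (V' r) K)
    (hU : ∀ r, IsRedPair (S.prob r) p q u ui (U r) (U' r) K)
    (hB : ∀ r, Integrable B (S.prob r)) {T : ℝ≥0} (hT : 0 < T)
    (hosc : ∀ r, oscTilde (S.prob r) (V r) (U r) B ≤ T) (k : ℕ) (r : ι) (M : Mat d) :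
    lpNorm p (S.prob r) (fun x => ‖v x * (S.cellAvg B k r x - ∫ y, B y ∂(S.prob r)) * M‖ₑ) ≤
      (jnConst p K (Fintype.card β) * T : ℝ≥0) * lpNorm p (S.prob r) (fun x => ‖u x * M‖ₑ) := by
  have hp : 0 < p := (hV r).holder.pos
  induction k using Nat.strong_induction_on generalizing r M with
  | _ k ih =>
  set C : ℝ≥0 := jnConst p K (Fintype.card β) with hC
  set c := ∫ y, B y ∂(S.prob r) with hc
  have hm : ∀ j < k, ∀ r, ∀ M : Mat d,
      ∫⁻ x in S.set r, ‖v x * (S.cellAvg B j r x - ∫ y, B y ∂(S.prob r)) * M‖ₑ ^ p ∂μ ≤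
        ((C * T : ℝ≥0) : ℝ≥0∞) ^ p * ∫⁻ x in S.set r, ‖u x * M‖ₑ ^ p ∂μ := by
    intro j hj r M
    rw [S.setLIntegral_eq, S.setLIntegral_eq, mul_left_comm]
    refine mul_le_mul_right ?_ _
    rw [← lpNorm_rpow hp, ← lpNorm_rpow hp, ← ENNReal.mul_rpow_of_nonneg _ _ hp.le]
    exact ENNReal.rpow_le_rpow (ih j hj r M) hp.le
  have hr1 : ∫⁻ x in S.set r, ‖V r * (B x - c) * (U r)⁻¹‖ₑ ∂μ ≤ T * μ (S.set r) := by
    rw [S.setLIntegral_eq, mul_comm]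
    exact mul_le_mul_left (hosc r) _
  -- The threshold `2 * T` is twice the bound on the average over `r`, so by Chebyshev `E` fills at
  -- most half of `r`; this is where `T` must be positive.
  obtain ⟨E, h, hE, hEr, hh, hEt, hbd, hM⟩ := S.exists_stopping hB hm hp (V r) c (U r)⁻¹ k le_rfl r
    (t := 2 * T) (hr1.trans (mul_le_mul_left (le_mul_of_one_le_left' (by norm_num)) _))
  have hEhalf : S.prob r E ≤ 1 / 2 := by
    have h1 : (T : ℝ≥0∞) * (2 * μ E) ≤ T * μ (S.set r) := by
      refine le_trans (le_of_eq (by ring)) (hEt.trans ((lintegral_mono_set hEr).trans hr1))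
    rw [ENNReal.mul_le_mul_iff_right (by exact_mod_cast hT.ne') ENNReal.coe_ne_top] at h1
    rw [prob, ProbabilityTheory.cond_apply (S.measurableSet_set r),
      inter_eq_self_of_subset_right hEr, ENNReal.le_div_iff_mul_le (by simp) (by simp), mul_assoc,
      mul_comm (μ E), ENNReal.inv_mul_le_iff (S.measure_ne_zero r) (S.measure_ne_top r), mul_one]
    exact h1
  have hsmall := (hU r).setLIntegral_le hE hEhalf M
  -- Inside the stopping cells the constant `C` comes back, but multiplied by a factor below one,
  -- since `E` carries only the proportion `massRatio` of the mass.
  have bad : lpNorm p (S.prob r) (fun x => ‖v x * h x * M‖ₑ) ≤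
      (C * T * massRatio p K ^ (1 / p) : ℝ≥0) * lpNorm p (S.prob r) (fun x => ‖u x * M‖ₑ) := by
    rw [← ENNReal.rpow_le_rpow_iff hp, lpNorm_rpow hp, ENNReal.mul_rpow_of_nonneg _ _ hp.le,
      lpNorm_rpow hp, ENNReal.coe_mul, ENNReal.mul_rpow_of_nonneg _ _ hp.le,
      ENNReal.coe_rpow_of_nonneg _ (by positivity : 0 ≤ 1 / p), ← ENNReal.rpow_mul, one_div,
      inv_mul_cancel₀ hp.ne', ENNReal.rpow_one]
    calc ∫⁻ x, ‖v x * h x * M‖ₑ ^ p ∂(S.prob r)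
        = (μ (S.set r))⁻¹ * ∫⁻ x in S.set r, ‖v x * h x * M‖ₑ ^ p ∂μ := S.lintegral_prob r _
      _ ≤ (μ (S.set r))⁻¹ * (((C * T : ℝ≥0) : ℝ≥0∞) ^ p * ∫⁻ x in E, ‖u x * M‖ₑ ^ p ∂μ) := by
          gcongr
          exact hM M
      _ = ((C * T : ℝ≥0) : ℝ≥0∞) ^ p * ∫⁻ x in E, ‖u x * M‖ₑ ^ p ∂(S.prob r) := by
          rw [S.setLIntegral_prob hE hEr]
          ring
      _ ≤ _ := by
          rw [mul_assoc]
          gcongr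
  -- Outside the part described by `h`, the middle factor is pointwise bounded and only the
  -- normalized factors `v V⁻¹` and `U M` remain.
  have good : lpNorm p (S.prob r) (fun x => ‖v x * (V r)⁻¹‖ₑ * (Fintype.card β * (2 * T) *
        ‖U r * M‖ₑ)) ≤
      (2 * Fintype.card β * K ^ 2 * T : ℝ≥0) * lpNorm p (S.prob r) (fun x => ‖u x * M‖ₑ) := by
    rw [lpNorm_mul_const hp (by finiteness)]
    calc _ ≤ (K : ℝ≥0∞) * (Fintype.card β * (2 * T) *
            (K * lpNorm p (S.prob r) (fun x => ‖u x * M‖ₑ))) := by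
          gcongr
          · exact (hV r).lpNorm_mul_inv_le
          · exact (hU r).red.ge M
      _ = _ := by push_cast; ring
  have hpt : ∀ᵐ x ∂(S.prob r), ‖v x * (S.cellAvg B k r x - c) * M‖ₑ ≤
      ‖v x * (V r)⁻¹‖ₑ * (Fintype.card β * (2 * T) * ‖U r * M‖ₑ) + ‖v x * h x * M‖ₑ := by
    filter_upwards [ProbabilityTheory.ae_cond_mem (S.measurableSet_set r)] with x hx
    have e : v x * (S.cellAvg B k r x - c) * M = (v x * (V r)⁻¹) *
        (V r * (S.cellAvg B k r x - c - h x) * (U r)⁻¹) * (U r * M) + v x * h x * M := by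
      have e1 : (v x * (V r)⁻¹) * (V r * (S.cellAvg B k r x - c - h x) * (U r)⁻¹) * (U r * M) =
          v x * (S.cellAvg B k r x - c - h x) * M := by
        calc _ = v x * ((V r)⁻¹ * V r) * (S.cellAvg B k r x - c - h x) * ((U r)⁻¹ * U r) * M := by
              simp only [Matrix.mul_assoc]
          _ = _ := by rw [(hV r).inv_mul, (hU r).inv_mul, Matrix.mul_one, Matrix.mul_one]
      rw [e1, ← Matrix.add_mul, ← Matrix.mul_add, sub_add_cancel]
    rw [e]
    refine (enorm_add_le _ _).trans (add_le_add ((enorm_mat_mul₃_le _ _ _).trans ?_) le_rfl)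
    rw [mul_assoc]
    gcongr
    exact hbd x hx
  calc _ ≤ _ := lpNorm_mono_ae hp.le hpt
    _ ≤ _ := lpNorm_add_le (hV r).holder.lt.le
        (((hV r).meas.mul_const _).enorm.mul_const _)
        (((hV r).meas.mul hh.aestronglyMeasurable).mul_const _).enorm
    _ ≤ _ := add_le_add good bad
    _ = ((2 * Fintype.card β * K ^ 2 + C * massRatio p K ^ (1 / p)) * T : ℝ≥0) *
          lpNorm p (S.prob r) (fun x => ‖u x * M‖ₑ) := by
        rw [← add_mul, ← ENNReal.coe_add]
        congr 2
        ring
    _ = _ := by rw [hC, jnConst_eq hp]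

open Filter Topology in
-- The bound for the dyadic averages is uniform in the generation, so Fatou's lemma carries it to
-- their limit `B`.
theorem lpNorm_oscillation_le [Nonempty β]
    (hV : ∀ r, IsRedPair (S.prob r) p q v vi (V r) (V' r) K)
    (hU : ∀ r, IsRedPair (S.prob r) p q u ui (U r) (U' r) K)
    (hB : ∀ r, Integrable B (S.prob r))
    (hlim : ∀ r, ∀ᵐ x ∂(S.prob r), Tendsto (fun k => S.cellAvg B k r x) atTop (𝓝 (B x)))
    {T : ℝ≥0} (hT : 0 < T)
    (hosc : ∀ r, oscTilde (S.prob r) (V r) (U r) B ≤ T) (r : ι) (M : Mat d) :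
    lpNorm p (S.prob r) (fun x => ‖v x * (B x - ∫ y, B y ∂(S.prob r)) * M‖ₑ) ≤
      (jnConst p K (Fintype.card β) * T : ℝ≥0) * lpNorm p (S.prob r) (fun x => ‖u x * M‖ₑ) := by
  refine lpNorm_le_of_tendsto (hV r).holder.pos (fun k => ?_) ?_
    (fun k => S.lpNorm_cellAvg_le hV hU hB hT hosc k r M) tendsto_const_nhds
  · exact (((hV r).meas.mul ((S.stronglyMeasurable_cellAvg B k r).aestronglyMeasurable.sub
      aestronglyMeasurable_const)).mul_const _).enorm
  · filter_upwards [hlim r] with x hx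
    exact ((tendsto_const_nhds.mul (hx.sub tendsto_const_nhds)).mul tendsto_const_nhds).enorm

open Filter Topology in
theorem osc_le [Nonempty β]
    (hV : ∀ r, IsRedPair (S.prob r) p q v vi (V r) (V' r) K)
    (hU : ∀ r, IsRedPair (S.prob r) p q u ui (U r) (U' r) K)
    (hB : ∀ r, Integrable B (S.prob r))
    (hlim : ∀ r, ∀ᵐ x ∂(S.prob r), Tendsto (fun k => S.cellAvg B k r x) atTop (𝓝 (B x)))
    {T : ℝ≥0} (hT : 0 < T)
    (hosc : ∀ r, oscTilde (S.prob r) (V r) (U r) B ≤ T) (r : ι) :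
    osc (S.prob r) p v (U r) B ≤ (jnConst p K (Fintype.card β) * K : ℝ≥0) * T := by
  refine (S.lpNorm_oscillation_le hV hU hB hlim hT hosc r (U r)⁻¹).trans ?_
  refine (mul_le_mul_right (hU r).lpNorm_mul_inv_le _).trans (le_of_eq ?_)
  push_cast
  ring

end DyadicSystem

/-! ### Reducing operators of matrix weights -/

theorem toEuclideanLin_mul_apply {d : ℕ} (A B : Mat d) (e : EuclideanSpace ℂ (Fin d)) :
    Matrix.toEuclideanLin (A * B) e = Matrix.toEuclideanLin A (Matrix.toEuclideanLin B e) := by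
  simp [Matrix.toLpLin_apply, Matrix.mulVec_mulVec]

theorem aemeasurable_enorm_toEuclideanLin {X : Type*} [MeasurableSpace X] {ν : Measure X} {d : ℕ}
    {w : X → Mat d} (hw : AEStronglyMeasurable w ν) (e : EuclideanSpace ℂ (Fin d)) :
    AEMeasurable (fun x => ‖Matrix.toEuclideanLin (w x) e‖ₑ) ν := by
  have hc : Continuous fun A : Mat d => Matrix.toEuclideanLin A e :=
    ((LinearMap.applyₗ e).comp (Matrix.toEuclideanLin (𝕜 := ℂ) (m := Fin d)
      (n := Fin d)).toLinearMap).continuous_of_finiteDimensional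
  exact (hc.comp_aestronglyMeasurable hw).enorm

/-- The constant with which reducing operators reduce matrix norms. -/
noncomputable def redConst (d : ℕ) : ℝ≥0 := d * (NNReal.sqrt d + 1)

/-- The constant of the reducing pair of a weight with `A_p` characteristic at most `k`. -/
noncomputable def redPairConst (d : ℕ) (p : ℝ) (k : ℝ≥0) : ℝ≥0 :=
  redConst d + redConst d * redConst d * k ^ (1 / p)

section Mono

variable {X : Type*} [MeasurableSpace X] {ν : Measure X} {d : ℕ} {p q : ℝ} {w wi w' : X → Mat d}
  {A A' : Mat d} {K L : ℝ≥0}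

theorem IsMatRed.mono (h : IsMatRed ν p w A K) (hKL : K ≤ L) : IsMatRed ν p w A L where
  le M := (h.le M).trans (mul_le_mul_left (by exact_mod_cast hKL) _)
  ge M := (h.ge M).trans (mul_le_mul_left (by exact_mod_cast hKL) _)

theorem IsMatRed.congr_ae (h : IsMatRed ν p w A K) (hw : ∀ᵐ x ∂ν, w x = w' x) :
    IsMatRed ν p w' A K := by
  have : ∀ M : Mat d, lpNorm p ν (fun x => ‖w' x * M‖ₑ) = lpNorm p ν (fun x => ‖w x * M‖ₑ) :=
    fun M => lpNorm_congr_ae (hw.mono fun x hx => by rw [hx])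
  exact ⟨fun M => (this M).trans_le (h.le M), fun M => (this M).symm ▸ h.ge M⟩

theorem IsRedPair.mono (h : IsRedPair ν p q w wi A A' K) (hKL : K ≤ L) :
    IsRedPair ν p q w wi A A' L :=
  { h with
    red := h.red.mono hKL
    redi := h.redi.mono hKL
    norm_mul_le := h.norm_mul_le.trans (by exact_mod_cast hKL) }

end Mono

theorem neg_one_div_conjExponent {p : ℝ} (hp : 1 < p) :
    -1 / (p - 1) * (1 / p.conjExponent) = -1 / p := by
  rw [Real.conjExponent]
  have h1 : p - 1 ≠ 0 := by linarith
  have h2 : p ≠ 0 := by linarith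
  field_simp

/-- The exponents multiply to `-1 / p`. Consequently the objects of the dual weight at the exponent
`p'` are those of `W` with the two members of the inverse pair exchanged. -/
theorem mpow_dualWeight {p : ℝ} (hp : 1 < p) {X : Type*} {d : ℕ} {W : X → Mat d}
    {x : X} (hx : (W x).PosDef) :
    mpow (dualWeight p W x) (1 / p.conjExponent) = mpow (W x) (-1 / p) := by
  rw [dualWeight, mpow_mpow hx, neg_one_div_conjExponent hp]

section Weights

variable {X : Type*} [MeasureSpace X] {d : ℕ} {p : ℝ} {W V U B : X → Mat d} {E : Set X}

/-- The normalized restriction of the volume to a set. -/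
noncomputable abbrev avgMeasure (E : Set X) : Measure X := ProbabilityTheory.cond volume E

theorem ae_avgMeasure {P : X → Prop} (h : ∀ᵐ x, P x) : ∀ᵐ x ∂(avgMeasure E), P x :=
  ProbabilityTheory.cond_absolutelyContinuous.ae_le h

theorem setLAverage_eq_lintegral (f : X → ℝ≥0∞) :
    ⨍⁻ x in E, f x ∂volume = ∫⁻ x, f x ∂(avgMeasure E) := setLAverage_eq' _ _ _

theorem setAverage_eq_integral (f : X → Mat d) :
    ⨍ x in E, f x ∂volume = ∫ x, f x ∂(avgMeasure E) := setAverage_eq' _ _ _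

theorem weightedAvg_eq (e : EuclideanSpace ℂ (Fin d)) :
    weightedAvg p W E e =
      lpNorm p (avgMeasure E) (fun x => ‖Matrix.toEuclideanLin (mpow (W x) (1 / p)) e‖ₑ) := by
  rw [weightedAvg, setLAverage_eq_lintegral, lpNorm]

/-- Apply the vector inequalities to each column of `M`; summing the columns produces the factor
`d`. -/
theorem IsReducing.isMatRed {A : Mat d} (hA : IsReducing p W E A) (hp : 1 ≤ p)
    (hW : AEStronglyMeasurable (fun x => mpow (W x) (1 / p)) (avgMeasure E)) :
    IsMatRed (avgMeasure E) p (fun x => mpow (W x) (1 / p)) A (redConst d) where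
  le M := by
    have hp0 : 0 ≤ p := zero_le_one.trans hp
    calc _ ≤ lpNorm p (avgMeasure E) (fun x => ∑ j, ‖Matrix.toEuclideanLin (mpow (W x) (1 / p))
            (Matrix.toEuclideanLin M (EuclideanSpace.single j 1))‖ₑ) := by
          refine lpNorm_mono hp0 fun x => (enorm_le_sum_single _).trans (le_of_eq ?_)
          simp only [toEuclideanLin_mul_apply]
      _ ≤ ∑ j, weightedAvg p W E (Matrix.toEuclideanLin M (EuclideanSpace.single j 1)) := by
          refine (lpNorm_sum_le _ hp fun j _ => aemeasurable_enorm_toEuclideanLin hW _).trans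
            (le_of_eq ?_)
          simp only [weightedAvg_eq]
      _ ≤ ∑ _j : Fin d, ‖A * M‖ₑ := by
          refine Finset.sum_le_sum fun j _ => (hA.2 _).1.trans ?_
          rw [← toEuclideanLin_mul_apply]
          exact enorm_toEuclideanLin_single_le _ _
      _ = d * ‖A * M‖ₑ := by simp
      _ ≤ _ := by
          refine mul_le_mul_left ?_ _
          rw [redConst]
          push_cast
          exact le_mul_of_one_le_right' le_add_self
  ge M := by
    have hp0 : 0 ≤ p := zero_le_one.trans hp
    calc _ ≤ ∑ j, ‖Matrix.toEuclideanLin (A * M) (EuclideanSpace.single j 1)‖ₑ :=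
          enorm_le_sum_single _
      _ ≤ ∑ _j : Fin d, (NNReal.sqrt d : ℝ≥0∞) *
            lpNorm p (avgMeasure E) (fun x => ‖mpow (W x) (1 / p) * M‖ₑ) := by
          refine Finset.sum_le_sum fun j _ => ?_
          rw [toEuclideanLin_mul_apply]
          refine (hA.2 _).2.trans (mul_le_mul' (le_of_eq ?_) ?_)
          · rw [ENNReal.ofReal, Real.sqrt, Real.toNNReal_coe, Real.toNNReal_natCast]
          · rw [weightedAvg_eq]
            refine lpNorm_mono hp0 fun x => ?_
            rw [← toEuclideanLin_mul_apply]
            exact enorm_toEuclideanLin_single_le _ _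
      _ = d * NNReal.sqrt d * lpNorm p (avgMeasure E) (fun x => ‖mpow (W x) (1 / p) * M‖ₑ) := by
          simp [mul_assoc]
      _ ≤ _ := by
          refine mul_le_mul_left ?_ _
          rw [redConst]
          push_cast
          exact mul_le_mul_right le_self_add _

/-- The bound on `|A A'|` comes from reducing twice: `A` is replaced by an `L^p` norm in `x`, then,
after taking adjoints, `A'` by an `L^{p'}` norm in `y`. The result is the mixed norm in the
definition of the `A_p` characteristic, to the power `1 / p`. -/
theorem isRedPair_of_isReducing (hp : 1 < p) {𝓕 : Set (Set X)} (hE : E ∈ 𝓕)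
    (hW : AEStronglyMeasurable W volume) (hpos : ∀ᵐ x, (W x).PosDef) {k : ℝ≥0}
    (hk : apChar 𝓕 p W ≤ k) {A A' : Mat d} (hA : IsReducing p W E A)
    (hA' : IsReducing p.conjExponent (dualWeight p W) E A') :
    IsRedPair (avgMeasure E) p p.conjExponent (fun x => mpow (W x) (1 / p))
      (fun x => mpow (W x) (-1 / p)) A A' (redPairConst d p k) := by
  have hpq : p.HolderConjugate p.conjExponent := Real.HolderConjugate.conjExponent hp
  have hp0 := hpq.pos
  have hq0 := hpq.symm.pos
  have hWm : AEStronglyMeasurable W (avgMeasure E) :=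
    hW.mono_ac ProbabilityTheory.cond_absolutelyContinuous
  have hpos' := ae_avgMeasure (E := E) hpos
  have hdual : ∀ᵐ x ∂(avgMeasure E),
      mpow (dualWeight p W x) (1 / p.conjExponent) = mpow (W x) (-1 / p) :=
    hpos'.mono fun x hx => mpow_dualWeight hp hx
  have hm := aestronglyMeasurable_mpow hWm hpos' (1 / p)
  have hmi := aestronglyMeasurable_mpow hWm hpos' (-1 / p)
  have hred := hA.isMatRed hp.le hm
  have hredi := (hA'.isMatRed hpq.symm.lt.le (hmi.congr (hdual.mono fun _ hx => hx.symm))).congr_ae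
    hdual
  have hle : redConst d ≤ redPairConst d p k := le_self_add
  refine ⟨hpq, hm, hmi, ae_of_all _ fun x => mpow_isHermitian _ _,
    ae_of_all _ fun x => mpow_isHermitian _ _, ?_, hA.1, hA'.1, hred.mono hle, hredi.mono hle, ?_⟩
  · filter_upwards [hpos'] with x hx
    rw [neg_div]
    exact mpow_mul_mpow_neg hx _
  have hap : lpNorm p (avgMeasure E) (fun x => lpNorm p.conjExponent (avgMeasure E)
      (fun y => ‖mpow (W x) (1 / p) * mpow (W y) (-1 / p)‖ₑ)) ≤ (k ^ (1 / p) : ℝ≥0) := by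
    rw [ENNReal.coe_rpow_of_nonneg _ (by positivity)]
    refine ENNReal.rpow_le_rpow (le_trans (le_of_eq ?_) ((le_iSup₂ E hE).trans hk)) (by positivity)
    simp only [setLAverage_eq_lintegral, lpNorm, ← ENNReal.rpow_mul, one_div_mul_eq_div]
  calc ‖A * A'‖ₑ ≤ redConst d * lpNorm p (avgMeasure E) (fun x => ‖mpow (W x) (1 / p) * A'‖ₑ) :=
        hred.ge A'
    _ ≤ redConst d * lpNorm p (avgMeasure E) (fun x => redConst d *
          lpNorm p.conjExponent (avgMeasure E)
            (fun y => ‖mpow (W x) (1 / p) * mpow (W y) (-1 / p)‖ₑ)) := by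
        gcongr
        refine lpNorm_mono hp0.le fun x => ?_
        rw [enorm_mul_comm_of_isHermitian (mpow_isHermitian _ _) hA'.1.1]
        refine (hredi.ge _).trans (le_of_eq ?_)
        congr 2
        ext1 y
        exact enorm_mul_comm_of_isHermitian (mpow_isHermitian _ _) (mpow_isHermitian _ _)
    _ ≤ redConst d * (redConst d * (k ^ (1 / p) : ℝ≥0)) := by
        rw [lpNorm_const_mul hp0 ENNReal.coe_ne_top]
        gcongr
    _ ≤ _ := by
        rw [redPairConst]
        push_cast
        rw [← mul_assoc]
        exact le_add_self

/-! ### The norms as suprema of oscillations -/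

theorem bmoNorm_eq (𝓕 : Set (Set X)) (𝓤 : Set X → Mat d) :
    bmoNorm 𝓕 p 𝓤 V B =
      ⨆ R ∈ 𝓕, osc (avgMeasure R) p (fun x => mpow (V x) (1 / p)) (𝓤 R) B := by
  simp only [bmoNorm, setLAverage_eq_lintegral, setAverage_eq_integral, osc, lpNorm]

theorem bmoTildeNorm_eq (𝓕 : Set (Set X)) (𝓤 𝓥 : Set X → Mat d) :
    bmoTildeNorm 𝓕 𝓤 𝓥 B = ⨆ R ∈ 𝓕, oscTilde (avgMeasure R) (𝓥 R) (𝓤 R) B := by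
  simp only [bmoTildeNorm, setLAverage_eq_lintegral, setAverage_eq_integral, oscTilde]

theorem bmoOneNorm_eq (𝓕 : Set (Set X)) :
    bmoOneNorm 𝓕 p U V B = ⨆ R ∈ 𝓕, oscOne (avgMeasure R) p p.conjExponent
      (fun x => mpow (V x) (1 / p)) (fun x => mpow (U x) (-1 / p)) B := by
  simp only [bmoOneNorm, setLAverage_eq_lintegral, oscOne, lpNorm, ← ENNReal.rpow_mul,
    one_div_mul_eq_div]

/-- Taking adjoints inside the norm exchanges the roles of `x` and `y`: the second pointwise variant
is the first one for the dual data, and needs no separate argument. -/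
theorem bmoTwoNorm_eq (𝓕 : Set (Set X)) :
    bmoTwoNorm 𝓕 p U V B = ⨆ R ∈ 𝓕, oscOne (avgMeasure R) p.conjExponent p
      (fun x => mpow (U x) (-1 / p)) (fun x => mpow (V x) (1 / p)) (fun x => (B x)ᴴ) := by
  have h : ∀ x y, ‖mpow (U y) (-1 / p) * ((B y)ᴴ - (B x)ᴴ) * mpow (V x) (1 / p)‖ₑ =
      ‖mpow (V x) (1 / p) * (B x - B y) * mpow (U y) (-1 / p)‖ₑ := fun x y => by
    rw [← enorm_conjTranspose, ← enorm_neg]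
    simp only [Matrix.conjTranspose_mul, Matrix.conjTranspose_sub,
      Matrix.conjTranspose_conjTranspose, (mpow_isHermitian _ _).eq, ← Matrix.mul_assoc]
    rw [← Matrix.neg_mul, ← Matrix.mul_neg, neg_sub]
  simp only [bmoTwoNorm, setLAverage_eq_lintegral, oscOne, lpNorm, ← ENNReal.rpow_mul,
    one_div_mul_eq_div, h]

theorem bmoNorm_dual_eq (hp : 1 < p) (hpos : ∀ᵐ x, (W x).PosDef) (𝓕 : Set (Set X))
    (𝓤 : Set X → Mat d) :
    bmoNorm 𝓕 p.conjExponent 𝓤 (dualWeight p W) B =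
      ⨆ R ∈ 𝓕, osc (avgMeasure R) p.conjExponent (fun x => mpow (W x) (-1 / p)) (𝓤 R) B := by
  rw [bmoNorm_eq]
  refine iSup_congr fun R => iSup_congr fun _ => lpNorm_congr_ae ?_
  filter_upwards [ae_avgMeasure hpos] with x hx
  rw [mpow_dualWeight hp hx]

end Weights

/-! ### Cubes and rectangles -/

section Cube

variable {n : ℕ}

/-- The cube with lower corner `a` and side length `l`. -/
def cube (a : Fin n → ℝ) (l : ℝ) : Set (Fin n → ℝ) := Set.pi univ fun i => Ico (a i) (a i + l)

/-- The lower corner of a dyadic child of a cube. -/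
noncomputable def subCorner (a : Fin n → ℝ) (l : ℝ) (ε : Fin n → Bool) : Fin n → ℝ :=
  fun i => a i + if ε i then l / 2 else 0

/-- The dyadic child of a cube to which a point belongs. -/
noncomputable def cubeLoc (a : Fin n → ℝ) (l : ℝ) (x : Fin n → ℝ) : Fin n → Bool :=
  fun i => decide (a i + l / 2 ≤ x i)

theorem mem_cube {a : Fin n → ℝ} {l : ℝ} {x : Fin n → ℝ} :
    x ∈ cube a l ↔ ∀ i, a i ≤ x i ∧ x i < a i + l := by
  simp [cube]

theorem measurableSet_cube (a : Fin n → ℝ) (l : ℝ) : MeasurableSet (cube a l) :=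
  MeasurableSet.univ_pi fun _ => measurableSet_Ico

theorem cube_subCorner {a : Fin n → ℝ} {l : ℝ} (hl : 0 < l) (ε : Fin n → Bool) :
    cube (subCorner a l ε) (l / 2) = cube a l ∩ cubeLoc a l ⁻¹' {ε} := by
  ext x
  simp only [mem_inter_iff, mem_cube, mem_preimage, mem_singleton_iff, funext_iff, ← forall_and]
  refine forall_congr' fun i => ?_
  simp only [subCorner, cubeLoc]
  cases hε : ε i
  · simp only [Bool.false_eq_true, if_false, decide_eq_false_iff_not, not_le]
    constructor <;> rintro h <;> refine ⟨?_, ?_⟩ <;> (try constructor) <;> linarith [h.1, h.2]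
  · simp only [if_true, decide_eq_true_eq]
    constructor <;> rintro h <;> refine ⟨?_, ?_⟩ <;> (try constructor) <;> linarith [h.1, h.2]

theorem measurable_cubeLoc (a : Fin n → ℝ) (l : ℝ) : Measurable (cubeLoc a l) :=
  measurable_pi_lambda _ fun i => measurable_to_bool <| by
    have : (fun x : Fin n → ℝ => cubeLoc a l x i) ⁻¹' {true} = {x | a i + l / 2 ≤ x i} := by
      ext x
      simp [cubeLoc]
    rw [this]
    exact measurableSet_le measurable_const (measurable_pi_apply i)

theorem volume_cube (a : Fin n → ℝ) (l : ℝ) : volume (cube a l) = ENNReal.ofReal l ^ n := by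
  simp [cube, Real.volume_pi_Ico]

theorem volume_cube_eq_mul (a a' : Fin n → ℝ) (l : ℝ) :
    volume (cube a l) = 2 ^ n * volume (cube a' (l / 2)) := by
  rw [volume_cube, volume_cube, ← mul_pow]
  congr 1
  rw [← ENNReal.ofReal_ofNat 2, ← ENNReal.ofReal_mul (by norm_num), mul_div_cancel₀ l two_ne_zero]

theorem volume_cube_ne_zero (a : Fin n → ℝ) {l : ℝ} (hl : 0 < l) : volume (cube a l) ≠ 0 := by
  rw [volume_cube]
  exact pow_ne_zero _ (ENNReal.ofReal_pos.2 hl).ne'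

theorem volume_cube_ne_top (a : Fin n → ℝ) (l : ℝ) : volume (cube a l) ≠ ∞ := by
  rw [volume_cube]
  finiteness

theorem cube_ae_eq_Icc (a : Fin n → ℝ) (l : ℝ) :
    cube a l =ᵐ[volume] Icc a (fun i => a i + l) :=
  Measure.univ_pi_Ico_ae_eq_Icc

theorem cube_subset_Icc (a : Fin n → ℝ) (l : ℝ) : cube a l ⊆ Icc a (fun i => a i + l) :=
  fun _ hx => ⟨fun i => (mem_cube.1 hx i).1, fun i => (mem_cube.1 hx i).2.le⟩

theorem interior_Icc_nonempty (a : Fin n → ℝ) {l : ℝ} (hl : 0 < l) :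
    (interior (Icc a (fun i => a i + l))).Nonempty := by
  rw [← pi_univ_Icc, interior_pi_set finite_univ, univ_pi_nonempty_iff]
  intro i
  rw [interior_Icc]
  exact nonempty_Ioo.2 (by linarith)

theorem Icc_subset_closedBall {a x : Fin n → ℝ} {l r : ℝ} (hx : x ∈ Icc a (fun i => a i + l))
    (hr : 0 ≤ r) (hlr : l ≤ r) : Icc a (fun i => a i + l) ⊆ Metric.closedBall x r := by
  intro y hy
  rw [Metric.mem_closedBall, dist_pi_le_iff hr]
  intro i
  have h1 := hx.1 i
  have h2 := hx.2 i
  have h3 := hy.1 i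
  have h4 := hy.2 i
  simp only at h2 h4
  rw [Real.dist_eq, abs_le]
  constructor <;> linarith

end Cube

/-- A rectangle in `ℝⁿ × ℝᵐ`, given by the corners and the side lengths of its two cubes. -/
structure Rect (n m : ℕ) where
  /-- The lower corner of the first cube. -/
  a : Fin n → ℝ
  /-- The lower corner of the second cube. -/
  b : Fin m → ℝ
  /-- The side length of the first cube. -/
  l : ℝ
  /-- The side length of the second cube. -/
  s : ℝ
  l_pos : 0 < l
  s_pos : 0 < s

variable {n m d : ℕ}

theorem volume_prod_set (P : Set (Fin n → ℝ)) (Q : Set (Fin m → ℝ)) :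
    volume (P ×ˢ Q) = volume P * volume Q := by
  rw [Measure.volume_eq_prod, Measure.prod_prod]

/-- The dyadic system of rectangles, each split by halving all of its sides. -/
noncomputable def rectSystem (n m : ℕ) : DyadicSystem ((Fin n → ℝ) × (Fin m → ℝ)) volume
    (Rect n m) ((Fin n → Bool) × (Fin m → Bool)) where
  set r := cube r.a r.l ×ˢ cube r.b r.s
  child r ε := ⟨subCorner r.a r.l ε.1, subCorner r.b r.s ε.2, r.l / 2, r.s / 2, half_pos r.l_pos,
    half_pos r.s_pos⟩
  loc r x := (cubeLoc r.a r.l x.1, cubeLoc r.b r.s x.2)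
  measurableSet_set r := (measurableSet_cube _ _).prod (measurableSet_cube _ _)
  measurableSet_loc r ε :=
    (((measurable_cubeLoc _ _).comp measurable_fst).prodMk
      ((measurable_cubeLoc _ _).comp measurable_snd)) (measurableSet_singleton ε)
  set_child r ε := by
    rw [cube_subCorner r.l_pos, cube_subCorner r.s_pos]
    ext x
    simp only [mem_prod, mem_inter_iff, mem_preimage, mem_singleton_iff, Prod.ext_iff]
    tauto
  measure_child r ε := by
    rw [volume_prod_set, volume_prod_set, volume_cube_eq_mul r.a _ r.l,
      volume_cube_eq_mul r.b _ r.s]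
    simp only [Fintype.card_prod, Fintype.card_fun, Fintype.card_bool, Fintype.card_fin]
    push_cast
    ring
  measure_ne_zero r := by
    rw [volume_prod_set]
    exact mul_ne_zero (volume_cube_ne_zero _ r.l_pos) (volume_cube_ne_zero _ r.s_pos)
  measure_ne_top r := by
    rw [volume_prod_set]
    exact ENNReal.mul_ne_top (volume_cube_ne_top _ _) (volume_cube_ne_top _ _)

theorem rectSystem_set_mem (r : Rect n m) : (rectSystem n m).set r ∈ rectangles n m :=
  ⟨_, ⟨r.a, r.l, r.l_pos, rfl⟩, _, ⟨r.b, r.s, r.s_pos, rfl⟩, rfl⟩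

theorem exists_rect_of_mem {R : Set ((Fin n → ℝ) × (Fin m → ℝ))} (hR : R ∈ rectangles n m) :
    ∃ r : Rect n m, (rectSystem n m).set r = R := by
  obtain ⟨_, ⟨a, l, hl, rfl⟩, _, ⟨b, s, hs, rfl⟩, rfl⟩ := hR
  exact ⟨⟨a, b, l, s, hl, hs⟩, rfl⟩

/-- The closure of a rectangle. -/
def Rect.closed (r : Rect n m) : Set ((Fin n → ℝ) × (Fin m → ℝ)) :=
  Icc r.a (fun i => r.a i + r.l) ×ˢ Icc r.b (fun i => r.b i + r.s)

theorem Rect.ae_eq_closed (r : Rect n m) : (rectSystem n m).set r =ᵐ[volume] r.closed :=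
  Measure.set_prod_ae_eq (cube_ae_eq_Icc _ _) (cube_ae_eq_Icc _ _)

theorem Rect.subset_closed (r : Rect n m) : (rectSystem n m).set r ⊆ r.closed :=
  prod_mono (cube_subset_Icc _ _) (cube_subset_Icc _ _)

theorem Rect.isCompact_closed (r : Rect n m) : IsCompact r.closed :=
  isCompact_Icc.prod isCompact_Icc

theorem integrable_prob_rect {B : (Fin n → ℝ) × (Fin m → ℝ) → Mat d}
    (hB : LocallyIntegrable B volume) (r : Rect n m) :
    Integrable B ((rectSystem n m).prob r) :=
  ((hB.integrableOn_isCompact r.isCompact_closed).mono_set r.subset_closed).smul_measure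
    (ENNReal.inv_ne_top.2 ((rectSystem n m).measure_ne_zero r))

theorem Rect.setAverage_closed (r : Rect n m) (B : (Fin n → ℝ) × (Fin m → ℝ) → Mat d) :
    ⨍ y in r.closed, B y ∂volume = ∫ y, B y ∂((rectSystem n m).prob r) := by
  rw [setAverage_eq_integral, avgMeasure, DyadicSystem.prob, ProbabilityTheory.cond,
    ProbabilityTheory.cond, measure_congr r.ae_eq_closed, Measure.restrict_congr_set r.ae_eq_closed]

theorem exists_rect_cellAvg (B : (Fin n → ℝ) × (Fin m → ℝ) → Mat d) (k : ℕ) (r : Rect n m)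
    {x : (Fin n → ℝ) × (Fin m → ℝ)} (hx : x ∈ (rectSystem n m).set r) :
    ∃ r' : Rect n m, x ∈ (rectSystem n m).set r' ∧ r'.l = r.l / 2 ^ k ∧ r'.s = r.s / 2 ^ k ∧
      (rectSystem n m).cellAvg B k r x = ∫ y, B y ∂((rectSystem n m).prob r') := by
  induction k generalizing r with
  | zero => exact ⟨r, hx, by simp, by simp, rfl⟩
  | succ k ih =>
    have hx' : x ∈ (rectSystem n m).set ((rectSystem n m).child r ((rectSystem n m).loc r x)) := by
      rw [(rectSystem n m).set_child]
      exact ⟨hx, rfl⟩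
    obtain ⟨r', h1, h2, h3, h4⟩ := ih _ hx'
    refine ⟨r', h1, h2.trans ?_, h3.trans ?_, h4⟩
    · change r.l / 2 / 2 ^ k = _
      rw [div_div, pow_succ']
    · change r.s / 2 / 2 ^ k = _
      rw [div_div, pow_succ']

theorem volume_closedBall_prod (x : (Fin n → ℝ) × (Fin m → ℝ)) {r : ℝ} (hr : 0 ≤ r) :
    volume (Metric.closedBall x r) = ENNReal.ofReal ((2 * r) ^ n * (2 * r) ^ m) := by
  rw [← Prod.mk.eta (p := x), ← closedBall_prod_same, volume_prod_set,
    Real.volume_pi_closedBall _ hr, Real.volume_pi_closedBall _ hr, Fintype.card_fin,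
    Fintype.card_fin, ENNReal.ofReal_mul (by positivity)]

theorem Rect.volume_closed (r : Rect n m) :
    volume r.closed = ENNReal.ofReal (r.l ^ n * r.s ^ m) := by
  rw [← measure_congr r.ae_eq_closed]
  change volume (cube r.a r.l ×ˢ cube r.b r.s) = _
  rw [volume_prod_set, volume_cube, volume_cube, ENNReal.ofReal_mul (pow_nonneg r.l_pos.le _),
    ENNReal.ofReal_pow r.l_pos.le, ENNReal.ofReal_pow r.s_pos.le]

open Filter Topology in
-- All cells below `r` have the eccentricity of `r`, so their closures are admissible in a Vitali
-- family whose constant may depend on `r`. No constant in the theorem depends on this one, because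
-- only convergence almost everywhere is used. Closed rectangles appear because the sets of a Vitali
-- family are closed.
theorem ae_tendsto_cellAvg {B : (Fin n → ℝ) × (Fin m → ℝ) → Mat d}
    (hB : LocallyIntegrable B volume) (r : Rect n m) :
    ∀ᵐ x ∂((rectSystem n m).prob r),
      Tendsto (fun k => (rectSystem n m).cellAvg B k r x) atTop (𝓝 (B x)) := by
  have hl := r.l_pos
  have hs := r.s_pos
  set t := r.l + r.s with ht
  have ht0 : 0 < t := add_pos hl hs
  have h1l : 1 ≤ t / r.l := (one_le_div hl).2 (by linarith)
  have h1s : 1 ≤ t / r.s := (one_le_div hs).2 (by linarith)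
  -- A cell of generation `k` lies in a sup-norm ball of radius `t / 2 ^ k`; `C` is exactly the
  -- volume ratio between the ball of three times this radius, whose sides are `6 t / 2 ^ k`, and
  -- the cell. It also exceeds the constant for tripling a ball.
  set C : ℝ := (6 * (t / r.l)) ^ n * (6 * (t / r.s)) ^ m with hC
  have hC0 : 0 ≤ C := by positivity
  have hball : ∀ x : (Fin n → ℝ) × (Fin m → ℝ), ∃ᶠ ρ in 𝓝[>] (0 : ℝ),
      volume (Metric.closedBall x (3 * ρ)) ≤ (C.toNNReal : ℝ≥0∞) *
        volume (Metric.closedBall x ρ) := fun x => by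
    refine Eventually.frequently ?_
    filter_upwards [self_mem_nhdsWithin] with ρ hρ
    have hρ0 : 0 < ρ := hρ
    change _ ≤ ENNReal.ofReal C * _
    rw [volume_closedBall_prod x (by positivity), volume_closedBall_prod x hρ0.le,
      ← ENNReal.ofReal_mul hC0]
    refine ENNReal.ofReal_le_ofReal ?_
    calc (2 * (3 * ρ)) ^ n * (2 * (3 * ρ)) ^ m = (3 * (2 * ρ)) ^ n * (3 * (2 * ρ)) ^ m := by ring
      _ ≤ (6 * (t / r.l) * (2 * ρ)) ^ n * (6 * (t / r.s) * (2 * ρ)) ^ m := by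
          gcongr <;> linarith
      _ = _ := by rw [mul_pow _ (2 * ρ), mul_pow _ (2 * ρ), hC]; ring
  set vf := Vitali.vitaliFamily (volume : Measure ((Fin n → ℝ) × (Fin m → ℝ))) C.toNNReal hball
  filter_upwards [ProbabilityTheory.ae_cond_mem ((rectSystem n m).measurableSet_set r),
    ae_avgMeasure (vf.ae_tendsto_average hB)] with x hx hlim
  choose ρ hρ using fun k => exists_rect_cellAvg B k r hx
  have hlim' : Tendsto (fun k => (ρ k).closed) atTop (vf.filterAt x) := by
    have hsub : ∀ k, (ρ k).closed ⊆ Metric.closedBall x (t / 2 ^ k) := fun k => by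
      have hxk := (ρ k).subset_closed (hρ k).1
      rw [← Prod.mk.eta (p := x), ← closedBall_prod_same]
      refine prod_mono (Icc_subset_closedBall hxk.1 (by positivity) ?_)
        (Icc_subset_closedBall hxk.2 (by positivity) ?_)
      · rw [(hρ k).2.1]
        gcongr
        linarith
      · rw [(hρ k).2.2.1]
        gcongr
        linarith
    rw [VitaliFamily.tendsto_filterAt_iff]
    refine ⟨Eventually.of_forall fun k => ⟨(ρ k).isCompact_closed.isClosed, ?_, t / 2 ^ k, hsub k, ?_⟩,
      fun ε hε => ?_⟩
    · rw [Rect.closed, interior_prod_eq]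
      exact (interior_Icc_nonempty _ (ρ k).l_pos).prod (interior_Icc_nonempty _ (ρ k).s_pos)
    · change _ ≤ ENNReal.ofReal C * _
      rw [volume_closedBall_prod x (by positivity), Rect.volume_closed, ← ENNReal.ofReal_mul hC0,
        (hρ k).2.1, (hρ k).2.2.1, hC]
      refine ENNReal.ofReal_le_ofReal (le_of_eq ?_)
      have e1 : 2 * (3 * (t / 2 ^ k)) = 6 * (t / r.l) * (r.l / 2 ^ k) := by field_simp; norm_num
      have e2 : 2 * (3 * (t / 2 ^ k)) = 6 * (t / r.s) * (r.s / 2 ^ k) := by field_simp; norm_num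
      calc _ = (6 * (t / r.l) * (r.l / 2 ^ k)) ^ n * (6 * (t / r.s) * (r.s / 2 ^ k)) ^ m := by
            rw [← e1, ← e2]
        _ = _ := by rw [mul_pow _ (r.l / 2 ^ k), mul_pow _ (r.s / 2 ^ k)]; ring
    · have h0 : Tendsto (fun k : ℕ => t / 2 ^ k) atTop (𝓝 0) := by
        have := (tendsto_pow_atTop_nhds_zero_of_lt_one (r := (1 / 2 : ℝ)) (by norm_num)
          (by norm_num)).const_mul t
        simpa [div_eq_mul_inv] using this
      filter_upwards [h0.eventually_le_const hε] with k hk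
      exact (hsub k).trans (Metric.closedBall_subset_closedBall hk)
  refine (hlim.comp hlim').congr fun k => ?_
  rw [(hρ k).2.2.2, Function.comp_apply, Rect.setAverage_closed]

/-! ### From slices to rectangles -/

theorem enorm_mul_integral_mul_le {X : Type*} [MeasurableSpace X] {d : ℕ} {ν : Measure X}
    {D : X → Mat d} (hD : Integrable D ν) (L M : Mat d) :
    ‖L * (∫ y, D y ∂ν) * M‖ₑ ≤ ∫⁻ y, ‖L * D y * M‖ₑ ∂ν := by
  have h : ∫ y, L * D y * M ∂ν = L * (∫ y, D y ∂ν) * M := by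
    rw [integral_mul_const_of_integrable (hD.const_mul L), integral_const_mul_of_integrable hD]
  rw [← h]
  exact enorm_integral_le_lintegral_enorm _

theorem lpNorm_comp_measurePreserving {X Y : Type*} [MeasurableSpace X] [MeasurableSpace Y]
    {ν : Measure X} {ν' : Measure Y} {e : Y → X} (he : MeasurePreserving e ν' ν)
    (he' : MeasurableEmbedding e) (p : ℝ) (f : X → ℝ≥0∞) :
    lpNorm p ν' (fun y => f (e y)) = lpNorm p ν f := by
  unfold lpNorm
  rw [he.lintegral_comp_emb he' fun x => f x ^ p]

theorem IsRedPair.comp_measurePreserving {X Y : Type*} [MeasurableSpace X] [MeasurableSpace Y]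
    {d : ℕ} {ν : Measure X} {ν' : Measure Y} {e : Y → X} (he : MeasurePreserving e ν' ν)
    (he' : MeasurableEmbedding e) {p q : ℝ} {w wi : X → Mat d} {A A' : Mat d} {K : ℝ≥0}
    (h : IsRedPair ν p q w wi A A' K) :
    IsRedPair ν' p q (fun y => w (e y)) (fun y => wi (e y)) A A' K where
  holder := h.holder
  meas := h.meas.comp_measurePreserving he
  measi := h.measi.comp_measurePreserving he
  herm := he.quasiMeasurePreserving.ae h.herm
  hermi := he.quasiMeasurePreserving.ae h.hermi
  inv := he.quasiMeasurePreserving.ae h.inv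
  posDef := h.posDef
  posDef' := h.posDef'
  red := by
    constructor <;> intro M <;>
      rw [lpNorm_comp_measurePreserving he he' p fun x => ‖w x * M‖ₑ]
    · exact h.red.le M
    · exact h.red.ge M
  redi := by
    constructor <;> intro M <;>
      rw [lpNorm_comp_measurePreserving he he' q fun x => ‖wi x * M‖ₑ]
    · exact h.redi.le M
    · exact h.redi.ge M
  norm_mul_le := h.norm_mul_le

section Slices

variable {X Y : Type*} [MeasurableSpace X] [MeasurableSpace Y] {d : ℕ} {μ : Measure X}
  {ν : Measure Y} [IsProbabilityMeasure μ] [IsProbabilityMeasure ν] {p q : ℝ}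

theorem measurePreserving_swap_prod : MeasurePreserving Prod.swap (ν.prod μ) (μ.prod ν) :=
  Measure.measurePreserving_swap

theorem lpNorm_prod_symm (hp : 0 < p) {F : X × Y → ℝ≥0∞} (hF : AEMeasurable F (μ.prod ν)) :
    lpNorm p ν (fun y => lpNorm p μ (fun x => F (x, y))) = lpNorm p (μ.prod ν) F := by
  unfold lpNorm
  simp only [← ENNReal.rpow_mul, one_div, inv_mul_cancel₀ hp.ne', ENNReal.rpow_one]
  rw [lintegral_prod_symm (fun z => F z ^ p) (hF.pow_const p)]

theorem aemeasurable_lpNorm_slice {F : X × Y → ℝ≥0∞} (hF : AEMeasurable F (μ.prod ν)) :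
    AEMeasurable (fun y => lpNorm p μ (fun x => F (x, y))) ν :=
  ((hF.pow_const p).prod_swap.lintegral_prod_right').pow_const _

/-- On the slice at `y`, insert `vi v = 1` and `(A y)⁻¹ A y = 1` and apply Hölder in `x`. The factor
`A y U⁻¹` is at once converted back into an `L^p` norm of `u U⁻¹` on the slice, so that Hölder in
`y` reassembles norms over the whole product. Hence neither measurability of `A` nor an `A_p` bound
on the slices is needed. -/
theorem lintegral_sub_slice_le {v vi u ui B : X × Y → Mat d} {V V' U U' : Mat d} {K s : ℝ≥0}
    (hV : IsRedPair (μ.prod ν) p q v vi V V' K) (hU : IsRedPair (μ.prod ν) p q u ui U U' K)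
    (hB : Integrable B (μ.prod ν)) {A : Y → Mat d}
    (hA : ∀ᵐ y ∂ν, (A y).PosDef ∧ IsMatRed μ p (fun x => u (x, y)) (A y) K ∧
      osc μ p (fun x => v (x, y)) (A y) (fun x => B (x, y)) ≤ s) :
    ∫⁻ z, ‖V * (B z - ∫ x, B (x, z.2) ∂μ) * U⁻¹‖ₑ ∂(μ.prod ν) ≤ (K ^ 4 * s : ℝ≥0) := by
  have hp := hV.holder.pos
  have hq := hV.holder.symm.pos
  have hb : AEStronglyMeasurable (fun z : X × Y => ∫ x, B (x, z.2) ∂μ) (μ.prod ν) :=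
    hB.integral_prod_right.1.comp_snd
  have hVm : AEMeasurable (fun z => ‖V * vi z‖ₑ) (μ.prod ν) := (hV.measi.const_mul _).enorm
  have hUm : AEMeasurable (fun z => ‖u z * U⁻¹‖ₑ) (μ.prod ν) := (hU.meas.mul_const _).enorm
  have m1 : AEMeasurable (fun z => ‖V * (B z - ∫ x, B (x, z.2) ∂μ) * U⁻¹‖ₑ) (μ.prod ν) :=
    (((hB.1.sub hb).const_mul V).mul_const U⁻¹).enorm
  rw [lintegral_prod_symm _ m1]
  have inner : ∀ᵐ y ∂ν, ∫⁻ x, ‖V * (B (x, y) - ∫ x', B (x', y) ∂μ) * U⁻¹‖ₑ ∂μ ≤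
      (lpNorm q μ (fun x => ‖V * vi (x, y)‖ₑ) * lpNorm p μ (fun x => ‖u (x, y) * U⁻¹‖ₑ)) *
        (s * K) := by
    have hinv : ∀ᵐ y ∂ν, ∀ᵐ x ∂μ, vi (x, y) * v (x, y) = 1 :=
      Measure.ae_ae_of_ae_prod (measurePreserving_swap_prod.quasiMeasurePreserving.ae hV.swap.inv)
    filter_upwards [hA, hinv, hV.meas.prod_swap.prodMk_left, hV.measi.prod_swap.prodMk_left,
      hB.1.prod_swap.prodMk_left] with y hAy hvy hvm hvim hBm
    obtain ⟨hApos, hAred, hAosc⟩ := hAy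
    have hAinv : (A y)⁻¹ * A y = 1 :=
      Matrix.nonsing_inv_mul _ ((A y).isUnit_iff_isUnit_det.1 hApos.isUnit)
    set c := ∫ x', B (x', y) ∂μ
    calc ∫⁻ x, ‖V * (B (x, y) - c) * U⁻¹‖ₑ ∂μ
        ≤ ∫⁻ x, (‖V * vi (x, y)‖ₑ * ‖v (x, y) * (B (x, y) - c) * (A y)⁻¹‖ₑ) *
            ‖A y * U⁻¹‖ₑ ∂μ := by
          refine lintegral_mono_ae (hvy.mono fun x hx => ?_)
          refine le_trans (le_of_eq ?_) (enorm_mat_mul₃_le _ _ _)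
          calc _ = ‖V * (vi (x, y) * v (x, y)) * (B (x, y) - c) * ((A y)⁻¹ * A y) * U⁻¹‖ₑ := by
                rw [hx, hAinv, Matrix.mul_one, Matrix.mul_one]
            _ = _ := by simp only [Matrix.mul_assoc]
      _ = (∫⁻ x, ‖V * vi (x, y)‖ₑ * ‖v (x, y) * (B (x, y) - c) * (A y)⁻¹‖ₑ ∂μ) *
            ‖A y * U⁻¹‖ₑ := lintegral_mul_const' _ _ enorm_ne_top
      _ ≤ (lpNorm q μ (fun x => ‖V * vi (x, y)‖ₑ) * s) *
            (K * lpNorm p μ (fun x => ‖u (x, y) * U⁻¹‖ₑ)) := by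
          refine mul_le_mul' ?_ (hAred.ge _)
          refine (lintegral_mul_le_lpNorm hV.holder.symm (hvim.const_mul V).enorm
            ((hvm.mul (hBm.sub aestronglyMeasurable_const)).mul_const _).enorm).trans ?_
          exact mul_le_mul_right hAosc _
      _ = _ := by ring
  calc _ ≤ _ := lintegral_mono_ae inner
    _ = (∫⁻ y, lpNorm q μ (fun x => ‖V * vi (x, y)‖ₑ) * lpNorm p μ (fun x => ‖u (x, y) * U⁻¹‖ₑ)
          ∂ν) * (s * K) := lintegral_mul_const' _ _ (by finiteness)
    _ ≤ (lpNorm q (μ.prod ν) (fun z => ‖V * vi z‖ₑ) *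
          lpNorm p (μ.prod ν) (fun z => ‖u z * U⁻¹‖ₑ)) * (s * K) := by
        refine mul_le_mul_left ?_ _
        rw [← lpNorm_prod_symm hq hVm, ← lpNorm_prod_symm hp hUm]
        exact lintegral_mul_le_lpNorm hV.holder.symm (aemeasurable_lpNorm_slice hVm)
          (aemeasurable_lpNorm_slice hUm)
    _ ≤ (K * K) * K * (s * K) := by
        gcongr
        · exact hV.lpNorm_inv_mul_le
        · exact hU.lpNorm_mul_inv_le
    _ = _ := by push_cast; ring

/-- The average in `x` minus the full average is the average over `x` of `B(x, y)` minus its average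
in `y`. Jensen thus bounds the second half of the triangle inequality by the deviation in the other
variable. -/
theorem oscTilde_prod_le_add {B : X × Y → Mat d} (hB : Integrable B (μ.prod ν)) (V U : Mat d) :
    oscTilde (μ.prod ν) V U B ≤
      ∫⁻ z, ‖V * (B z - ∫ x, B (x, z.2) ∂μ) * U⁻¹‖ₑ ∂(μ.prod ν) +
        ∫⁻ z, ‖V * (B z - ∫ y, B (z.1, y) ∂ν) * U⁻¹‖ₑ ∂(μ.prod ν) := by
  have hb1 : AEStronglyMeasurable (fun z : X × Y => ∫ x, B (x, z.2) ∂μ) (μ.prod ν) :=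
    hB.integral_prod_right.1.comp_snd
  have hb2 : AEStronglyMeasurable (fun z : X × Y => ∫ y, B (z.1, y) ∂ν) (μ.prod ν) :=
    hB.integral_prod_left.1.comp_fst
  have m1 : AEMeasurable (fun z => ‖V * (B z - ∫ x, B (x, z.2) ∂μ) * U⁻¹‖ₑ) (μ.prod ν) :=
    (((hB.1.sub hb1).const_mul V).mul_const U⁻¹).enorm
  have m2 : AEMeasurable (fun z => ‖V * (B z - ∫ y, B (z.1, y) ∂ν) * U⁻¹‖ₑ) (μ.prod ν) :=
    (((hB.1.sub hb2).const_mul V).mul_const U⁻¹).enorm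
  calc oscTilde (μ.prod ν) V U B
      ≤ ∫⁻ z, ‖V * (B z - ∫ x, B (x, z.2) ∂μ) * U⁻¹‖ₑ +
          ‖V * (∫ x, B (x, z.2) ∂μ - ∫ w, B w ∂(μ.prod ν)) * U⁻¹‖ₑ ∂(μ.prod ν) := by
        refine lintegral_mono fun z => ?_
        refine le_trans (le_of_eq ?_) (enorm_add_le _ _)
        rw [← Matrix.add_mul, ← Matrix.mul_add, sub_add_sub_cancel]
    _ = _ + ∫⁻ z, ‖V * (∫ x, B (x, z.2) ∂μ - ∫ w, B w ∂(μ.prod ν)) * U⁻¹‖ₑ ∂(μ.prod ν) :=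
        lintegral_add_left' m1 _
    _ ≤ _ := by
        refine add_le_add le_rfl ?_
        have m3 : AEMeasurable (fun z : X × Y =>
            ‖V * (∫ x, B (x, z.2) ∂μ - ∫ w, B w ∂(μ.prod ν)) * U⁻¹‖ₑ) (μ.prod ν) :=
          (((hb1.sub aestronglyMeasurable_const).const_mul V).mul_const U⁻¹).enorm
        rw [lintegral_prod_symm _ m3, lintegral_prod_symm _ m2]
        refine lintegral_mono_ae ?_
        filter_upwards [hB.prod_left_ae] with y hy
        simp only [lintegral_const, measure_univ, mul_one]
        have e : ∫ x, B (x, y) ∂μ - ∫ w, B w ∂(μ.prod ν) =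
            ∫ x, (B (x, y) - ∫ y', B (x, y') ∂ν) ∂μ := by
          rw [integral_sub hy hB.integral_prod_left, integral_prod _ hB]
        rw [e]
        exact enorm_mul_integral_mul_le (hy.sub hB.integral_prod_left) _ _

theorem oscTilde_prod_le {v vi u ui B : X × Y → Mat d} {V V' U U' : Mat d} {K s : ℝ≥0}
    (hV : IsRedPair (μ.prod ν) p q v vi V V' K) (hU : IsRedPair (μ.prod ν) p q u ui U U' K)
    (hB : Integrable B (μ.prod ν)) {A₁ : Y → Mat d} {A₂ : X → Mat d}
    (hA₁ : ∀ᵐ y ∂ν, (A₁ y).PosDef ∧ IsMatRed μ p (fun x => u (x, y)) (A₁ y) K ∧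
      osc μ p (fun x => v (x, y)) (A₁ y) (fun x => B (x, y)) ≤ s)
    (hA₂ : ∀ᵐ x ∂μ, (A₂ x).PosDef ∧ IsMatRed ν p (fun y => u (x, y)) (A₂ x) K ∧
      osc ν p (fun y => v (x, y)) (A₂ x) (fun y => B (x, y)) ≤ s) :
    oscTilde (μ.prod ν) V U B ≤ (2 * K ^ 4 * s : ℝ≥0) := by
  have hs : MeasurePreserving Prod.swap (ν.prod μ) (μ.prod ν) := measurePreserving_swap_prod
  have hs' : MeasurableEmbedding (Prod.swap : Y × X → X × Y) :=
    MeasurableEquiv.prodComm.measurableEmbedding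
  have h2 := lintegral_sub_slice_le (hV.comp_measurePreserving hs hs')
    (hU.comp_measurePreserving hs hs') hB.swap hA₂
  have h3 : ∫⁻ z, ‖V * (B z - ∫ y, B (z.1, y) ∂ν) * U⁻¹‖ₑ ∂(μ.prod ν) ≤ (K ^ 4 * s : ℝ≥0) := by
    rw [← hs.lintegral_comp_emb hs']
    exact h2
  refine (oscTilde_prod_le_add hB V U).trans
    ((add_le_add (lintegral_sub_slice_le hV hU hB hA₁) h3).trans (le_of_eq ?_))
  push_cast
  ring

end Slices

theorem avgMeasure_prod {n m : ℕ} (P : Set (Fin n → ℝ)) (Q : Set (Fin m → ℝ))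
    (hP : volume P ≠ ∞) (hQ : volume Q ≠ ∞) :
    avgMeasure (P ×ˢ Q) = (avgMeasure P).prod (avgMeasure Q) := by
  rw [avgMeasure, avgMeasure, avgMeasure, ProbabilityTheory.cond, ProbabilityTheory.cond,
    ProbabilityTheory.cond, volume_prod_set, Measure.prod_smul_left, Measure.prod_smul_right,
    Measure.prod_restrict, smul_smul, ENNReal.mul_inv (Or.inr hQ) (Or.inl hP),
    ← Measure.volume_eq_prod]

/-! ### From rectangles to slices -/

section OneParameter

variable {n d : ℕ} {p : ℝ}

theorem lpNorm_avgMeasure {X : Type*} [MeasureSpace X] {P : Set X} (hP : MeasurableSet P)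
    (hp : 0 < p) (F : X → ℝ≥0∞) :
    lpNorm p (avgMeasure P) F = (volume P)⁻¹ ^ (1 / p) * lpNorm p volume (P.indicator F) := by
  rw [lpNorm, lpNorm, avgMeasure, ProbabilityTheory.cond, lintegral_smul_measure, smul_eq_mul,
    ENNReal.mul_rpow_of_nonneg _ _ (by positivity), ← lintegral_indicator hP]
  congr 3
  ext x
  by_cases hx : x ∈ P <;> simp [hx, hp]

/-- Both sides are homogeneous in the normalization of the measure. Writing the inequality with
indicators over a fixed measure allows the cube to vary in a limit. -/
theorem lpNorm_avgMeasure_le_iff {X : Type*} [MeasureSpace X] {P : Set X} (hP : MeasurableSet P)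
    (hP0 : volume P ≠ 0) (hPt : volume P ≠ ∞) (hp : 0 < p) {F G H : X → ℝ≥0∞} {L c : ℝ≥0∞} :
    lpNorm p (avgMeasure P) F ≤ L * lpNorm p (avgMeasure P) G + lpNorm p (avgMeasure P) H * c ↔
      lpNorm p volume (P.indicator F) ≤
        L * lpNorm p volume (P.indicator G) + lpNorm p volume (P.indicator H) * c := by
  have h0 : (volume P)⁻¹ ^ (1 / p) ≠ 0 := by
    simp [ENNReal.rpow_eq_zero_iff, hP0, hPt]
  have ht : (volume P)⁻¹ ^ (1 / p) ≠ ∞ :=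
    ENNReal.rpow_ne_top_of_nonneg (by positivity) (ENNReal.inv_ne_top.2 hP0)
  simp only [lpNorm_avgMeasure hP hp]
  rw [mul_left_comm, mul_assoc, ← mul_add, ENNReal.mul_le_mul_iff_right h0 ht]

open Filter Topology

/-- Only points on the finitely many hyperplanes bounding the limit cube can fail, and these are
null. -/
theorem ae_eventually_mem_cube_iff {a : ℕ → Fin n → ℝ} {a' : Fin n → ℝ} {l : ℕ → ℝ} {l' : ℝ}
    (ha : Tendsto a atTop (𝓝 a')) (hl : Tendsto l atTop (𝓝 l')) :
    ∀ᵐ x : Fin n → ℝ, ∀ᶠ k in atTop, (x ∈ cube (a k) (l k) ↔ x ∈ cube a' l') := by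
  have h1 : ∀ᵐ x : Fin n → ℝ, ∀ i, x i ≠ a' i ∧ x i ≠ a' i + l' := by
    rw [ae_all_iff]
    intro i
    exact (Measure.ae_eval_ne (μ := fun _ : Fin n => (volume : Measure ℝ)) i (a' i)).and
      (Measure.ae_eval_ne (μ := fun _ : Fin n => (volume : Measure ℝ)) i (a' i + l'))
  filter_upwards [h1] with x hx
  have h2 : ∀ i, ∀ᶠ k in atTop, (a k i ≤ x i ∧ x i < a k i + l k ↔
      a' i ≤ x i ∧ x i < a' i + l') := by
    intro i
    have hai : Tendsto (fun k => a k i) atTop (𝓝 (a' i)) := (tendsto_pi_nhds.1 ha) i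
    have hal : Tendsto (fun k => a k i + l k) atTop (𝓝 (a' i + l')) := hai.add hl
    have e1 : ∀ᶠ k in atTop, (a k i ≤ x i ↔ a' i ≤ x i) := by
      rcases lt_or_gt_of_ne (hx i).1 with h | h
      · filter_upwards [hai.eventually_const_lt h] with k hk
        exact ⟨fun h' => absurd h' (not_le.2 hk), fun h' => absurd h' (not_le.2 h)⟩
      · filter_upwards [hai.eventually_lt_const h] with k hk
        exact ⟨fun _ => h.le, fun _ => hk.le⟩
    have e2 : ∀ᶠ k in atTop, (x i < a k i + l k ↔ x i < a' i + l') := by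
      rcases lt_or_gt_of_ne (hx i).2 with h | h
      · filter_upwards [hal.eventually_const_lt h] with k hk
        exact ⟨fun _ => h, fun _ => hk⟩
      · filter_upwards [hal.eventually_lt_const h] with k hk
        exact ⟨fun h' => absurd h' (not_lt.2 hk.le), fun h' => absurd h' (not_lt.2 h.le)⟩
    filter_upwards [e1, e2] with k hk1 hk2
    rw [hk1, hk2]
  filter_upwards [eventually_all.2 h2] with k hk
  rw [mem_cube, mem_cube]
  exact forall_congr' hk

theorem cube_subset_closedBall {a : Fin n → ℝ} {l s t : ℝ} (ha : ‖a‖ ≤ s) (hl : l ≤ t)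
    (ht : 0 ≤ t) : cube a l ⊆ Metric.closedBall 0 (s + t) := by
  intro x hx
  rw [mem_closedBall_zero_iff, pi_norm_le_iff_of_nonneg (by linarith [norm_nonneg a])]
  intro i
  have h1 := mem_cube.1 hx i
  have h2 := abs_le.1 ((norm_le_pi_norm a i).trans ha)
  rw [Real.norm_eq_abs, abs_le]
  constructor <;> linarith

theorem setAverage_cube (a : Fin n → ℝ) {l : ℝ} (hl : 0 < l) (B : (Fin n → ℝ) → Mat d) :
    ∫ x, B x ∂(avgMeasure (cube a l)) = ((l ^ n)⁻¹ : ℝ) • ∫ x, (cube a l).indicator B x := by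
  rw [avgMeasure, ProbabilityTheory.cond, integral_smul_measure,
    integral_indicator (measurableSet_cube a l), volume_cube, ENNReal.toReal_inv,
    ENNReal.toReal_pow, ENNReal.toReal_ofReal hl.le]

/-- Approximate the corner, the side, `M` and the matrix `⟨B⟩ M` from the dense sets. The averages
of `B` and the norms of `u M` converge by dominated convergence, the left side is lower
semicontinuous by Fatou, and the error term disappears because the constants converge to `⟨B⟩ M`. -/
theorem lpNorm_cube_le_of_dense (hp : 0 < p) {w u B : (Fin n → ℝ) → Mat d} {L : ℝ≥0}
    (hw : AEStronglyMeasurable w volume) (hu : AEStronglyMeasurable u volume)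
    (hB : LocallyIntegrable B volume)
    (hwf : ∀ N : ℕ, ∫⁻ x in Metric.closedBall 0 N, ‖w x‖ₑ ^ p ≠ ∞)
    (huf : ∀ N : ℕ, ∫⁻ x in Metric.closedBall 0 N, ‖u x‖ₑ ^ p ≠ ∞)
    {Da : Set (Fin n → ℝ)} {D : Set (Mat d)} (hDa : Dense Da) (hD : Dense D)
    (h : ∀ a ∈ Da, ∀ l : ℚ, 0 < l → ∀ M ∈ D, ∀ c ∈ D,
      lpNorm p (avgMeasure (cube a l)) (fun x => ‖w x * (B x * M - c)‖ₑ) ≤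
        L * lpNorm p (avgMeasure (cube a l)) (fun x => ‖u x * M‖ₑ) +
          lpNorm p (avgMeasure (cube a l)) (fun x => ‖w x‖ₑ) *
            ‖(∫ x, B x ∂(avgMeasure (cube a l))) * M - c‖ₑ)
    (a : Fin n → ℝ) {l : ℝ} (hl : 0 < l) (M : Mat d) :
    lpNorm p (avgMeasure (cube a l))
        (fun x => ‖w x * (B x - ∫ x', B x' ∂(avgMeasure (cube a l))) * M‖ₑ) ≤
      L * lpNorm p (avgMeasure (cube a l)) (fun x => ‖u x * M‖ₑ) := by
  set β := ∫ x', B x' ∂(avgMeasure (cube a l)) with hβ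
  obtain ⟨a', ha'D, ha'⟩ := mem_closure_iff_seq_limit.1 (hDa a)
  obtain ⟨M', hM'D, hM'⟩ := mem_closure_iff_seq_limit.1 (hD M)
  -- The constants are aimed at `β * M`, the value that makes the error term vanish in the limit.
  obtain ⟨c', hc'D, hc'⟩ := mem_closure_iff_seq_limit.1 (hD (β * M))
  obtain ⟨l', hl'0, hl'⟩ : ∃ l' : ℕ → ℚ, (∀ k, 0 < l' k) ∧
      Tendsto (fun k => (l' k : ℝ)) atTop (𝓝 l) := by
    have : ∀ k : ℕ, ∃ q : ℚ, l < q ∧ (q : ℝ) < l + 1 / (k + 1) := fun k =>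
      exists_rat_btwn (by linarith [Nat.one_div_pos_of_nat (α := ℝ) (n := k)])
    choose l' h1 h2 using this
    refine ⟨l', fun k => by exact_mod_cast hl.trans (h1 k), ?_⟩
    refine tendsto_of_tendsto_of_tendsto_of_le_of_le tendsto_const_nhds ?_
      (fun k => (h1 k).le) (fun k => (h2 k).le)
    simpa using tendsto_const_nhds.add (tendsto_one_div_add_atTop_nhds_zero_nat (𝕜 := ℝ))
  obtain ⟨N, hNk, hN⟩ : ∃ N : ℕ, (∀ k, cube (a' k) (l' k) ⊆ Metric.closedBall 0 (N : ℝ)) ∧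
      cube a l ⊆ Metric.closedBall 0 (N : ℝ) := by
    obtain ⟨s, hs⟩ := (Metric.isBounded_range_of_tendsto _ ha').exists_norm_le
    obtain ⟨t, ht⟩ := (Metric.isBounded_range_of_tendsto _ hl').exists_norm_le
    obtain ⟨N, hN⟩ := exists_nat_ge (s + ‖a‖ + (t + l))
    have hs' : ∀ k, ‖a' k‖ ≤ s := fun k => hs _ (mem_range_self k)
    have ht' : ∀ k, (l' k : ℝ) ≤ t := fun k => (le_abs_self _).trans (ht _ (mem_range_self k))
    have hs0 : 0 ≤ s := (norm_nonneg _).trans (hs' 0)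
    have ht0 : 0 ≤ t := (norm_nonneg _).trans (ht _ (mem_range_self 0))
    have hsub : Metric.closedBall (0 : Fin n → ℝ) (s + ‖a‖ + (t + l)) ⊆
        Metric.closedBall 0 (N : ℝ) := Metric.closedBall_subset_closedBall hN
    refine ⟨N, fun k => (cube_subset_closedBall ?_ ?_ (by linarith)).trans hsub,
      (cube_subset_closedBall ?_ ?_ (by linarith)).trans hsub⟩
    · linarith [hs' k, norm_nonneg a]
    · linarith [ht' k]
    · linarith
    · linarith
  have hmem := ae_eventually_mem_cube_iff ha' hl'
  have hind : ∀ {γ : Type} [Zero γ] [TopologicalSpace γ] {f : ℕ → (Fin n → ℝ) → γ}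
      {g : (Fin n → ℝ) → γ}, (∀ x, Tendsto (fun k => f k x) atTop (𝓝 (g x))) →
      ∀ᵐ x, Tendsto (fun k => (cube (a' k) (l' k)).indicator (f k) x) atTop
        (𝓝 ((cube a l).indicator g x)) := by
    intro γ _ _ f g hfg
    filter_upwards [hmem] with x hx
    by_cases hxa : x ∈ cube a l
    · rw [indicator_of_mem hxa]
      refine (hfg x).congr' ?_
      filter_upwards [hx] with k hk
      rw [indicator_of_mem (hk.2 hxa)]
    · rw [indicator_of_notMem hxa]
      refine tendsto_const_nhds.congr' ?_
      filter_upwards [hx] with k hk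
      rw [indicator_of_notMem fun h => hxa (hk.1 h)]
  have hβk : Tendsto (fun k => ∫ x, B x ∂(avgMeasure (cube (a' k) (l' k)))) atTop (𝓝 β) := by
    have hBi : IntegrableOn B (Metric.closedBall 0 (N : ℝ)) volume :=
      hB.integrableOn_isCompact (isCompact_closedBall _ _)
    have h1 : Tendsto (fun k => ∫ x, (cube (a' k) (l' k)).indicator B x) atTop
        (𝓝 (∫ x, (cube a l).indicator B x)) := by
      refine tendsto_integral_of_dominated_convergence
        ((Metric.closedBall 0 (N : ℝ)).indicator fun x => ‖B x‖)
        (fun k => hB.aestronglyMeasurable.indicator (measurableSet_cube _ _))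
        ((integrable_indicator_iff measurableSet_closedBall).2 hBi.norm)
        (fun k => ae_of_all _ fun x => ?_) (hind (γ := Mat d) fun x => tendsto_const_nhds)
      rw [norm_indicator_eq_indicator_norm]
      exact indicator_le_indicator_of_subset (hNk k) (fun _ => norm_nonneg _) x
    have h2 : Tendsto (fun k => (((l' k : ℝ) ^ n)⁻¹ : ℝ)) atTop (𝓝 ((l ^ n)⁻¹ : ℝ)) :=
      (hl'.pow n).inv₀ (pow_pos hl n).ne'
    rw [hβ, setAverage_cube a hl]
    refine (h2.smul h1).congr fun k => ?_
    rw [setAverage_cube (a' k) (by exact_mod_cast hl'0 k)]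
  have hGk : Tendsto (fun k => lpNorm p volume
      ((cube (a' k) (l' k)).indicator fun x => ‖u x * M' k‖ₑ)) atTop
      (𝓝 (lpNorm p volume ((cube a l).indicator fun x => ‖u x * M‖ₑ))) := by
    obtain ⟨t, ht⟩ := (Metric.isBounded_range_of_tendsto _ hM').exists_norm_le
    have ht' : ∀ k, ‖M' k‖ₑ ≤ ENNReal.ofReal t := fun k => by
      rw [← ofReal_norm]
      exact ENNReal.ofReal_le_ofReal (ht _ (mem_range_self k))
    refine Tendsto.ennrpow_const _ ?_
    refine tendsto_lintegral_of_dominated_convergence'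
      ((Metric.closedBall 0 (N : ℝ)).indicator fun x => ‖u x‖ₑ ^ p * ENNReal.ofReal t ^ p)
      (fun k => (((hu.mul_const _).enorm.indicator (measurableSet_cube _ _)).pow_const p))
      (fun k => ae_of_all _ fun x => ?_) ?_ ?_
    · beta_reduce
      by_cases hx : x ∈ cube (a' k) (l' k)
      · rw [indicator_of_mem hx, indicator_of_mem (hNk k hx), ← ENNReal.mul_rpow_of_nonneg _ _ hp.le]
        exact ENNReal.rpow_le_rpow ((enorm_mat_mul_le _ _).trans (mul_le_mul_right (ht' k) _)) hp.le
      · rw [indicator_of_notMem hx, ENNReal.zero_rpow_of_pos hp]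
        exact zero_le
    · rw [lintegral_indicator measurableSet_closedBall, lintegral_mul_const' _ _ (by finiteness)]
      exact ENNReal.mul_ne_top (huf N) (by finiteness)
    · filter_upwards [hind (γ := ℝ≥0∞) (f := fun k x => ‖u x * M' k‖ₑ) (g := fun x => ‖u x * M‖ₑ)
        fun x => (tendsto_const_nhds.mul hM').enorm] with x hx
      exact hx.ennrpow_const p
  -- A single finite bound for the norms of `w` over all the approximating cubes, which lie in one
  -- common ball.
  set Wn := lpNorm p volume ((Metric.closedBall 0 (N : ℝ)).indicator fun x => ‖w x‖ₑ) with hWn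
  have hWfin : Wn ≠ ∞ := by
    refine ENNReal.rpow_ne_top_of_nonneg (by positivity) (ne_of_eq_of_ne ?_ (hwf N))
    rw [← lintegral_indicator measurableSet_closedBall]
    refine lintegral_congr fun x => ?_
    by_cases hx : x ∈ Metric.closedBall (0 : Fin n → ℝ) (N : ℝ) <;> simp [hx, hp]
  have hlim : Tendsto (fun k => L * lpNorm p volume
        ((cube (a' k) (l' k)).indicator fun x => ‖u x * M' k‖ₑ) +
        Wn * ‖(∫ x, B x ∂(avgMeasure (cube (a' k) (l' k)))) * M' k - c' k‖ₑ) atTop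
      (𝓝 (L * lpNorm p volume ((cube a l).indicator fun x => ‖u x * M‖ₑ) + Wn * 0)) := by
    refine (ENNReal.Tendsto.const_mul hGk (Or.inr ENNReal.coe_ne_top)).add
      (ENNReal.Tendsto.const_mul ?_ (Or.inr hWfin))
    have h3 := ((hβk.mul hM').sub hc').enorm
    rwa [sub_self, enorm_zero] at h3
  have hfinal : lpNorm p volume ((cube a l).indicator fun x => ‖w x * (B x - β) * M‖ₑ) ≤
      L * lpNorm p volume ((cube a l).indicator fun x => ‖u x * M‖ₑ) + Wn * 0 := by
    refine lpNorm_le_of_tendsto hp (F := fun k => (cube (a' k) (l' k)).indicator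
      fun x => ‖w x * (B x * M' k - c' k)‖ₑ) (fun k => ?_) (hind fun x => ?_) (fun k => ?_) hlim
    · exact ((hw.mul ((hB.aestronglyMeasurable.mul_const _).sub
        aestronglyMeasurable_const)).enorm).indicator (measurableSet_cube _ _)
    · rw [Matrix.mul_assoc, Matrix.sub_mul]
      exact (tendsto_const_nhds.mul ((tendsto_const_nhds.mul hM').sub hc')).enorm
    · have hl'k : (0 : ℝ) < l' k := by exact_mod_cast hl'0 k
      refine ((lpNorm_avgMeasure_le_iff (measurableSet_cube _ _) (volume_cube_ne_zero _ hl'k)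
        (volume_cube_ne_top _ _) hp).1
        (h _ (ha'D k) (l' k) (hl'0 k) _ (hM'D k) _ (hc'D k))).trans ?_
      gcongr
      exact lpNorm_mono hp.le fun x =>
        indicator_le_indicator_of_subset (hNk k) (fun _ => zero_le) x
  have := (lpNorm_avgMeasure_le_iff (measurableSet_cube a l) (volume_cube_ne_zero a hl)
    (volume_cube_ne_top a l) hp (L := L)
    (G := fun x => ‖u x * M‖ₑ) (H := 0) (c := 0)).2 (hfinal.trans (by simp))
  simpa using this

end OneParameter

/-! ### Lebesgue differentiation in the slice variable -/

open Filter Topology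

section Differentiation

variable {m : ℕ}

theorem closedBall_eq_Icc (y : Fin m → ℝ) {r : ℝ} (hr : 0 ≤ r) :
    Metric.closedBall y r = Icc (fun i => y i - r) (fun i => y i - r + 2 * r) := by
  ext x
  rw [Metric.mem_closedBall, dist_pi_le_iff hr, mem_Icc, Pi.le_def, Pi.le_def, ← forall_and]
  refine forall_congr' fun i => ?_
  rw [Real.dist_eq, abs_le]
  constructor <;> rintro ⟨h1, h2⟩ <;> constructor <;> linarith

theorem cube_ae_eq_closedBall (y : Fin m → ℝ) {r : ℝ} (hr : 0 ≤ r) :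
    cube (fun i => y i - r) (2 * r) =ᵐ[volume] Metric.closedBall y r := by
  rw [closedBall_eq_Icc y hr]
  exact cube_ae_eq_Icc _ _

theorem avgMeasure_closedBall (y : Fin m → ℝ) {r : ℝ} (hr : 0 ≤ r) :
    avgMeasure (Metric.closedBall y r) = avgMeasure (cube (fun i => y i - r) (2 * r)) := by
  rw [avgMeasure, avgMeasure, ProbabilityTheory.cond, ProbabilityTheory.cond,
    measure_congr (cube_ae_eq_closedBall y hr),
    Measure.restrict_congr_set (cube_ae_eq_closedBall y hr)]

theorem tendsto_one_div_nhdsGT_zero :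
    Tendsto (fun k : ℕ => 1 / ((k : ℝ) + 1)) atTop (𝓝[>] 0) :=
  tendsto_nhdsWithin_iff.2 ⟨tendsto_one_div_add_atTop_nhds_zero_nat,
    Eventually.of_forall fun _ => mem_Ioi.2 Nat.one_div_pos_of_nat⟩

theorem ae_tendsto_lintegral_closedBall {f : (Fin m → ℝ) → ℝ≥0∞} (hf : AEMeasurable f volume)
    (hfin : ∀ r : ℝ, 0 < r → ∫⁻ y in Metric.closedBall 0 r, f y ≠ ∞) :
    ∀ᵐ y, Tendsto (fun k : ℕ => ∫⁻ z, f z ∂(avgMeasure (Metric.closedBall y (1 / ((k : ℝ) + 1)))))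
      atTop (𝓝 (f y)) := by
  -- The differentiation theorem asks for a finite total integral, so `f` is first truncated to
  -- balls; the shrinking balls around `y` lie in one of them.
  have h1 : ∀ N : ℕ, ∀ᵐ y, Tendsto (fun k : ℕ =>
      (∫⁻ z in Metric.closedBall y (1 / ((k : ℝ) + 1)),
        (Metric.closedBall 0 ((N : ℝ) + 1)).indicator f z) /
          volume (Metric.closedBall y (1 / ((k : ℝ) + 1)))) atTop
      (𝓝 ((Metric.closedBall 0 ((N : ℝ) + 1)).indicator f y)) := fun N => by
    have h2 := (Besicovitch.vitaliFamily (volume : Measure (Fin m → ℝ))).ae_tendsto_lintegral_div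
      (hf.indicator (measurableSet_closedBall (x := 0) (ε := (N : ℝ) + 1)))
      (by
        rw [lintegral_indicator measurableSet_closedBall]
        exact hfin _ (by positivity))
    filter_upwards [h2] with y hy
    exact (hy.comp (Besicovitch.tendsto_filterAt volume y)).comp tendsto_one_div_nhdsGT_zero
  filter_upwards [ae_all_iff.2 h1] with y hy
  obtain ⟨N, hN⟩ := exists_nat_ge (‖y‖ + 1)
  have hsub : ∀ k : ℕ, Metric.closedBall y (1 / ((k : ℝ) + 1)) ⊆
      Metric.closedBall 0 ((N : ℝ) + 1) := fun k => by
    refine Metric.closedBall_subset_closedBall' ?_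
    have : 1 / ((k : ℝ) + 1) ≤ 1 := by
      rw [div_le_one (by positivity)]
      linarith [(Nat.cast_nonneg k : (0 : ℝ) ≤ k)]
    rw [dist_zero_right]
    linarith
  have hyN := hy N
  rw [indicator_of_mem (hsub 0 (Metric.mem_closedBall_self (by positivity)))] at hyN
  refine hyN.congr fun k => ?_
  rw [setLIntegral_congr_fun measurableSet_closedBall
    (fun z hz => indicator_of_mem (hsub k hz) f), avgMeasure, ProbabilityTheory.cond,
    lintegral_smul_measure, smul_eq_mul, mul_comm, ENNReal.div_eq_inv_mul, mul_comm]

theorem ae_ne_top_of_closedBall {f : (Fin m → ℝ) → ℝ≥0∞} (hf : AEMeasurable f volume)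
    (hfin : ∀ r : ℝ, 0 < r → ∫⁻ y in Metric.closedBall 0 r, f y ≠ ∞) : ∀ᵐ y, f y ≠ ∞ := by
  have h1 : ∀ N : ℕ, ∀ᵐ y, y ∈ Metric.closedBall (0 : Fin m → ℝ) ((N : ℝ) + 1) → f y < ∞ :=
    fun N => (ae_restrict_iff' measurableSet_closedBall).1
      (ae_lt_top' hf.restrict (hfin _ (by positivity)))
  filter_upwards [ae_all_iff.2 h1] with y hy
  obtain ⟨N, hN⟩ := exists_nat_ge ‖y‖
  exact (hy N (by rw [mem_closedBall_zero_iff]; linarith)).ne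

end Differentiation

section RectToSlice

variable {n m d : ℕ} {p : ℝ}

theorem avgMeasure_prod_absolutelyContinuous (P : Set (Fin n → ℝ)) (Q : Set (Fin m → ℝ)) :
    (avgMeasure P).prod (avgMeasure Q) ≪ volume := by
  rw [Measure.volume_eq_prod]
  exact ProbabilityTheory.cond_absolutelyContinuous.prod ProbabilityTheory.cond_absolutelyContinuous

theorem isProbabilityMeasure_avgMeasure_cube (a : Fin n → ℝ) {l : ℝ} (hl : 0 < l) :
    IsProbabilityMeasure (avgMeasure (cube a l)) :=
  ProbabilityTheory.cond_isProbabilityMeasure_of_finite (volume_cube_ne_zero a hl)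
    (volume_cube_ne_top a l)

theorem aemeasurable_lintegral_slice {F : (Fin n → ℝ) × (Fin m → ℝ) → ℝ≥0∞}
    (hF : AEMeasurable F volume) (P : Set (Fin n → ℝ)) :
    AEMeasurable (fun y => ∫⁻ x, F (x, y) ∂(avgMeasure P)) volume := by
  have hac : (avgMeasure P).prod (volume : Measure (Fin m → ℝ)) ≪ volume := by
    rw [Measure.volume_eq_prod]
    exact ProbabilityTheory.cond_absolutelyContinuous.prod Measure.AbsolutelyContinuous.rfl
  exact (hF.mono_ac hac).prod_swap.lintegral_prod_right'

theorem setLIntegral_lintegral_slice_ne_top {F : (Fin n → ℝ) × (Fin m → ℝ) → ℝ≥0∞}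
    (hF : AEMeasurable F volume)
    (hFc : ∀ K, IsCompact K → ∫⁻ z in K, F z ≠ ∞) (a : Fin n → ℝ) {l : ℝ} (hl : 0 < l) (r : ℝ) :
    ∫⁻ y in Metric.closedBall 0 r, ∫⁻ x, F (x, y) ∂(avgMeasure (cube a l)) ≠ ∞ := by
  have e : ∫⁻ y in Metric.closedBall 0 r, ∫⁻ x, F (x, y) ∂(avgMeasure (cube a l)) =
      (volume (cube a l))⁻¹ * ∫⁻ z in cube a l ×ˢ Metric.closedBall 0 r, F z := by
    rw [Measure.volume_eq_prod, ← Measure.prod_restrict, lintegral_prod_symm _ (by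
      rw [Measure.prod_restrict, ← Measure.volume_eq_prod]
      exact hF.restrict), ← lintegral_const_mul' _ _
      (ENNReal.inv_ne_top.2 (volume_cube_ne_zero a hl))]
    simp only [avgMeasure, ProbabilityTheory.cond, lintegral_smul_measure, smul_eq_mul]
  rw [e]
  refine ENNReal.mul_ne_top (ENNReal.inv_ne_top.2 (volume_cube_ne_zero a hl))
    (ne_top_of_le_ne_top (hFc (Icc a (fun i => a i + l) ×ˢ Metric.closedBall 0 r)
      (isCompact_Icc.prod (isCompact_closedBall _ _))) ?_)
  exact lintegral_mono_set (prod_mono (cube_subset_Icc a l) Subset.rfl)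

theorem lintegral_avgMeasure_ne_top {X : Type*} [MeasureSpace X] {E : Set X} {f : X → ℝ≥0∞}
    (hE : volume E ≠ 0) (hf : ∫⁻ x in E, f x ≠ ∞) : ∫⁻ x, f x ∂(avgMeasure E) ≠ ∞ := by
  rw [avgMeasure, ProbabilityTheory.cond, lintegral_smul_measure, smul_eq_mul]
  exact ENNReal.mul_ne_top (ENNReal.inv_ne_top.2 hE) hf

theorem setLIntegral_ne_top_of_avgMeasure {X : Type*} [MeasureSpace X] {E : Set X} {f : X → ℝ≥0∞}
    (hE : volume E ≠ ∞) (hf : ∫⁻ x, f x ∂(avgMeasure E) ≠ ∞) : ∫⁻ x in E, f x ≠ ∞ := by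
  rw [avgMeasure, ProbabilityTheory.cond, lintegral_smul_measure, smul_eq_mul] at hf
  intro h
  rw [h, ENNReal.mul_top (ENNReal.inv_ne_zero.2 hE)] at hf
  exact hf rfl

variable {v u B : (Fin n → ℝ) × (Fin m → ℝ) → Mat d} {L : ℝ≥0}

theorem locallyIntegrable_integral_slice (hB : LocallyIntegrable B volume) (a : Fin n → ℝ) {l : ℝ}
    (hl : 0 < l) :
    LocallyIntegrable (fun y => ∫ x, B (x, y) ∂(avgMeasure (cube a l))) volume := by
  have := isProbabilityMeasure_avgMeasure_cube a hl
  rw [locallyIntegrable_iff]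
  intro K hK
  have h1 : IntegrableOn B (cube a l ×ˢ K) volume :=
    (hB.integrableOn_isCompact (isCompact_Icc.prod hK)).mono_set
      (prod_mono (cube_subset_Icc a l) Subset.rfl)
  have h2 : Integrable B ((avgMeasure (cube a l)).prod (volume.restrict K)) := by
    rw [avgMeasure, ProbabilityTheory.cond, Measure.prod_smul_left, Measure.prod_restrict,
      ← Measure.volume_eq_prod]
    exact h1.smul_measure (ENNReal.inv_ne_top.2 (volume_cube_ne_zero a hl))
  exact h2.integral_prod_right

/-- The average over the whole rectangle is traded for a fixed matrix `c`, so that the left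
integrand does not change as the second cube shrinks. The price is a term with the difference of
`⟨B⟩ M` and `c`, whose limit is known. -/
theorem lpNorm_prod_sub_const_le {μ : Measure (Fin n → ℝ)} {κ : Measure (Fin m → ℝ)}
    [IsProbabilityMeasure μ] [IsProbabilityMeasure κ] (hp : 1 ≤ p)
    (hv : AEStronglyMeasurable v (μ.prod κ)) (hB : Integrable B (μ.prod κ)) (M c : Mat d)
    (h : lpNorm p (μ.prod κ) (fun z => ‖v z * (B z - ∫ z', B z' ∂(μ.prod κ)) * M‖ₑ) ≤
      L * lpNorm p (μ.prod κ) (fun z => ‖u z * M‖ₑ)) :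
    lpNorm p (μ.prod κ) (fun z => ‖v z * (B z * M - c)‖ₑ) ≤
      L * lpNorm p (μ.prod κ) (fun z => ‖u z * M‖ₑ) +
        lpNorm p (μ.prod κ) (fun z => ‖v z‖ₑ) *
          ‖(∫ y, ∫ x, B (x, y) ∂μ ∂κ) * M - c‖ₑ := by
  have hp0 : 0 < p := zero_lt_one.trans_le hp
  rw [← integral_prod_symm _ hB]
  set β := ∫ z', B z' ∂(μ.prod κ)
  calc _ ≤ lpNorm p (μ.prod κ) (fun z => ‖v z * (B z - β) * M‖ₑ + ‖v z‖ₑ * ‖β * M - c‖ₑ) := by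
        refine lpNorm_mono hp0.le fun z => ?_
        have e : v z * (B z * M - c) = v z * (B z - β) * M + v z * (β * M - c) := by
          rw [Matrix.mul_assoc, Matrix.sub_mul, ← Matrix.mul_add, sub_add_sub_cancel]
        rw [e]
        exact (enorm_add_le _ _).trans (add_le_add le_rfl (enorm_mat_mul_le _ _))
    _ ≤ _ := lpNorm_add_le hp ((hv.mul (hB.1.sub aestronglyMeasurable_const)).mul_const M).enorm
        (hv.enorm.mul_const _)
    _ ≤ _ := by
        rw [lpNorm_mul_const hp0 enorm_ne_top]
        exact add_le_add h le_rfl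

/-- With the cube in the first variable, `M` and `c` fixed, each term is an average over `y` of a
fixed function, and differentiation at almost every `y` gives the inequality on the slice. -/
theorem ae_slice_sub_const_le (hp : 1 ≤ p) (hv : AEStronglyMeasurable v volume)
    (hu : AEStronglyMeasurable u volume) (hB : LocallyIntegrable B volume)
    (hvf : ∀ K, IsCompact K → ∫⁻ z in K, ‖v z‖ₑ ^ p ≠ ∞)
    (huf : ∀ K, IsCompact K → ∫⁻ z in K, ‖u z‖ₑ ^ p ≠ ∞)
    (a : Fin n → ℝ) {l : ℝ} (hl : 0 < l) (M c : Mat d)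
    (h : ∀ (b : Fin m → ℝ) (s : ℝ), 0 < s →
      lpNorm p ((avgMeasure (cube a l)).prod (avgMeasure (cube b s))) (fun z => ‖v z *
        (B z - ∫ z', B z' ∂((avgMeasure (cube a l)).prod (avgMeasure (cube b s)))) * M‖ₑ) ≤
      L * lpNorm p ((avgMeasure (cube a l)).prod (avgMeasure (cube b s))) (fun z => ‖u z * M‖ₑ)) :
    ∀ᵐ y, lpNorm p (avgMeasure (cube a l)) (fun x => ‖v (x, y) * (B (x, y) * M - c)‖ₑ) ≤
      L * lpNorm p (avgMeasure (cube a l)) (fun x => ‖u (x, y) * M‖ₑ) +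
        lpNorm p (avgMeasure (cube a l)) (fun x => ‖v (x, y)‖ₑ) *
          ‖(∫ x, B (x, y) ∂(avgMeasure (cube a l))) * M - c‖ₑ := by
  have hp0 : 0 < p := zero_lt_one.trans_le hp
  have hπ := isProbabilityMeasure_avgMeasure_cube a hl
  set π := avgMeasure (cube a l) with hπdef
  have mg : AEMeasurable (fun z => ‖v z * (B z * M - c)‖ₑ ^ p) volume :=
    ((hv.mul ((hB.aestronglyMeasurable.mul_const M).sub
      aestronglyMeasurable_const)).enorm).pow_const p
  have mh : AEMeasurable (fun z => ‖u z * M‖ₑ ^ p) volume := ((hu.mul_const M).enorm).pow_const p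
  have mw : AEMeasurable (fun z => ‖v z‖ₑ ^ p) volume := hv.enorm.pow_const p
  have hhf : ∀ K, IsCompact K → ∫⁻ z in K, ‖u z * M‖ₑ ^ p ≠ ∞ := fun K hK => by
    refine ne_top_of_le_ne_top (ENNReal.mul_ne_top (huf K hK)
      (by finiteness : ‖M‖ₑ ^ p ≠ ∞)) ?_
    rw [← lintegral_mul_const' _ _ (by finiteness)]
    refine lintegral_mono fun z => ?_
    rw [← ENNReal.mul_rpow_of_nonneg _ _ hp0.le]
    exact ENNReal.rpow_le_rpow (enorm_mat_mul_le _ _) hp0.le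
  have tonelli : ∀ {F : (Fin n → ℝ) × (Fin m → ℝ) → ℝ≥0∞},
      AEMeasurable (fun z => F z ^ p) volume → ∀ Q : Set (Fin m → ℝ),
      lpNorm p (π.prod (avgMeasure Q)) F =
        (∫⁻ y, ∫⁻ x, F (x, y) ^ p ∂π ∂(avgMeasure Q)) ^ (1 / p) := fun {F} hF Q => by
    rw [lpNorm, lintegral_prod_symm _ (hF.mono_ac (avgMeasure_prod_absolutelyContinuous _ _))]
  have key : ∀ (y : Fin m → ℝ) (r : ℝ), 0 < r →
      (∫⁻ y', ∫⁻ x, ‖v (x, y') * (B (x, y') * M - c)‖ₑ ^ p ∂π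
        ∂(avgMeasure (Metric.closedBall y r))) ^ (1 / p) ≤
      L * (∫⁻ y', ∫⁻ x, ‖u (x, y') * M‖ₑ ^ p ∂π
        ∂(avgMeasure (Metric.closedBall y r))) ^ (1 / p) +
      (∫⁻ y', ∫⁻ x, ‖v (x, y')‖ₑ ^ p ∂π ∂(avgMeasure (Metric.closedBall y r))) ^ (1 / p) *
        ‖(∫ y', ∫ x, B (x, y') ∂π ∂(avgMeasure (Metric.closedBall y r))) * M - c‖ₑ := by
    intro y r hr
    rw [← tonelli mg, ← tonelli mh, ← tonelli mw, avgMeasure_closedBall y hr.le]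
    have := isProbabilityMeasure_avgMeasure_cube (fun i => y i - r) (mul_pos two_pos hr)
    have hBi : Integrable B (π.prod (avgMeasure (cube (fun i => y i - r) (2 * r)))) := by
      have := integrable_prob_rect hB ⟨a, fun i => y i - r, l, 2 * r, hl, mul_pos two_pos hr⟩
      rwa [← avgMeasure_prod _ _ (volume_cube_ne_top _ _) (volume_cube_ne_top _ _)]
    exact lpNorm_prod_sub_const_le hp (hv.mono_ac (avgMeasure_prod_absolutelyContinuous _ _)) hBi
      M c (h _ _ (mul_pos two_pos hr))
  have fh := fun r : ℝ => setLIntegral_lintegral_slice_ne_top mh hhf a hl r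
  have fw := fun r : ℝ => setLIntegral_lintegral_slice_ne_top mw hvf a hl r
  -- Local integrability of the left side is not a hypothesis: it is read off from `key` on a ball
  -- about the origin, whose right side is finite.
  have fg : ∀ r : ℝ, 0 < r → ∫⁻ y in Metric.closedBall 0 r,
      ∫⁻ x, ‖v (x, y) * (B (x, y) * M - c)‖ₑ ^ p ∂π ≠ ∞ := fun r hr => by
    have hpos : volume (Metric.closedBall (0 : Fin m → ℝ) r) ≠ 0 :=
      (Metric.measure_closedBall_pos _ _ hr).ne'
    refine setLIntegral_ne_top_of_avgMeasure measure_closedBall_lt_top.ne fun htop => ?_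
    have hk := key 0 r hr
    rw [htop, ENNReal.top_rpow_of_pos (by positivity), top_le_iff] at hk
    refine absurd hk (ENNReal.add_ne_top.2 ⟨ENNReal.mul_ne_top ENNReal.coe_ne_top ?_,
      ENNReal.mul_ne_top ?_ enorm_ne_top⟩)
    · exact ENNReal.rpow_ne_top_of_nonneg (by positivity) (lintegral_avgMeasure_ne_top hpos (fh r))
    · exact ENNReal.rpow_ne_top_of_nonneg (by positivity) (lintegral_avgMeasure_ne_top hpos (fw r))
  filter_upwards [ae_tendsto_lintegral_closedBall (aemeasurable_lintegral_slice mg (cube a l)) fg,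
    ae_tendsto_lintegral_closedBall (aemeasurable_lintegral_slice mh (cube a l)) fun r _ => fh r,
    ae_tendsto_lintegral_closedBall (aemeasurable_lintegral_slice mw (cube a l)) fun r _ => fw r,
    (Besicovitch.vitaliFamily (volume : Measure (Fin m → ℝ))).ae_tendsto_average
      (locallyIntegrable_integral_slice hB a hl),
    ae_ne_top_of_closedBall (aemeasurable_lintegral_slice mw (cube a l)) fun r _ => fw r]
    with y hg hh hw hb hwy
  have hb' : Tendsto (fun k : ℕ => ∫ y', ∫ x, B (x, y') ∂π
      ∂(avgMeasure (Metric.closedBall y (1 / ((k : ℝ) + 1))))) atTop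
      (𝓝 (∫ x, B (x, y) ∂π)) := by
    refine ((hb.comp (Besicovitch.tendsto_filterAt volume y)).comp
      tendsto_one_div_nhdsGT_zero).congr fun k => ?_
    simp only [Function.comp_apply, setAverage_eq_integral, hπdef]
  refine le_of_tendsto_of_tendsto' (hg.ennrpow_const (1 / p)) ?_
    fun k => key y (1 / ((k : ℝ) + 1)) Nat.one_div_pos_of_nat
  refine (ENNReal.Tendsto.const_mul (hh.ennrpow_const (1 / p)) (Or.inr ENNReal.coe_ne_top)).add ?_
  -- The norm of `v` on the slice must be finite here, since the second factor may tend to `0`.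
  refine ENNReal.Tendsto.mul (hw.ennrpow_const (1 / p)) (Or.inr enorm_ne_top)
    ((hb'.mul_const M).sub tendsto_const_nhds).enorm (Or.inr ?_)
  exact ENNReal.rpow_ne_top_of_nonneg (by positivity) hwy

theorem ae_slice_setLIntegral_ne_top {F : (Fin n → ℝ) × (Fin m → ℝ) → ℝ≥0∞}
    (hF : AEMeasurable F volume) (hFc : ∀ K, IsCompact K → ∫⁻ z in K, F z ≠ ∞) :
    ∀ᵐ y, ∀ N : ℕ, ∫⁻ x in Metric.closedBall 0 N, F (x, y) ≠ ∞ := by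
  rw [ae_all_iff]
  intro N
  have hN : (0 : ℝ) < N + 1 := by positivity
  have hae := cube_ae_eq_closedBall (0 : Fin n → ℝ) hN.le
  filter_upwards [ae_ne_top_of_closedBall (aemeasurable_lintegral_slice hF _) fun r _ =>
    setLIntegral_lintegral_slice_ne_top hF hFc _ (mul_pos two_pos hN) r] with y hy
  refine ne_top_of_le_ne_top (setLIntegral_ne_top_of_avgMeasure (volume_cube_ne_top _ _) hy) ?_
  rw [setLIntegral_congr hae]
  exact lintegral_mono_set (Metric.closedBall_subset_closedBall (by linarith))

theorem ae_locallyIntegrable_slice (hB : LocallyIntegrable B volume) :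
    ∀ᵐ y, LocallyIntegrable (fun x => B (x, y)) volume := by
  have h1 := ae_slice_setLIntegral_ne_top hB.aestronglyMeasurable.enorm
    fun K hK => (hB.integrableOn_isCompact hK).2.ne
  have h2 : ∀ᵐ y, AEStronglyMeasurable (fun x => B (x, y)) volume :=
    AEStronglyMeasurable.prodMk_left (AEStronglyMeasurable.prod_swap hB.aestronglyMeasurable)
  filter_upwards [h1, h2] with y hy1 hy2
  rw [locallyIntegrable_iff]
  intro K hK
  obtain ⟨r, hr⟩ := hK.isBounded.subset_closedBall 0
  obtain ⟨N, hN⟩ := exists_nat_ge r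
  have h3 : IntegrableOn (fun x => B (x, y)) (Metric.closedBall 0 (N : ℝ)) volume :=
    ⟨hy2.restrict, (hy1 N).lt_top⟩
  exact h3.mono_set (hr.trans (Metric.closedBall_subset_closedBall hN))

theorem ae_slice_lpNorm_le (hp : 1 ≤ p) (hv : AEStronglyMeasurable v volume)
    (hu : AEStronglyMeasurable u volume) (hB : LocallyIntegrable B volume)
    (hvf : ∀ K, IsCompact K → ∫⁻ z in K, ‖v z‖ₑ ^ p ≠ ∞)
    (huf : ∀ K, IsCompact K → ∫⁻ z in K, ‖u z‖ₑ ^ p ≠ ∞)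
    (h : ∀ (a : Fin n → ℝ) (l : ℝ), 0 < l → ∀ (b : Fin m → ℝ) (s : ℝ), 0 < s → ∀ M : Mat d,
      lpNorm p ((avgMeasure (cube a l)).prod (avgMeasure (cube b s))) (fun z => ‖v z *
        (B z - ∫ z', B z' ∂((avgMeasure (cube a l)).prod (avgMeasure (cube b s)))) * M‖ₑ) ≤
      L * lpNorm p ((avgMeasure (cube a l)).prod (avgMeasure (cube b s))) (fun z => ‖u z * M‖ₑ)) :
    ∀ᵐ y, ∀ (a : Fin n → ℝ) (l : ℝ), 0 < l → ∀ M : Mat d,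
      lpNorm p (avgMeasure (cube a l)) (fun x => ‖v (x, y) *
        (B (x, y) - ∫ x', B (x', y) ∂(avgMeasure (cube a l))) * M‖ₑ) ≤
      L * lpNorm p (avgMeasure (cube a l)) (fun x => ‖u (x, y) * M‖ₑ) := by
  have hp0 : 0 < p := zero_lt_one.trans_le hp
  obtain ⟨Da, hDac, hDa⟩ := TopologicalSpace.exists_countable_dense (Fin n → ℝ)
  obtain ⟨D, hDc, hD⟩ := TopologicalSpace.exists_countable_dense (Mat d)
  have hall : ∀ᵐ y, ∀ a ∈ Da, ∀ l : ℚ, 0 < l → ∀ M ∈ D, ∀ c ∈ D,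
      lpNorm p (avgMeasure (cube a l)) (fun x => ‖v (x, y) * (B (x, y) * M - c)‖ₑ) ≤
        L * lpNorm p (avgMeasure (cube a l)) (fun x => ‖u (x, y) * M‖ₑ) +
          lpNorm p (avgMeasure (cube a l)) (fun x => ‖v (x, y)‖ₑ) *
            ‖(∫ x, B (x, y) ∂(avgMeasure (cube a l))) * M - c‖ₑ := by
    refine (ae_ball_iff hDac).2 fun a _ => ae_all_iff.2 fun l => ae_all_iff.2 fun hl =>
      (ae_ball_iff hDc).2 fun M _ => (ae_ball_iff hDc).2 fun c _ => ?_
    have hl' : (0 : ℝ) < l := by exact_mod_cast hl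
    exact ae_slice_sub_const_le hp hv hu hB hvf huf a hl' M c fun b s hs => h a l hl' b s hs M
  have hvs : ∀ᵐ y, AEStronglyMeasurable (fun x => v (x, y)) volume :=
    AEStronglyMeasurable.prodMk_left (AEStronglyMeasurable.prod_swap hv)
  have hus : ∀ᵐ y, AEStronglyMeasurable (fun x => u (x, y)) volume :=
    AEStronglyMeasurable.prodMk_left (AEStronglyMeasurable.prod_swap hu)
  filter_upwards [hall, hvs, hus, ae_locallyIntegrable_slice hB,
    ae_slice_setLIntegral_ne_top (hv.enorm.pow_const p) hvf,
    ae_slice_setLIntegral_ne_top (hu.enorm.pow_const p) huf] with y hy hvy huy hBy hvfy hufy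
  exact fun a l hl M => lpNorm_cube_le_of_dense hp0 hvy huy hBy hvfy hufy hDa hD hy a hl M

end RectToSlice

/-! ### Comparison of the suprema -/

section Swap

variable {n m d : ℕ} {p : ℝ}

theorem measurePreserving_swap_volume : MeasurePreserving
    (Prod.swap : (Fin n → ℝ) × (Fin m → ℝ) → (Fin m → ℝ) × (Fin n → ℝ)) volume volume :=
  Measure.measurePreserving_swap

theorem measurableEmbedding_swap :
    MeasurableEmbedding (Prod.swap : (Fin n → ℝ) × (Fin m → ℝ) → (Fin m → ℝ) × (Fin n → ℝ)) :=
  MeasurableEquiv.prodComm.measurableEmbedding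

theorem locallyIntegrable_comp_swap {B : (Fin m → ℝ) × (Fin n → ℝ) → Mat d}
    (hB : LocallyIntegrable B volume) :
    LocallyIntegrable (fun z : (Fin n → ℝ) × (Fin m → ℝ) => B z.swap) volume := by
  rw [locallyIntegrable_iff]
  intro K hK
  have h1 := hB.integrableOn_isCompact (hK.image continuous_swap)
  rw [← measurePreserving_swap_volume.integrableOn_comp_preimage measurableEmbedding_swap,
    preimage_image_eq _ Prod.swap_injective] at h1
  exact h1

theorem setLIntegral_comp_swap_ne_top {F : (Fin m → ℝ) × (Fin n → ℝ) → ℝ≥0∞}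
    (hF : ∀ K, IsCompact K → ∫⁻ z in K, F z ≠ ∞) (K : Set ((Fin n → ℝ) × (Fin m → ℝ)))
    (hK : IsCompact K) : ∫⁻ z in K, F z.swap ≠ ∞ := by
  have h1 := hF _ (hK.image continuous_swap)
  rwa [← measurePreserving_swap_volume.setLIntegral_comp_preimage_emb measurableEmbedding_swap,
    preimage_image_eq _ Prod.swap_injective] at h1

end Swap

section Suprema

variable {n m d : ℕ} {p q : ℝ} {v vi u ui B : (Fin n → ℝ) × (Fin m → ℝ) → Mat d}
  {𝓥 𝓥' 𝓤 𝓤' : Set ((Fin n → ℝ) × (Fin m → ℝ)) → Mat d} {K : ℝ≥0}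

theorem isProbabilityMeasure_avgMeasure_rectangle {R : Set ((Fin n → ℝ) × (Fin m → ℝ))}
    (hR : R ∈ rectangles n m) : IsProbabilityMeasure (avgMeasure R) := by
  obtain ⟨r, rfl⟩ := exists_rect_of_mem hR
  exact (rectSystem n m).isProbabilityMeasure_prob r

theorem integrable_avgMeasure_rectangle (hB : LocallyIntegrable B volume)
    {R : Set ((Fin n → ℝ) × (Fin m → ℝ))} (hR : R ∈ rectangles n m) :
    Integrable B (avgMeasure R) := by
  obtain ⟨r, rfl⟩ := exists_rect_of_mem hR
  exact integrable_prob_rect hB r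

theorem iSup_oscTilde_le_iSup_osc
    (hV : ∀ R ∈ rectangles n m, IsRedPair (avgMeasure R) p q v vi (𝓥 R) (𝓥' R) K)
    (hB : LocallyIntegrable B volume) :
    ⨆ R ∈ rectangles n m, oscTilde (avgMeasure R) (𝓥 R) (𝓤 R) B ≤
      (K * K : ℝ≥0) * ⨆ R ∈ rectangles n m, osc (avgMeasure R) p v (𝓤 R) B :=
  iSup₂_le fun R hR => (oscTilde_le_osc (hV R hR) (integrable_avgMeasure_rectangle hB hR)).trans
    (mul_le_mul_right (le_iSup₂ (f := fun R (_ : R ∈ rectangles n m) =>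
      osc (avgMeasure R) p v (𝓤 R) B) R hR) _)

theorem iSup_oscTilde_le_iSup_oscTilde_dual
    (hV : ∀ R ∈ rectangles n m, IsRedPair (avgMeasure R) p q v vi (𝓥 R) (𝓥' R) K)
    (hU : ∀ R ∈ rectangles n m, IsRedPair (avgMeasure R) p q u ui (𝓤 R) (𝓤' R) K) :
    ⨆ R ∈ rectangles n m, oscTilde (avgMeasure R) (𝓥 R) (𝓤 R) B ≤
      (K * (K * K) : ℝ≥0) *
        ⨆ R ∈ rectangles n m, oscTilde (avgMeasure R) (𝓤' R) (𝓥' R) (fun x => (B x)ᴴ) := by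
  refine iSup₂_le fun R hR => ?_
  have := isProbabilityMeasure_avgMeasure_rectangle hR
  exact (oscTilde_le_oscTilde_dual (hV R hR) (hU R hR)).trans
    (mul_le_mul_right (le_iSup₂ (f := fun R (_ : R ∈ rectangles n m) =>
      oscTilde (avgMeasure R) (𝓤' R) (𝓥' R) (fun x => (B x)ᴴ)) R hR) _)

theorem iSup_oscOne_le
    (hV : ∀ R ∈ rectangles n m, IsRedPair (avgMeasure R) p q v vi (𝓥 R) (𝓥' R) K)
    (hU : ∀ R ∈ rectangles n m, IsRedPair (avgMeasure R) p q u ui (𝓤 R) (𝓤' R) K)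
    (hB : LocallyIntegrable B volume) :
    ⨆ R ∈ rectangles n m, oscOne (avgMeasure R) p q v ui B ≤
      (K * K : ℝ≥0) * ((⨆ R ∈ rectangles n m, osc (avgMeasure R) p v (𝓤 R) B) +
        ⨆ R ∈ rectangles n m, osc (avgMeasure R) q ui (𝓥' R) (fun x => (B x)ᴴ)) :=
  iSup₂_le fun R hR => (oscOne_le (hV R hR) (hU R hR)
    (integrable_avgMeasure_rectangle hB hR)).trans (mul_le_mul_right (add_le_add
      (le_iSup₂ (f := fun R (_ : R ∈ rectangles n m) => osc (avgMeasure R) p v (𝓤 R) B) R hR)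
      (le_iSup₂ (f := fun R (_ : R ∈ rectangles n m) =>
        osc (avgMeasure R) q ui (𝓥' R) (fun x => (B x)ᴴ)) R hR)) _)

theorem iSup_oscTilde_le_iSup_oscOne
    (hV : ∀ R ∈ rectangles n m, IsRedPair (avgMeasure R) p q v vi (𝓥 R) (𝓥' R) K)
    (hU : ∀ R ∈ rectangles n m, IsRedPair (avgMeasure R) p q u ui (𝓤 R) (𝓤' R) K)
    (hB : LocallyIntegrable B volume) :
    ⨆ R ∈ rectangles n m, oscTilde (avgMeasure R) (𝓥 R) (𝓤 R) B ≤
      (K * (K * K) : ℝ≥0) * ⨆ R ∈ rectangles n m, oscOne (avgMeasure R) p q v ui B := by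
  refine iSup₂_le fun R hR => ?_
  have := isProbabilityMeasure_avgMeasure_rectangle hR
  exact (oscTilde_le_oscOne (hV R hR) (hU R hR) (integrable_avgMeasure_rectangle hB hR)).trans
    (mul_le_mul_right (le_iSup₂ (f := fun R (_ : R ∈ rectangles n m) =>
      oscOne (avgMeasure R) p q v ui B) R hR) _)

/-- The constant in the John–Nirenberg inequality for rectangles. -/
noncomputable def rectConst (n m : ℕ) (p : ℝ) (K : ℝ≥0) : ℝ≥0 :=
  jnConst p K (Fintype.card ((Fin n → Bool) × (Fin m → Bool))) * K + 1

theorem iSup_osc_le_iSup_oscTilde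
    (hV : ∀ R ∈ rectangles n m, IsRedPair (avgMeasure R) p q v vi (𝓥 R) (𝓥' R) K)
    (hU : ∀ R ∈ rectangles n m, IsRedPair (avgMeasure R) p q u ui (𝓤 R) (𝓤' R) K)
    (hB : LocallyIntegrable B volume) :
    ⨆ R ∈ rectangles n m, osc (avgMeasure R) p v (𝓤 R) B ≤
      rectConst n m p K * ⨆ R ∈ rectangles n m, oscTilde (avgMeasure R) (𝓥 R) (𝓤 R) B := by
  set T := ⨆ R ∈ rectangles n m, oscTilde (avgMeasure R) (𝓥 R) (𝓤 R) B with hT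
  have hC : (rectConst n m p K : ℝ≥0∞) ≠ 0 := by
    rw [rectConst]
    exact_mod_cast (add_pos_of_nonneg_of_pos zero_le one_pos).ne'
  refine iSup₂_le fun R hR => ?_
  rw [mul_comm, ← ENNReal.div_le_iff hC ENNReal.coe_ne_top]
  refine le_of_forall_gt_imp_ge_of_dense fun T' hT' => ?_
  rcases eq_or_ne T' ∞ with rfl | hT'top
  · exact le_top
  lift T' to ℝ≥0 using hT'top
  rw [ENNReal.div_le_iff hC ENNReal.coe_ne_top, mul_comm]
  obtain ⟨r, rfl⟩ := exists_rect_of_mem hR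
  refine ((rectSystem n m).osc_le (fun r => hV _ (rectSystem_set_mem r))
    (fun r => hU _ (rectSystem_set_mem r)) (integrable_prob_rect hB) (ae_tendsto_cellAvg hB)
    (by exact_mod_cast zero_le.trans_lt hT') (fun r => ?_) r).trans ?_
  · exact (le_iSup₂ (f := fun R (_ : R ∈ rectangles n m) =>
      oscTilde (avgMeasure R) (𝓥 R) (𝓤 R) B) _ (rectSystem_set_mem r)).trans hT'.le
  · refine mul_le_mul_left ?_ _
    rw [rectConst]
    exact_mod_cast le_self_add

theorem exists_subset_rectangle {K : Set ((Fin n → ℝ) × (Fin m → ℝ))} (hK : IsCompact K) :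
    ∃ R ∈ rectangles n m, K ⊆ R ∧ volume R ≠ ∞ := by
  obtain ⟨r, hr⟩ := hK.isBounded.subset_closedBall 0
  obtain ⟨s, hs0, hs⟩ : ∃ s : ℝ, 0 ≤ s ∧ r ≤ s := ⟨max r 0, le_max_right _ _, le_max_left _ _⟩
  have hsub : ∀ {k : ℕ}, Metric.closedBall (0 : Fin k → ℝ) s ⊆ cube (fun _ => -s) (2 * s + 1) := by
    intro k x hx
    rw [mem_closedBall_zero_iff, pi_norm_le_iff_of_nonneg hs0] at hx
    refine mem_cube.2 fun i => ?_
    have := abs_le.1 (hx i)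
    constructor <;> linarith
  refine ⟨cube (fun _ => -s) (2 * s + 1) ×ˢ cube (fun _ => -s) (2 * s + 1),
    ⟨_, ⟨_, _, by linarith, rfl⟩, _, ⟨_, _, by linarith, rfl⟩, rfl⟩, ?_, ?_⟩
  · refine hr.trans ((Metric.closedBall_subset_closedBall hs).trans ?_)
    rw [← Prod.mk_zero_zero, ← closedBall_prod_same]
    exact prod_mono hsub hsub
  · rw [volume_prod_set]
    exact ENNReal.mul_ne_top (volume_cube_ne_top _ _) (volume_cube_ne_top _ _)

theorem setLIntegral_ne_top_of_isRedPair
    (hU : ∀ R ∈ rectangles n m, IsRedPair (avgMeasure R) p q u ui (𝓤 R) (𝓤' R) K)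
    (E : Set ((Fin n → ℝ) × (Fin m → ℝ))) (hE : IsCompact E) : ∫⁻ z in E, ‖u z‖ₑ ^ p ≠ ∞ := by
  obtain ⟨R, hR, hER, hRt⟩ := exists_subset_rectangle hE
  refine ne_top_of_le_ne_top (setLIntegral_ne_top_of_avgMeasure hRt ?_) (lintegral_mono_set hER)
  have hp := (hU R hR).holder.pos
  rw [← lpNorm_rpow hp]
  refine ENNReal.rpow_ne_top_of_nonneg hp.le (ne_top_of_le_ne_top ?_
    (by simpa using (hU R hR).red.le 1))
  finiteness

theorem oscTilde_le_of_slices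
    (hV : ∀ R ∈ rectangles n m, IsRedPair (avgMeasure R) p q v vi (𝓥 R) (𝓥' R) K)
    (hU : ∀ R ∈ rectangles n m, IsRedPair (avgMeasure R) p q u ui (𝓤 R) (𝓤' R) K)
    (hB : LocallyIntegrable B volume) (hK : K ≠ 0) {s : ℝ≥0∞}
    {𝓤₁ : (Fin m → ℝ) → Set (Fin n → ℝ) → Mat d} {𝓤₂ : (Fin n → ℝ) → Set (Fin m → ℝ) → Mat d}
    (h₁ : ∀ᵐ y, ∀ P ∈ cubes n, (𝓤₁ y P).PosDef ∧
      IsMatRed (avgMeasure P) p (fun x => u (x, y)) (𝓤₁ y P) K ∧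
      osc (avgMeasure P) p (fun x => v (x, y)) (𝓤₁ y P) (fun x => B (x, y)) ≤ s)
    (h₂ : ∀ᵐ x, ∀ Q ∈ cubes m, (𝓤₂ x Q).PosDef ∧
      IsMatRed (avgMeasure Q) p (fun y => u (x, y)) (𝓤₂ x Q) K ∧
      osc (avgMeasure Q) p (fun y => v (x, y)) (𝓤₂ x Q) (fun y => B (x, y)) ≤ s) :
    ⨆ R ∈ rectangles n m, oscTilde (avgMeasure R) (𝓥 R) (𝓤 R) B ≤ (2 * K ^ 4 : ℝ≥0) * s := by
  refine iSup₂_le fun R hR => ?_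
  rcases eq_or_ne s ∞ with rfl | hs
  · rw [ENNReal.mul_top (by positivity)]
    exact le_top
  lift s to ℝ≥0 using hs
  have hVR := hV R hR
  have hUR := hU R hR
  have hBR := integrable_avgMeasure_rectangle hB hR
  obtain ⟨P, hP, Q, hQ, hRPQ⟩ := hR
  obtain ⟨a, l, hl, hPa⟩ := id hP
  obtain ⟨b, t, ht, hQb⟩ := id hQ
  have hPp : IsProbabilityMeasure (avgMeasure P) :=
    hPa ▸ isProbabilityMeasure_avgMeasure_cube a hl
  have hQp : IsProbabilityMeasure (avgMeasure Q) :=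
    hQb ▸ isProbabilityMeasure_avgMeasure_cube b ht
  have e : avgMeasure R = (avgMeasure P).prod (avgMeasure Q) := by
    rw [hRPQ]
    exact avgMeasure_prod _ _ (hPa ▸ volume_cube_ne_top a l) (hQb ▸ volume_cube_ne_top b t)
  rw [e] at hVR hUR hBR ⊢
  rw [← ENNReal.coe_mul]
  exact oscTilde_prod_le hVR hUR hBR (ae_avgMeasure (h₁.mono fun y hy => hy P hP))
    (ae_avgMeasure (h₂.mono fun x hx => hx Q hQ))

theorem lpNorm_oscillation_le_of_osc_le
    (hU : ∀ R ∈ rectangles n m, IsRedPair (avgMeasure R) p q u ui (𝓤 R) (𝓤' R) K) {L : ℝ≥0}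
    (hL : ∀ R ∈ rectangles n m, osc (avgMeasure R) p v (𝓤 R) B ≤ L)
    {R : Set ((Fin n → ℝ) × (Fin m → ℝ))} (hR : R ∈ rectangles n m) (M : Mat d) :
    lpNorm p (avgMeasure R) (fun z => ‖v z * (B z - ∫ z', B z' ∂(avgMeasure R)) * M‖ₑ) ≤
      (L * K : ℝ≥0) * lpNorm p (avgMeasure R) (fun z => ‖u z * M‖ₑ) := by
  have hp := (hU R hR).holder.pos
  calc _ ≤ lpNorm p (avgMeasure R) (fun z =>
        ‖v z * (B z - ∫ z', B z' ∂(avgMeasure R)) * (𝓤 R)⁻¹‖ₑ * ‖𝓤 R * M‖ₑ) := by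
        refine lpNorm_mono hp.le fun z => le_trans (le_of_eq ?_) (enorm_mat_mul_le _ _)
        rw [Matrix.mul_assoc _ (𝓤 R)⁻¹, ← Matrix.mul_assoc (𝓤 R)⁻¹, (hU R hR).inv_mul,
          Matrix.one_mul]
    _ = osc (avgMeasure R) p v (𝓤 R) B * ‖𝓤 R * M‖ₑ := lpNorm_mul_const hp enorm_ne_top
    _ ≤ L * (K * lpNorm p (avgMeasure R) (fun z => ‖u z * M‖ₑ)) :=
        mul_le_mul' (hL R hR) ((hU R hR).red.ge M)
    _ = _ := by push_cast; ring

theorem osc_slice_le {k : ℕ} {w u' B' : (Fin k → ℝ) → Mat d} {A : Mat d} {P : Set (Fin k → ℝ)}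
    {L : ℝ≥0} (hA : A.PosDef) (hred : IsMatRed (avgMeasure P) p u' A K)
    (h : lpNorm p (avgMeasure P) (fun x => ‖w x * (B' x - ∫ x', B' x' ∂(avgMeasure P)) * A⁻¹‖ₑ) ≤
      L * lpNorm p (avgMeasure P) (fun x => ‖u' x * A⁻¹‖ₑ)) :
    osc (avgMeasure P) p w A B' ≤ (L * K : ℝ≥0) := by
  refine h.trans ?_
  rw [ENNReal.coe_mul]
  refine mul_le_mul_right ((hred.le _).trans ?_) _
  rw [Matrix.mul_nonsing_inv A (A.isUnit_iff_isUnit_det.1 hA.isUnit)]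
  exact mul_le_of_le_one_right' enorm_mat_one_le

theorem ae_osc_slices_le (hv : AEStronglyMeasurable v volume) (hu : AEStronglyMeasurable u volume)
    (hV : ∀ R ∈ rectangles n m, IsRedPair (avgMeasure R) p q v vi (𝓥 R) (𝓥' R) K)
    (hU : ∀ R ∈ rectangles n m, IsRedPair (avgMeasure R) p q u ui (𝓤 R) (𝓤' R) K)
    (hB : LocallyIntegrable B volume) (hp : 1 ≤ p) {L : ℝ≥0}
    (hL : ∀ R ∈ rectangles n m, osc (avgMeasure R) p v (𝓤 R) B ≤ L) :
    (∀ᵐ y, ∀ P ∈ cubes n, ∀ A : Mat d, A.PosDef →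
      IsMatRed (avgMeasure P) p (fun x => u (x, y)) A K →
      osc (avgMeasure P) p (fun x => v (x, y)) A (fun x => B (x, y)) ≤ (L * K * K : ℝ≥0)) ∧
    ∀ᵐ x, ∀ Q ∈ cubes m, ∀ A : Mat d, A.PosDef →
      IsMatRed (avgMeasure Q) p (fun y => u (x, y)) A K →
      osc (avgMeasure Q) p (fun y => v (x, y)) A (fun y => B (x, y)) ≤ (L * K * K : ℝ≥0) := by
  have hrect : ∀ (a : Fin n → ℝ) (l : ℝ), 0 < l → ∀ (b : Fin m → ℝ) (s : ℝ), 0 < s → ∀ M : Mat d,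
      lpNorm p ((avgMeasure (cube a l)).prod (avgMeasure (cube b s))) (fun z => ‖v z *
        (B z - ∫ z', B z' ∂((avgMeasure (cube a l)).prod (avgMeasure (cube b s)))) * M‖ₑ) ≤
      (L * K : ℝ≥0) *
        lpNorm p ((avgMeasure (cube a l)).prod (avgMeasure (cube b s))) (fun z => ‖u z * M‖ₑ) := by
    intro a l hl b s hs M
    rw [← avgMeasure_prod _ _ (volume_cube_ne_top _ _) (volume_cube_ne_top _ _)]
    exact lpNorm_oscillation_le_of_osc_le hU hL
      ⟨_, ⟨a, l, hl, rfl⟩, _, ⟨b, s, hs, rfl⟩, rfl⟩ M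
  have hvf := setLIntegral_ne_top_of_isRedPair hV
  have huf := setLIntegral_ne_top_of_isRedPair hU
  constructor
  · filter_upwards [ae_slice_lpNorm_le hp hv hu hB hvf huf hrect] with y hy
    rintro _ ⟨a, l, hl, rfl⟩ A hA hred
    exact osc_slice_le hA hred (hy a l hl A⁻¹)
  · have hrect' : ∀ (b : Fin m → ℝ) (s : ℝ), 0 < s → ∀ (a : Fin n → ℝ) (l : ℝ), 0 < l →
        ∀ M : Mat d,
        lpNorm p ((avgMeasure (cube b s)).prod (avgMeasure (cube a l))) (fun z => ‖v z.swap *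
          (B z.swap - ∫ z', B z'.swap ∂((avgMeasure (cube b s)).prod (avgMeasure (cube a l)))) *
            M‖ₑ) ≤
        (L * K : ℝ≥0) * lpNorm p ((avgMeasure (cube b s)).prod (avgMeasure (cube a l)))
          (fun z => ‖u z.swap * M‖ₑ) := by
      intro b s hs a l hl M
      have := isProbabilityMeasure_avgMeasure_cube a hl
      have := isProbabilityMeasure_avgMeasure_cube b hs
      rw [lpNorm_comp_measurePreserving measurePreserving_swap_prod measurableEmbedding_swap p
          fun z => ‖u z * M‖ₑ, integral_prod_swap,
        lpNorm_comp_measurePreserving measurePreserving_swap_prod measurableEmbedding_swap p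
          fun z => ‖v z * (B z - ∫ z', B z' ∂((avgMeasure (cube a l)).prod
            (avgMeasure (cube b s)))) * M‖ₑ]
      exact hrect a l hl b s hs M
    filter_upwards [ae_slice_lpNorm_le hp (hv.comp_measurePreserving measurePreserving_swap_volume)
      (hu.comp_measurePreserving measurePreserving_swap_volume) (locallyIntegrable_comp_swap hB)
      (setLIntegral_comp_swap_ne_top hvf) (setLIntegral_comp_swap_ne_top huf) hrect'] with x hx
    rintro _ ⟨b, s, hs, rfl⟩ A hA hred
    exact osc_slice_le hA hred (hx b s hs A⁻¹)

end Suprema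

theorem Comparable.mono {C D : ℝ≥0} (hCD : C ≤ D) {a b : ℝ≥0∞} (h : Comparable C a b) :
    Comparable D a b :=
  ⟨h.1.trans (mul_le_mul_left (by exact_mod_cast hCD) _),
    h.2.trans (mul_le_mul_left (by exact_mod_cast hCD) _)⟩

theorem comparable_of_cycle {D : ℝ≥0} (hD : 1 ≤ D) {a b t t' o w s : ℝ≥0∞}
    (hta : t ≤ D * a) (hat : a ≤ D * t) (htb : t' ≤ D * b) (hbt : b ≤ D * t')
    (htt' : t ≤ D * t') (ht't : t' ≤ D * t) (ho : o ≤ D * (a + b)) (hto : t ≤ D * o)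
    (hw : w ≤ D * (b + a)) (htw : t' ≤ D * w) (hts : t ≤ D * s) (hsa : s ≤ D * a) :
    Comparable (2 * D ^ 4) a s ∧ Comparable (2 * D ^ 4) a b ∧ Comparable (2 * D ^ 4) a t ∧
      Comparable (2 * D ^ 4) a t' ∧ Comparable (2 * D ^ 4) a o ∧ Comparable (2 * D ^ 4) a w := by
  have hpow : ∀ k ≤ 4, D ^ k ≤ 2 * D ^ 4 := fun k hk =>
    (pow_le_pow_right₀ hD hk).trans (le_mul_of_one_le_left' one_le_two)
  have up : ∀ k ≤ 4, ∀ {x y : ℝ≥0∞}, x ≤ (D : ℝ≥0∞) ^ k * y → x ≤ (2 * D ^ 4 : ℝ≥0) * y :=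
    fun k hk x y h => h.trans (mul_le_mul_left (by exact_mod_cast hpow k hk) _)
  have step : ∀ k : ℕ, ∀ {x y z : ℝ≥0∞}, x ≤ D * y → y ≤ (D : ℝ≥0∞) ^ k * z →
      x ≤ (D : ℝ≥0∞) ^ (k + 1) * z := fun k x y z h1 h2 => by
    rw [pow_succ', mul_assoc]
    exact h1.trans (mul_le_mul_right h2 _)
  have one : ∀ {x y : ℝ≥0∞}, x ≤ D * y → x ≤ (D : ℝ≥0∞) ^ 1 * y := fun h => by rwa [pow_one]
  have hba : b ≤ (D : ℝ≥0∞) ^ 3 * a := step 2 hbt (step 1 ht't (one hta))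
  have hsum : D * (a + b) ≤ (2 * D ^ 4 : ℝ≥0) * a := by
    calc (D : ℝ≥0∞) * (a + b) ≤ D * ((D : ℝ≥0∞) ^ 3 * a + (D : ℝ≥0∞) ^ 3 * a) := by
          refine mul_le_mul_right (add_le_add (le_mul_of_one_le_left' ?_) hba) _
          exact_mod_cast one_le_pow₀ hD
      _ = _ := by push_cast; ring
  refine ⟨⟨up 2 (by norm_num) (step 1 hat (one hts)), up 1 (by norm_num) (one hsa)⟩,
    ⟨up 3 (by norm_num) (step 2 hat (step 1 htt' (one htb))), up 3 (by norm_num) hba⟩,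
    ⟨up 1 (by norm_num) (one hat), up 1 (by norm_num) (one hta)⟩,
    ⟨up 2 (by norm_num) (step 1 hat (one htt')), up 2 (by norm_num) (step 1 ht't (one hta))⟩,
    ⟨up 2 (by norm_num) (step 1 hat (one hto)), ho.trans hsum⟩,
    ⟨up 3 (by norm_num) (step 2 hat (step 1 htt' (one htw))), hw.trans ?_⟩⟩
  rwa [add_comm]

/-- A common constant for all weights with `A_p` characteristics at most `k` and `k'`. -/
noncomputable def commonConst (d : ℕ) (p : ℝ) (k k' : ℝ≥0) : ℝ≥0 :=
  redPairConst d p k + redPairConst d p k' + 1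

/-- A constant dominating those in all the basic comparisons. -/
noncomputable def baseConst (n m : ℕ) (p : ℝ) (K : ℝ≥0) : ℝ≥0 :=
  K * K + K * (K * K) + 2 * K ^ 4 + rectConst n m p K + rectConst n m p.conjExponent K + 1

section Slices

variable {n m d : ℕ} {p : ℝ}

theorem aestronglyMeasurable_slices {W : (Fin n → ℝ) × (Fin m → ℝ) → Mat d}
    (hW : AEStronglyMeasurable W volume) :
    (∀ᵐ y, AEStronglyMeasurable (fun x => W (x, y)) volume) ∧
      ∀ᵐ x, AEStronglyMeasurable (fun y => W (x, y)) volume :=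
  ⟨AEStronglyMeasurable.prodMk_left (AEStronglyMeasurable.prod_swap hW),
    AEStronglyMeasurable.prodMk_left hW⟩

theorem isMatRed_of_isReducingFamily {k : ℕ} {W : (Fin k → ℝ) → Mat d} (hp : 1 ≤ p)
    (hW : AEStronglyMeasurable (fun x => mpow (W x) (1 / p)) volume)
    {𝓦 : Set (Fin k → ℝ) → Mat d} (h : IsReducingFamily (cubes k) p W 𝓦) {K : ℝ≥0}
    (hK : redConst d ≤ K) {P : Set (Fin k → ℝ)} (hP : P ∈ cubes k) :
    (𝓦 P).PosDef ∧ IsMatRed (avgMeasure P) p (fun x => mpow (W x) (1 / p)) (𝓦 P) K :=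
  ⟨(h P hP).1, ((h P hP).isMatRed hp
    (hW.mono_ac ProbabilityTheory.cond_absolutelyContinuous)).mono hK⟩

end Slices

end LittleBMO

open LittleBMO in
theorem mainTheorem1 (n m d : ℕ) (hn : 1 ≤ n) (hm : 1 ≤ m) (hd : 1 ≤ d) (p : ℝ) (hp : 1 < p)
    (KU KV : ℝ≥0) :
    ∃ C : ℝ≥0, 0 < C ∧
      ∀ U V B : (Fin n → ℝ) × (Fin m → ℝ) → Mat d,
        IsMatrixAp (rectangles n m) p U → apChar (rectangles n m) p U ≤ KU →
        IsMatrixAp (rectangles n m) p V → apChar (rectangles n m) p V ≤ KV →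
        LocallyIntegrable B volume →
        -- arbitrary choices of the reducing operators of `U`, `V` (exponent `p`) and of the
        -- dual weights `U'`, `V'` (exponent `p'`) over rectangles
        ∀ 𝓤 𝓥 𝓤' 𝓥' : Set ((Fin n → ℝ) × (Fin m → ℝ)) → Mat d,
        IsReducingFamily (rectangles n m) p U 𝓤 →
        IsReducingFamily (rectangles n m) p V 𝓥 →
        IsReducingFamily (rectangles n m) p.conjExponent (dualWeight p U) 𝓤' →
        IsReducingFamily (rectangles n m) p.conjExponent (dualWeight p V) 𝓥' →
        -- arbitrary choices of the reducing operators of the slices `U(·, x₂)` and `U(x₁, ·)`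
        -- over cubes
        ∀ (𝓤₁ : (Fin m → ℝ) → Set (Fin n → ℝ) → Mat d)
          (𝓤₂ : (Fin n → ℝ) → Set (Fin m → ℝ) → Mat d),
        (∀ᵐ x₂, IsReducingFamily (cubes n) p (fun x₁ => U (x₁, x₂)) (𝓤₁ x₂)) →
        (∀ᵐ x₁, IsReducingFamily (cubes m) p (fun x₂ => U (x₁, x₂)) (𝓤₂ x₁)) →
          Comparable C (bmoNorm (rectangles n m) p 𝓤 V B)
            (max
              (essSup (fun x₂ => bmoNorm (cubes n) p (𝓤₁ x₂)
                (fun x₁ => V (x₁, x₂)) (fun x₁ => B (x₁, x₂))) volume)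
              (essSup (fun x₁ => bmoNorm (cubes m) p (𝓤₂ x₁)
                (fun x₂ => V (x₁, x₂)) (fun x₂ => B (x₁, x₂))) volume)) ∧
          Comparable C (bmoNorm (rectangles n m) p 𝓤 V B)
            (bmoNorm (rectangles n m) p.conjExponent 𝓥' (dualWeight p U) (fun x => (B x)ᴴ)) ∧
          Comparable C (bmoNorm (rectangles n m) p 𝓤 V B)
            (bmoTildeNorm (rectangles n m) 𝓤 𝓥 B) ∧
          Comparable C (bmoNorm (rectangles n m) p 𝓤 V B)
            (bmoTildeNorm (rectangles n m) 𝓥' 𝓤' (fun x => (B x)ᴴ)) ∧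
          Comparable C (bmoNorm (rectangles n m) p 𝓤 V B)
            (bmoOneNorm (rectangles n m) p U V B) ∧
          Comparable C (bmoNorm (rectangles n m) p 𝓤 V B)
            (bmoTwoNorm (rectangles n m) p U V B) := by
  set K : ℝ≥0 := commonConst d p KU KV with hK
  have hK1 : 1 ≤ K := le_add_self
  have hUK : redPairConst d p KU ≤ K := le_self_add.trans le_self_add
  have hVK : redPairConst d p KV ≤ K := le_add_self.trans le_self_add
  have hredK : redConst d ≤ K := (le_self_add : _ ≤ redPairConst d p KU).trans hUK
  set D : ℝ≥0 := baseConst n m p K with hD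
  have hD1 : 1 ≤ D := le_add_self
  have hKK : K * K ≤ D := by
    rw [hD, baseConst]; simp only [add_assoc]; exact le_self_add
  have hKKK : K * (K * K) ≤ D := by
    rw [hD, baseConst]; simp only [add_assoc]; exact le_add_left le_self_add
  have hK4 : 2 * K ^ 4 ≤ D := by
    rw [hD, baseConst]; simp only [add_assoc]; exact le_add_left (le_add_left le_self_add)
  have hKp : rectConst n m p K ≤ D := by
    rw [hD, baseConst]; simp only [add_assoc]
    exact le_add_left (le_add_left (le_add_left le_self_add))
  have hKq : rectConst n m p.conjExponent K ≤ D := by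
    rw [hD, baseConst]; simp only [add_assoc]
    exact le_add_left (le_add_left (le_add_left (le_add_left le_self_add)))
  refine ⟨2 * D ^ 4, by positivity, ?_⟩
  intro U V B hU hUk hV hVk hB 𝓤 𝓥 𝓤' 𝓥' h𝓤 h𝓥 h𝓤' h𝓥' 𝓤₁ 𝓤₂ h𝓤₁ h𝓤₂
  have lift : ∀ {c : ℝ≥0}, c ≤ D → ∀ {x y : ℝ≥0∞}, x ≤ c * y → x ≤ D * y :=
    fun hc x y h => h.trans (mul_le_mul_left (by exact_mod_cast hc) _)
  have hUm := hU.1.1.aestronglyMeasurable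
  have hVm := hV.1.1.aestronglyMeasurable
  have rU : ∀ R ∈ rectangles n m, IsRedPair (avgMeasure R) p p.conjExponent
      (fun x => mpow (U x) (1 / p)) (fun x => mpow (U x) (-1 / p)) (𝓤 R) (𝓤' R) K := fun R hR =>
    (isRedPair_of_isReducing hp hR hUm hU.1.2 hUk (h𝓤 R hR) (h𝓤' R hR)).mono hUK
  have rV : ∀ R ∈ rectangles n m, IsRedPair (avgMeasure R) p p.conjExponent
      (fun x => mpow (V x) (1 / p)) (fun x => mpow (V x) (-1 / p)) (𝓥 R) (𝓥' R) K := fun R hR =>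
    (isRedPair_of_isReducing hp hR hVm hV.1.2 hVk (h𝓥 R hR) (h𝓥' R hR)).mono hVK
  have hB' : LocallyIntegrable (fun x => (B x)ᴴ) volume := fun x => by
    obtain ⟨s, hs, hi⟩ := hB x
    exact ⟨s, hs, integrable_conjTranspose hi⟩
  have hum := aestronglyMeasurable_mpow hUm hU.1.2 (1 / p)
  have hvm := aestronglyMeasurable_mpow hVm hV.1.2 (1 / p)
  obtain ⟨hum₁, hum₂⟩ := aestronglyMeasurable_slices hum
  have hr₁ : ∀ᵐ y, ∀ P ∈ cubes n, (𝓤₁ y P).PosDef ∧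
      IsMatRed (avgMeasure P) p (fun x => mpow (U (x, y)) (1 / p)) (𝓤₁ y P) K := by
    filter_upwards [h𝓤₁, hum₁] with y hy hym P hP
    exact isMatRed_of_isReducingFamily hp.le hym hy hredK hP
  have hr₂ : ∀ᵐ x, ∀ Q ∈ cubes m, (𝓤₂ x Q).PosDef ∧
      IsMatRed (avgMeasure Q) p (fun y => mpow (U (x, y)) (1 / p)) (𝓤₂ x Q) K := by
    filter_upwards [h𝓤₂, hum₂] with x hx hxm Q hQ
    exact isMatRed_of_isReducingFamily hp.le hxm hx hredK hQ
  rw [bmoNorm_dual_eq hp hU.1.2, bmoTildeNorm_eq, bmoTildeNorm_eq, bmoOneNorm_eq, bmoTwoNorm_eq]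
  simp only [bmoNorm_eq]
  refine comparable_of_cycle hD1 (lift hKK (iSup_oscTilde_le_iSup_osc rV hB))
    (lift hKp (iSup_osc_le_iSup_oscTilde rV rU hB))
    (lift hKK (iSup_oscTilde_le_iSup_osc (fun R hR => (rU R hR).swap) hB'))
    (lift hKq (iSup_osc_le_iSup_oscTilde (fun R hR => (rU R hR).swap)
      (fun R hR => (rV R hR).swap) hB'))
    (lift hKKK (iSup_oscTilde_le_iSup_oscTilde_dual rV rU))
    ?_ (lift hKK (iSup_oscOne_le rV rU hB))
    (lift hKKK (iSup_oscTilde_le_iSup_oscOne rV rU hB)) ?_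
    (lift hKKK (iSup_oscTilde_le_iSup_oscOne (fun R hR => (rU R hR).swap)
      (fun R hR => (rV R hR).swap) hB'))
    ?_ ?_
  · simpa only [Matrix.conjTranspose_conjTranspose] using
      lift hKKK (iSup_oscTilde_le_iSup_oscTilde_dual (B := fun x => (B x)ᴴ)
        (fun R hR => (rU R hR).swap) (fun R hR => (rV R hR).swap))
  · simpa only [Matrix.conjTranspose_conjTranspose] using
      lift hKK (iSup_oscOne_le (B := fun x => (B x)ᴴ)
        (fun R hR => (rU R hR).swap) (fun R hR => (rV R hR).swap) hB')
  · refine lift hK4 (oscTilde_le_of_slices rV rU hB (zero_lt_one.trans_le hK1).ne'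
      (𝓤₁ := 𝓤₁) (𝓤₂ := 𝓤₂) ?_ ?_)
    · filter_upwards [hr₁, ENNReal.ae_le_essSup (μ := (volume : Measure (Fin m → ℝ)))
        fun y => ⨆ P ∈ cubes n, osc (avgMeasure P) p (fun x => mpow (V (x, y)) (1 / p)) (𝓤₁ y P)
          (fun x => B (x, y))] with y hy hy' P hP
      exact ⟨(hy P hP).1, (hy P hP).2, (le_iSup₂ (f := fun P (_ : P ∈ cubes n) =>
        osc (avgMeasure P) p (fun x => mpow (V (x, y)) (1 / p)) (𝓤₁ y P) (fun x => B (x, y)))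
          P hP).trans (hy'.trans (le_max_left _ _))⟩
    · filter_upwards [hr₂, ENNReal.ae_le_essSup (μ := (volume : Measure (Fin n → ℝ)))
        fun x => ⨆ Q ∈ cubes m, osc (avgMeasure Q) p (fun y => mpow (V (x, y)) (1 / p)) (𝓤₂ x Q)
          (fun y => B (x, y))] with x hx hx' Q hQ
      exact ⟨(hx Q hQ).1, (hx Q hQ).2, (le_iSup₂ (f := fun Q (_ : Q ∈ cubes m) =>
        osc (avgMeasure Q) p (fun y => mpow (V (x, y)) (1 / p)) (𝓤₂ x Q) (fun y => B (x, y)))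
          Q hQ).trans (hx'.trans (le_max_right _ _))⟩
  · rcases eq_or_ne (⨆ R ∈ rectangles n m,
      osc (avgMeasure R) p (fun x => mpow (V x) (1 / p)) (𝓤 R) B) ∞ with htop | htop
    · rw [htop, ENNReal.mul_top (by exact_mod_cast (zero_lt_one.trans_le hD1).ne')]
      exact le_top
    obtain ⟨L, hL⟩ : ∃ L : ℝ≥0, (L : ℝ≥0∞) = ⨆ R ∈ rectangles n m,
        osc (avgMeasure R) p (fun x => mpow (V x) (1 / p)) (𝓤 R) B := ⟨_, ENNReal.coe_toNNReal htop⟩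
    have hosc : ∀ R ∈ rectangles n m,
        osc (avgMeasure R) p (fun x => mpow (V x) (1 / p)) (𝓤 R) B ≤ L := fun R hR => by
      rw [hL]
      exact le_iSup₂ (f := fun R (_ : R ∈ rectangles n m) =>
        osc (avgMeasure R) p (fun x => mpow (V x) (1 / p)) (𝓤 R) B) R hR
    obtain ⟨hs₁, hs₂⟩ := ae_osc_slices_le hvm hum rV rU hB hp.le hosc
    rw [← hL]
    have hLD : ((L * K * K : ℝ≥0) : ℝ≥0∞) ≤ D * L := by
      rw [mul_assoc, mul_comm]
      exact_mod_cast mul_le_mul_left hKK L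
    refine max_le (essSup_le_of_ae_le _ ?_) (essSup_le_of_ae_le _ ?_)
    · filter_upwards [hs₁, hr₁] with y hy hy'
      exact iSup₂_le fun P hP => (hy P hP _ (hy' P hP).1 (hy' P hP).2).trans hLD
    · filter_upwards [hs₂, hr₂] with x hx hx'
      exact iSup₂_le fun Q hQ => (hx Q hQ _ (hx' Q hQ).1 (hx' Q hQ).2).trans hLD
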